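/- Let $\alpha>0$ and let $d_1,d_2,\dots$ and $b_1,b_2,\dots$ be real random variables, all independent, with finite moments of all orders. Let $A_n$ be the symmetric tridiagonal $n\times n$ matrix with diagonal $(d_n,d_{n-1},\dots,d_1)$ and off-diagonal $(b_{n-1},b_{n-2},\dots,b_1)$, let $X_n=n^{-\alpha}A_n$, and let $\mathrm{tr}_n(Y)=\frac1n\sum_{i=1}^n Y_{ii}$. Assume that $$\lim_{n\to\infty}\mathbb E\big[(b_n/n^{\alpha})^k\big]=m_k\quad\text{and}\quad \sup_{n\ge1}\mathbb E\big[|d_n|^k\big]<\infty\qquad\text{for all } k\ge 0,\quad m_0=1,$$ that $\lim_{n\to\infty}\mathrm{var}(d_n)=\sigma_d^2$, and that there is $0\le\epsilon\le\alpha$ such that the variables $z_n^k=n^{\epsilon}\big((b_n/n^{\alpha})^k-\mathbb E[(b_n/n^{\alpha})^k]\big)$ ($k$ is an upper index of $z$) satisfy $$\lim_{n\to\infty}\mathrm{cov}(z_n^k,z_n^l)=C(k,l)\ \text{ for all even } k,l\ge0,\qquad \sup_{n\ge1}\mathbb E\big[|z_n^k|^r\big]<\infty\ \text{ for all } k,r\ge1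 .$$ A path of length $k$ is a string $\gamma=(j_1,\dots,j_{k+1})$ of integers with $j_1=j_{k+1}$ and $|j_u-j_{u+1}|\le 1$ for $1\le u\le k$; a step is flat if $j_u=j_{u+1}$; $\max\gamma=\max_u j_u$; and $\ell_i(\gamma)$ is the number of steps of $\gamma$ that cross the line $y=i+\frac12$. For $k,l\ge 2$ even let $\Gamma(k,l)$ be the finite set of pairs $(\gamma_1,\gamma_2)$ of paths of lengths $k$ and $l$ without flat steps, with $\max(\max\gamma_1,\max\gamma_2)=0$ and with $\ell_i(\gamma_1)\ne0\ne\ell_i(\gamma_2)$ for some $i$. For $k,l\ge1$ define $D(k,l)$ as follows. - For $k,l$ even and $\epsilon=0$: $$D(k,l)=\frac{1}{\alpha(k+l)+1}\sum_{(\gamma_1,\gamma_2)\in\Gamma(k,l)}\Big(\prod_{h<0}m_{\ell_h(\gamma_1)+\ell_h(\gamma_2)}-\prod_{h<0}m_{\ell_h(\gamma_1)}m_{\ell_h(\gamma_2)}\Big).$$ - For $k,l$ even and $0<\epsilon\le\alpha$: $$D(k,l)=\frac{1}{\alpha(k+l)+1-2\epsilon}\sum_{(\gamma_1,\gamma_2)\in\Gamma(k,l)}\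 \sum_{i<0}C\big(\ell_i(\gamma_1),\ell_i(\gamma_2)\big)\,m_2^{(k+l-\ell_i(\gamma_1)-\ell_i(\gamma_2))/2}\qquad(0^0=1).$$ - For $k,l$ odd and $\epsilon=\alpha$: $$D(k,l)=\frac{kl\,\sigma_d^2\,m_2^{(k+l-2)/2}}{\alpha(k+l)+1-2\alpha}\binom{k-1}{\frac{k-1}2}\binom{l-1}{\frac{l-1}2}.$$ - In all other cases $D(k,l)=0$. For a real polynomial $P(x)=w_0+w_1x+\dots+w_Nx^N$ let $S_n(P)=n^{\epsilon+1/2}\big(\mathrm{tr}_n(P(X_n))-\mathbb E[\mathrm{tr}_n(P(X_n))]\big)$ and $\sigma(P)^2=\sum_{k,l=1}^N w_kw_lD(k,l)$. Then $\sigma(P)^2\ge0$ and, in distribution and with all moments, $$S_n(P)\longrightarrow N\big(0,\sigma(P)^2\big)\qquad(n\to\infty).$$ In particular, with $S_n(k)=S_n(x^k)$, the family $\{S_n(k)\}_{k\ge1}$ converges in (joint) moments to a centred Gaussian family $\{S(k)\}_{k\ge1}$ with covariance function $D(k,l)$, and for each $k\ge1$, $S_n(k)$ converges, in distribution and with all moments,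 to $N(0,D(k,k))$. -/

import Mathlib

open MeasureTheory ProbabilityTheory Filter Topology

namespace Tridiag

noncomputable section

/-! ### The matrix model -/

/-- The `n × n` symmetric tridiagonal matrix with diagonal `d_n, d_{n-1}, …, d_1` (from top to
bottom) and off-diagonal `b_{n-1}, b_{n-2}, …, b_1`.  Rows and columns are numbered from `0`. -/
def matA (d b : ℕ → ℝ) (n : ℕ) : Matrix (Fin n) (Fin n) ℝ := fun i j =>
  if i = j then d (n - i)
  else if (i : ℕ) + 1 = j then b (n - j)
  else if (j : ℕ) + 1 = i then b (n - i)
  else 0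

/-- The rescaled matrix `X_n = n^{-α} A_n`. -/
def matX (α : ℝ) (d b : ℕ → ℝ) (n : ℕ) : Matrix (Fin n) (Fin n) ℝ :=
  ((n : ℝ) ^ α)⁻¹ • matA d b n

/-- The reduced trace `tr_n (P(X_n)) = (1/n) ∑ᵢ P(X_n)ᵢᵢ`, as a random variable. -/
def trP {Ω : Type*} (α : ℝ) (d b : ℕ → Ω → ℝ) (P : Polynomial ℝ) (n : ℕ) (ω : Ω) : ℝ :=
  (1 / (n : ℝ)) *
    (Polynomial.aeval (matX α (fun i => d i ω) (fun i => b i ω) n) P).trace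

/-- The rescaled fluctuation
`S_n(P) = n^{ε+1/2} (tr_n P(X_n) - E[tr_n P(X_n)])`. -/
def fluct {Ω : Type*} [MeasurableSpace Ω] (μ : Measure Ω) (α ε : ℝ) (d b : ℕ → Ω → ℝ)
    (P : Polynomial ℝ) (n : ℕ) (ω : Ω) : ℝ :=
  (n : ℝ) ^ (ε + 1 / 2) * (trP α d b P n ω - ∫ ω', trP α d b P n ω' ∂μ)

/-- The normalized fluctuation `z_n^k = n^ε ((b_n/n^α)^k - E[(b_n/n^α)^k])` (`k` is an upper
index of `z`, not an exponent). -/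
def zfl {Ω : Type*} [MeasurableSpace Ω] (μ : Measure Ω) (α ε : ℝ) (b : ℕ → Ω → ℝ)
    (n k : ℕ) (ω : Ω) : ℝ :=
  (n : ℝ) ^ ε * ((b n ω / (n : ℝ) ^ α) ^ k - ∫ ω', (b n ω' / (n : ℝ) ^ α) ^ k ∂μ)

/-! ### Paths -/

/-- The strings `(j_1, …, j_{k+1})` of integers with `j_1 = j_{k+1}` and `|j_u - j_{u+1}| ≤ 1`. -/
def IsPath {k : ℕ} (γ : Fin (k + 1) → ℤ) : Prop :=
  γ 0 = γ (Fin.last k) ∧ ∀ u : Fin k, |γ u.castSucc - γ u.succ| ≤ 1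

/-- The maximal level of a path. -/
def pathMax {k : ℕ} (γ : Fin (k + 1) → ℤ) : ℤ :=
  Finset.univ.sup' Finset.univ_nonempty γ

/-- The number of times the path crosses the line `y = i + 1/2`. -/
def crossings {k : ℕ} (i : ℤ) (γ : Fin (k + 1) → ℤ) : ℕ :=
  (Finset.univ.filter fun u : Fin k =>
    (γ u.castSucc = i ∧ γ u.succ = i + 1) ∨ (γ u.castSucc = i + 1 ∧ γ u.succ = i)).card

/-- The number of flat steps of the path at level `i`. -/
def flats {k : ℕ} (i : ℤ) (γ : Fin (k + 1) → ℤ) : ℕ :=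
  (Finset.univ.filter fun u : Fin k => γ u.castSucc = i ∧ γ u.succ = i).card

/-- Two paths share a level. -/
def ShareLevel {k l : ℕ} (γ₁ : Fin (k + 1) → ℤ) (γ₂ : Fin (l + 1) → ℤ) : Prop :=
  ∃ i : ℤ, (crossings i γ₁ ≠ 0 ∧ crossings i γ₂ ≠ 0) ∨ (flats i γ₁ ≠ 0 ∧ flats i γ₂ ≠ 0)

/-- The pairs of paths without flat steps, of lengths `k` and `l`, that share a level and whose
joint maximum is `0`. -/
def pairSet (k l : ℕ) : Set ((Fin (k + 1) → ℤ) × (Fin (l + 1) → ℤ)) :=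
  {p | IsPath p.1 ∧ IsPath p.2 ∧ max (pathMax p.1) (pathMax p.2) = 0 ∧
    ShareLevel p.1 p.2 ∧ (∀ i, flats i p.1 = 0) ∧ (∀ i, flats i p.2 = 0)}

theorem IsPath.abs_sub_le {k : ℕ} {γ : Fin (k + 1) → ℤ} (h : IsPath γ) (u v : Fin (k + 1)) :
    |γ u - γ v| ≤ k := by
  have key : ∀ (m : ℕ) (a : ℕ) (ha : a + m < k + 1),
      |γ ⟨a + m, ha⟩ - γ ⟨a, by omega⟩| ≤ m := by
    intro m
    induction m with
    | zero => intro a ha; simp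
    | succ m ih =>
      intro a ha
      have h1 := ih a (by omega)
      have h2 := h.2 ⟨a + m, by omega⟩
      have e1 : (⟨a + m, by omega⟩ : Fin k).castSucc = ⟨a + m, by omega⟩ := rfl
      have e2 : (⟨a + m, by omega⟩ : Fin k).succ = ⟨a + (m + 1), ha⟩ := rfl
      rw [e1, e2] at h2
      rw [abs_le] at *
      push_cast
      constructor <;> linarith [h1.1, h1.2, h2.1, h2.2]
  have key2 : ∀ a c : Fin (k + 1), a ≤ c → |γ c - γ a| ≤ k := by
    intro a c hac
    have hac' : (a : ℕ) ≤ c := hac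
    have hc := c.2
    have h1 := key (c - a) a (by omega)
    have e1 : (⟨(a : ℕ) + (c - a), by omega⟩ : Fin (k + 1)) = c := by ext; simp; omega
    rw [e1] at h1
    refine h1.trans ?_
    have : (c : ℕ) - a ≤ k := by omega
    exact_mod_cast this
  rcases le_total u v with huv | huv
  · rw [abs_sub_comm]; exact key2 u v huv
  · exact key2 v u huv

theorem exists_of_crossings {k : ℕ} {γ : Fin (k + 1) → ℤ} {i : ℤ} (h : crossings i γ ≠ 0) :
    ∃ u, γ u = i := by
  rw [crossings, Finset.card_ne_zero] at h
  obtain ⟨u, hu⟩ := h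
  rw [Finset.mem_filter] at hu
  rcases hu.2 with h | h
  · exact ⟨_, h.1⟩
  · exact ⟨_, h.2⟩

theorem le_pathMax {k : ℕ} (γ : Fin (k + 1) → ℤ) (u : Fin (k + 1)) : γ u ≤ pathMax γ :=
  Finset.le_sup' γ (Finset.mem_univ u)

theorem exists_pathMax {k : ℕ} (γ : Fin (k + 1) → ℤ) : ∃ u, γ u = pathMax γ := by
  obtain ⟨u, _, hu⟩ := Finset.exists_mem_eq_sup' (Finset.univ_nonempty) γ
  exact ⟨u, hu.symm⟩

/-- All levels of a pair in `pairSet k l` lie between `-(k+l)` and `0`. -/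
theorem pairSet_bounds {k l : ℕ} {p : (Fin (k + 1) → ℤ) × (Fin (l + 1) → ℤ)}
    (hp : p ∈ pairSet k l) :
    (∀ u, -((k + l : ℕ) : ℤ) ≤ p.1 u ∧ p.1 u ≤ 0) ∧
      (∀ u, -((k + l : ℕ) : ℤ) ≤ p.2 u ∧ p.2 u ≤ 0) := by
  obtain ⟨h1, h2, hm, ⟨i, hi⟩, f1, f2⟩ := hp
  have hi' : crossings i p.1 ≠ 0 ∧ crossings i p.2 ≠ 0 := by
    rcases hi with hi | hi
    · exact hi
    · exact absurd (f1 i) hi.1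
  obtain ⟨a, ha⟩ := exists_of_crossings hi'.1
  obtain ⟨c, hc⟩ := exists_of_crossings hi'.2
  have m1 : pathMax p.1 ≤ 0 := hm ▸ le_max_left _ _
  have m2 : pathMax p.2 ≤ 0 := hm ▸ le_max_right _ _
  obtain ⟨a', ha'⟩ := exists_pathMax p.1
  obtain ⟨c', hc'⟩ := exists_pathMax p.2
  have A : ∀ u v, p.1 u - p.1 v ≤ k := fun u v => (abs_le.1 (h1.abs_sub_le u v)).2
  have B : ∀ u v, p.2 u - p.2 v ≤ l := fun u v => (abs_le.1 (h2.abs_sub_le u v)).2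
  have hk : (0 : ℤ) ≤ k := Int.natCast_nonneg k
  have hl : (0 : ℤ) ≤ l := Int.natCast_nonneg l
  have hcase : pathMax p.1 = 0 ∨ pathMax p.2 = 0 := by
    rcases max_choice (pathMax p.1) (pathMax p.2) with h | h
    · left; rw [← h, hm]
    · right; rw [← h, hm]
  push_cast
  constructor
  · intro u
    refine ⟨?_, (le_pathMax p.1 u).trans m1⟩
    rcases hcase with h | h
    · linarith [A a' u]
    · linarith [A a u, B c' c]
  · intro u
    refine ⟨?_, (le_pathMax p.2 u).trans m2⟩
    rcases hcase with h | h
    · linarith [B c u, A a' a]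
    · linarith [B c' u]

theorem pairSet_finite (k l : ℕ) : (pairSet k l).Finite := by
  have hf : ((Set.univ.pi fun _ : Fin (k + 1) => Set.Icc (-((k + l : ℕ) : ℤ)) 0) ×ˢ
      (Set.univ.pi fun _ : Fin (l + 1) => Set.Icc (-((k + l : ℕ) : ℤ)) 0)).Finite :=
    (Set.Finite.pi fun _ => Set.finite_Icc _ _).prod (Set.Finite.pi fun _ => Set.finite_Icc _ _)
  refine hf.subset fun p hp => ?_
  exact ⟨fun u _ => (pairSet_bounds hp).1 u, fun u _ => (pairSet_bounds hp).2 u⟩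

/-- The finite set of pairs of paths that indexes the covariance. -/
def pairs (k l : ℕ) : Finset ((Fin (k + 1) → ℤ) × (Fin (l + 1) → ℤ)) :=
  (pairSet_finite k l).toFinset

/-- The negative levels that a pair in `pairs k l` can cross; at all other negative levels both
crossing numbers vanish. -/
def levels (k l : ℕ) : Finset ℤ := Finset.Ico (-((k + l : ℕ) : ℤ)) 0

/-! ### The limiting covariance -/

/-- The limiting covariance for `k`, `l` even and `ε = 0`. -/
def covZero (α : ℝ) (m : ℕ → ℝ) (k l : ℕ) : ℝ :=
  1 / (α * (k + l) + 1) * ∑ p ∈ pairs k l,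
    ((∏ h ∈ levels k l, m (crossings h p.1 + crossings h p.2)) -
      ∏ h ∈ levels k l, m (crossings h p.1) * m (crossings h p.2))

/-- The limiting covariance for `k`, `l` even and `0 < ε ≤ α`.  The crossing numbers of closed
paths are even, at most `k` and `l` respectively, so that the exponent of `m 2` is
`(k + l - crossings i γ₁ - crossings i γ₂) / 2`, without truncation. -/
def covEven (α ε : ℝ) (m : ℕ → ℝ) (C : ℕ → ℕ → ℝ) (k l : ℕ) : ℝ :=
  1 / (α * (k + l) + 1 - 2 * ε) * ∑ p ∈ pairs k l, ∑ i ∈ levels k l,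
    C (crossings i p.1) (crossings i p.2) *
      m 2 ^ ((k + l - (crossings i p.1 + crossings i p.2)) / 2)

/-- The limiting covariance for `k`, `l` odd and `ε = α`; `v` is the limiting variance of the
diagonal entries. -/
def covOdd (α : ℝ) (m : ℕ → ℝ) (v : ℝ) (k l : ℕ) : ℝ :=
  (k * l * v * m 2 ^ ((k + l - 2) / 2)) / (α * (k + l) + 1 - 2 * α) *
    ((k - 1).choose ((k - 1) / 2) : ℝ) * ((l - 1).choose ((l - 1) / 2) : ℝ)

open Classical in
/-- The limiting covariance `D(k,l)`. -/
def covD (α ε : ℝ) (m : ℕ → ℝ) (C : ℕ → ℕ → ℝ) (v : ℝ) (k l : ℕ) : ℝ :=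
  if Even k ∧ Even l then
    if ε = 0 then covZero α m k l else covEven α ε m C k l
  else if Odd k ∧ Odd l ∧ ε = α then covOdd α m v k l
  else 0

/-- The limiting variance `σ(P)² = ∑_{k,l ≥ 1} w_k w_l D(k,l)` for `P = ∑ w_k x^k`. -/
def varP (α ε : ℝ) (m : ℕ → ℝ) (C : ℕ → ℕ → ℝ) (v : ℝ) (P : Polynomial ℝ) : ℝ :=
  ∑ k ∈ Finset.Icc 1 P.natDegree, ∑ l ∈ Finset.Icc 1 P.natDegree,
    P.coeff k * P.coeff l * covD α ε m C v k l

/-! ### Convergence to a centred normal law -/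

/-- `Y_n` converges, in distribution and with all moments, to the centred normal law of
variance `s` (a point mass if `s = 0`). -/
def TendstoNormal {Ω : Type*} [MeasurableSpace Ω] (μ : Measure Ω) [IsProbabilityMeasure μ]
    (Y : ℕ → Ω → ℝ) (s : ℝ) : Prop :=
  0 ≤ s ∧
  TendstoInDistribution Y atTop id (fun _ => μ) (gaussianReal 0 s.toNNReal) ∧
  ∀ j : ℕ, (∀ n, Integrable (fun ω => Y n ω ^ j) μ) ∧
    Tendsto (fun n => ∫ ω, Y n ω ^ j ∂μ) atTop (𝓝 (∫ x, x ^ j ∂gaussianReal 0 s.toNNReal))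

end

end Tridiag

/-! Expand `tr (A_n ^ k)` over closed paths: a flat step at level `i` reads `d_i`, a crossing of the
line `i + 1/2` reads `b_i`. Group the paths by starting level. A path of length at most `deg P`
reads only entries within `deg P` of its start, so `S_n(P)` is a row sum of centred local terms that
are independent at distance more than `2 deg P` (`Entries.locallyDependent`). Each local term has
size `n^{-1/2}`: rescaled entries differ from bounded constants by `O(n^{-ε})` in every moment, and
this property is stable under products (`Concentrated`, `Entries.concentrated_pathVar`).

For such arrays, expanding one factor of `S^{q+2}` and discarding the part of the sum far from it
yields `E S^{q+2} = (q+1) E S^2 E S^q + o(1)` (`LocallyDependent.tendsto_moment_recursion`), once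
the moments are known to be bounded (`LocallyDependent.bdd_rowSum`). Gaussian moments satisfy the
exact recursion, so convergence of the variance gives convergence of all moments, and Taylor
expansion of characteristic functions gives convergence in law.

It remains to find the limiting variance. Pairs of paths that share no level are uncorrelated. The
others are sorted by their joint maximum `i`; up to translation there are finitely many, so the
increment at `i` is asymptotic to a constant times `i^{α(k+l)-2ε}`, and a Stolz-Cesàro summation
supplies the factor `1/(α(k+l)+1-2ε)`. Each flat step costs `i^{-α}`. Hence only two kinds of pairs
survive: those without flat steps, through covariances of powers of `b`, and, if `ε = α`, those with
one flat step each at a common level, through the variance of `d`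
(`Entries.tendsto_rpow_mul_cov_pathVar`). The parity of the number of flat steps is that of the
length, which produces the cases of `D(k,l)` (`Entries.sum_pairLimit_div`).

Nonnegativity of `σ(P)²` is inherited from the variances. It makes `D` a positive semidefinite form
on polynomials; a triangular Gram factorization realizes it by independent standard normals, and
polarization reduces mixed moments to powers of a single `S_n(P)`. -/

namespace Tridiag

/-! ### Families with uniformly bounded moments -/

/-- A family of random variables whose absolute moments of each order are bounded uniformly over
the family. -/
def BddMoments {Ω : Type*} [MeasurableSpace Ω] (μ : Measure Ω) {I : Type*} (x : I → Ω → ℝ) :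
    Prop :=
  (∀ i, Measurable (x i)) ∧
    ∀ r : ℕ, ∃ K : ℝ, ∀ i, Integrable (fun ω => |x i ω| ^ r) μ ∧ ∫ ω, |x i ω| ^ r ∂μ ≤ K

namespace BddMoments

variable {Ω : Type*} [MeasurableSpace Ω] {μ : Measure Ω} {I : Type*} {x y : I → Ω → ℝ}

theorem measurable (hx : BddMoments μ x) (i : I) : Measurable (x i) := hx.1 i

theorem integrable_abs_pow (hx : BddMoments μ x) (i : I) (r : ℕ) :
    Integrable (fun ω => |x i ω| ^ r) μ :=
  let ⟨_, hK⟩ := hx.2 r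
  (hK i).1

theorem integrable_pow (hx : BddMoments μ x) (i : I) (r : ℕ) :
    Integrable (fun ω => x i ω ^ r) μ :=
  (hx.integrable_abs_pow i r).mono' ((hx.measurable i).pow_const r).aestronglyMeasurable
    (Eventually.of_forall fun ω => by rw [Real.norm_eq_abs, abs_pow])

theorem integrable (hx : BddMoments μ x) (i : I) : Integrable (x i) μ := by
  simpa using hx.integrable_pow i 1

theorem memLp_two (hx : BddMoments μ x) (i : I) : MemLp (x i) 2 μ :=
  (memLp_two_iff_integrable_sq (hx.measurable i).aestronglyMeasurable).2 (hx.integrable_pow i 2)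

theorem exists_abs_integral_le (hx : BddMoments μ x) : ∃ K : ℝ, 0 ≤ K ∧ ∀ i, |∫ ω, x i ω ∂μ| ≤ K := by
  obtain ⟨K, hK⟩ := hx.2 1
  refine ⟨max K 0, le_max_right _ _, fun i => ?_⟩
  have h := (hK i).2
  simp only [pow_one] at h
  exact (abs_integral_le_integral_abs.trans h).trans (le_max_left _ _)

theorem of_le {C : ℝ} (hy : ∀ i, Measurable (y i)) (hx : BddMoments μ x)
    (h : ∀ i ω, |y i ω| ≤ C * |x i ω|) : BddMoments μ y := by
  refine ⟨hy, fun r => ?_⟩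
  obtain ⟨K, hK⟩ := hx.2 r
  have hle : ∀ i ω, |y i ω| ^ r ≤ |C| ^ r * |x i ω| ^ r := fun i ω => by
    rw [← mul_pow]
    refine pow_le_pow_left₀ (abs_nonneg _) ((h i ω).trans ?_) r
    exact mul_le_mul_of_nonneg_right (le_abs_self C) (abs_nonneg _)
  refine ⟨|C| ^ r * K, fun i => ?_⟩
  have hint : Integrable (fun ω => |C| ^ r * |x i ω| ^ r) μ := (hK i).1.const_mul _
  have hy' : Integrable (fun ω => |y i ω| ^ r) μ :=
    hint.mono' ((hy i).abs.pow_const r).aestronglyMeasurable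
      (Eventually.of_forall fun ω => by
        rw [Real.norm_eq_abs, abs_of_nonneg (by positivity)]; exact hle i ω)
  refine ⟨hy', (integral_mono hy' hint (hle i)).trans ?_⟩
  rw [integral_const_mul]
  exact mul_le_mul_of_nonneg_left (hK i).2 (by positivity)

theorem reindex {J : Type*} (hx : BddMoments μ x) (φ : J → I) :
    BddMoments μ (fun j => x (φ j)) :=
  ⟨fun _ => hx.1 _, fun r => let ⟨K, hK⟩ := hx.2 r; ⟨K, fun _ => hK _⟩⟩

theorem add (hx : BddMoments μ x) (hy : BddMoments μ y) :
    BddMoments μ (fun i ω => x i ω + y i ω) := by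
  refine ⟨fun i => (hx.1 i).add (hy.1 i), fun r => ?_⟩
  obtain ⟨K, hK⟩ := hx.2 r
  obtain ⟨K', hK'⟩ := hy.2 r
  refine ⟨2 ^ (r - 1) * (K + K'), fun i => ?_⟩
  have hle : ∀ ω, |x i ω + y i ω| ^ r ≤ 2 ^ (r - 1) * (|x i ω| ^ r + |y i ω| ^ r) := fun ω =>
    (pow_le_pow_left₀ (abs_nonneg _) (abs_add_le _ _) r).trans
      (add_pow_le (abs_nonneg _) (abs_nonneg _) r)
  have hint : Integrable (fun ω => 2 ^ (r - 1) * (|x i ω| ^ r + |y i ω| ^ r)) μ :=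
    ((hK i).1.add (hK' i).1).const_mul _
  have hxy : Integrable (fun ω => |x i ω + y i ω| ^ r) μ :=
    hint.mono' (((hx.1 i).add (hy.1 i)).abs.pow_const r).aestronglyMeasurable
      (Eventually.of_forall fun ω => by
        rw [Real.norm_eq_abs, abs_of_nonneg (by positivity)]; exact hle ω)
  refine ⟨hxy, (integral_mono hxy hint hle).trans ?_⟩
  rw [integral_const_mul, integral_add (hK i).1 (hK' i).1]
  exact mul_le_mul_of_nonneg_left (add_le_add (hK i).2 (hK' i).2) (by positivity)

theorem mul (hx : BddMoments μ x) (hy : BddMoments μ y) :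
    BddMoments μ (fun i ω => x i ω * y i ω) := by
  refine ⟨fun i => (hx.1 i).mul (hy.1 i), fun r => ?_⟩
  obtain ⟨K, hK⟩ := hx.2 (2 * r)
  obtain ⟨K', hK'⟩ := hy.2 (2 * r)
  refine ⟨K + K', fun i => ?_⟩
  have hle : ∀ ω, |x i ω * y i ω| ^ r ≤ |x i ω| ^ (2 * r) + |y i ω| ^ (2 * r) := fun ω => by
    rw [abs_mul, mul_pow, mul_comm 2 r, pow_mul, pow_mul]
    have h1 : 0 ≤ |x i ω| ^ r := by positivity
    have h2 : 0 ≤ |y i ω| ^ r := by positivity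
    nlinarith [sq_nonneg (|x i ω| ^ r - |y i ω| ^ r)]
  have hint : Integrable (fun ω => |x i ω| ^ (2 * r) + |y i ω| ^ (2 * r)) μ :=
    (hK i).1.add (hK' i).1
  have hxy : Integrable (fun ω => |x i ω * y i ω| ^ r) μ :=
    hint.mono' (((hx.1 i).mul (hy.1 i)).abs.pow_const r).aestronglyMeasurable
      (Eventually.of_forall fun ω => by
        rw [Real.norm_eq_abs, abs_of_nonneg (by positivity)]; exact hle ω)
  refine ⟨hxy, (integral_mono hxy hint hle).trans ?_⟩
  rw [integral_add (hK i).1 (hK' i).1]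
  exact add_le_add (hK i).2 (hK' i).2

theorem const_mul {c : I → ℝ} {C : ℝ} (hc : ∀ i, |c i| ≤ C) (hx : BddMoments μ x) :
    BddMoments μ (fun i ω => c i * x i ω) :=
  hx.of_le (C := C) (fun i => (hx.1 i).const_mul _) fun i ω => by
    rw [abs_mul]; exact mul_le_mul_of_nonneg_right (hc i) (abs_nonneg _)

theorem neg (hx : BddMoments μ x) : BddMoments μ (fun i ω => -x i ω) :=
  hx.of_le (C := 1) (fun i => (hx.1 i).neg) fun i ω => by simp

theorem sub (hx : BddMoments μ x) (hy : BddMoments μ y) :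
    BddMoments μ (fun i ω => x i ω - y i ω) := by
  simpa only [sub_eq_add_neg] using hx.add hy.neg

theorem abs (hx : BddMoments μ x) : BddMoments μ (fun i ω => |x i ω|) :=
  hx.of_le (C := 1) (fun i => (hx.1 i).abs) fun i ω => by simp

variable [IsProbabilityMeasure μ]

theorem const {c : I → ℝ} {C : ℝ} (hc : ∀ i, |c i| ≤ C) :
    BddMoments μ (fun i (_ : Ω) => c i) := by
  refine ⟨fun i => measurable_const, fun r => ⟨C ^ r, fun i => ⟨integrable_const _, ?_⟩⟩⟩
  simpa using pow_le_pow_left₀ (abs_nonneg _) (hc i) r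

theorem pow (hx : BddMoments μ x) (k : ℕ) : BddMoments μ (fun i ω => x i ω ^ k) := by
  induction k with
  | zero => simpa using const (μ := μ) (c := fun _ : I => (1 : ℝ)) (C := 1) (by simp)
  | succ k ih => simpa only [pow_succ] using ih.mul hx

theorem sum {κ : Type*} (s : Finset κ) {z : κ → I → Ω → ℝ} (h : ∀ a ∈ s, BddMoments μ (z a)) :
    BddMoments μ (fun i ω => ∑ a ∈ s, z a i ω) := by
  classical
  induction s using Finset.induction_on with
  | empty => simpa using const (μ := μ) (c := fun _ : I => (0 : ℝ)) (C := 0) (by simp)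
  | insert a s ha ih =>
    simp only [Finset.sum_insert ha]
    exact (h a (Finset.mem_insert_self _ _)).add
      (ih fun c hc => h c (Finset.mem_insert_of_mem hc))

theorem prod {κ : Type*} (s : Finset κ) {z : κ → I → Ω → ℝ} (h : ∀ a ∈ s, BddMoments μ (z a)) :
    BddMoments μ (fun i ω => ∏ a ∈ s, z a i ω) := by
  classical
  induction s using Finset.induction_on with
  | empty => simpa using const (μ := μ) (c := fun _ : I => (1 : ℝ)) (C := 1) (by simp)
  | insert a s ha ih =>
    simp only [Finset.prod_insert ha]
    exact (h a (Finset.mem_insert_self _ _)).mul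
      (ih fun c hc => h c (Finset.mem_insert_of_mem hc))

/-- A family each of whose members is zero or belongs to a family with bounded moments. -/
theorem of_eq_zero_or {J : Type*} {z : J → Ω → ℝ} (hx : BddMoments μ x)
    (h : ∀ j, z j = 0 ∨ ∃ i, z j = x i) : BddMoments μ z := by
  refine ⟨fun j => ?_, fun r => ?_⟩
  · rcases h j with h | ⟨i, h⟩
    · rw [h]; exact measurable_const
    · rw [h]; exact hx.1 i
  · obtain ⟨K, hK⟩ := hx.2 r
    refine ⟨max K 1, fun j => ?_⟩
    rcases h j with h | ⟨i, h⟩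
    · rw [h]
      simp only [Pi.zero_apply, abs_zero]
      refine ⟨integrable_const _, le_max_of_le_right ?_⟩
      simpa using pow_le_one₀ (le_refl (0 : ℝ)) zero_le_one
    · rw [h]; exact ⟨(hK i).1, le_max_of_le_left (hK i).2⟩

/-- It suffices to bound the even moments. -/
theorem of_even_moments (hx : ∀ i, Measurable (x i))
    (h : ∀ p : ℕ, ∃ K : ℝ, ∀ i, Integrable (fun ω => x i ω ^ (2 * p)) μ ∧
      ∫ ω, x i ω ^ (2 * p) ∂μ ≤ K) : BddMoments μ x := by
  refine ⟨hx, fun r => ?_⟩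
  obtain ⟨K, hK⟩ := h r
  refine ⟨1 + K, fun i => ?_⟩
  have hle : ∀ ω, |x i ω| ^ r ≤ 1 + x i ω ^ (2 * r) := fun ω => by
    rw [mul_comm, pow_mul, ← sq_abs, ← abs_pow, abs_pow]
    nlinarith [sq_nonneg (|x i ω| ^ r - 1)]
  have hint : Integrable (fun ω => 1 + x i ω ^ (2 * r)) μ := (integrable_const _).add (hK i).1
  have hx' : Integrable (fun ω => |x i ω| ^ r) μ :=
    hint.mono' ((hx i).abs.pow_const r).aestronglyMeasurable
      (Eventually.of_forall fun ω => by
        rw [Real.norm_eq_abs, abs_of_nonneg (by positivity)]; exact hle ω)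
  refine ⟨hx', (integral_mono hx' hint hle).trans ?_⟩
  rw [integral_add (integrable_const _) (hK i).1]
  simpa using (hK i).2

/-- Centring preserves bounded moments. -/
theorem center (hx : BddMoments μ x) : BddMoments μ (fun i ω => x i ω - ∫ ω', x i ω' ∂μ) := by
  obtain ⟨K, _, hK⟩ := hx.exists_abs_integral_le
  exact hx.sub (const hK)

end BddMoments

/-! ### Moments of row sums of locally dependent arrays -/

/-- A triangular array `Y n i`, `1 ≤ i ≤ n`, of centred variables of size `n^{-1/2}`, such that
`Y n i` is a function of the independent sources in the window `win i`, and windows at distance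
more than `D` are disjoint. -/
structure LocallyDependent {Ω E : Type*} [mΩ : MeasurableSpace Ω] (μ : Measure Ω)
    (m : E → MeasurableSpace Ω) (win : ℤ → Set E) (D : ℤ) (Y : ℕ → ℤ → Ω → ℝ) : Prop where
  le : ∀ e, m e ≤ mΩ
  indep : iIndep m μ
  disj : ∀ i j, D < |i - j| → Disjoint (win i) (win j)
  meas : ∀ n i, Measurable[⨆ e ∈ win i, m e] (Y n i)
  zero : ∀ (n : ℕ) (i : ℤ), i ∉ Finset.Icc (1 : ℤ) n → Y n i = 0
  centered : ∀ n i, ∫ ω, Y n i ω ∂μ = 0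
  bdd : BddMoments μ (fun (p : ℕ × ℤ) ω => √(p.1 : ℝ) * Y p.1 p.2 ω)

/-- The row sums of an array. -/
noncomputable def rowSum {Ω : Type*} (Y : ℕ → ℤ → Ω → ℝ) (n : ℕ) (ω : Ω) : ℝ :=
  ∑ a ∈ Finset.Icc (1 : ℤ) n, Y n a ω

/-- The sum of the entries at distance at most `r` from `i`. -/
noncomputable def nearSum {Ω : Type*} (r : ℤ) (Y : ℕ → ℤ → Ω → ℝ) (n : ℕ) (i : ℤ) (ω : Ω) : ℝ :=
  ∑ e ∈ Finset.Icc (-r) r, Y n (i + e) ω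

/-- A Young inequality with free parameter `δ`, proved by comparing `a` with `δ x²`. It lets the top
moment be absorbed into the left side of a moment bound. -/
theorem mul_pow_le_add_mul_pow {a x δ : ℝ} (ha : 0 ≤ a) (hx : 0 ≤ x) (hδ : 0 < δ) (q : ℕ) :
    a * x ^ (2 * q) ≤ δ * x ^ (2 * (q + 1)) + δ * (a / δ) ^ (q + 1) := by
  rcases le_total a (δ * x ^ 2) with h | h
  · have : a * x ^ (2 * q) ≤ δ * x ^ (2 * (q + 1)) := by
      calc a * x ^ (2 * q) ≤ δ * x ^ 2 * x ^ (2 * q) :=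
            mul_le_mul_of_nonneg_right h (by positivity)
        _ = _ := by ring
    have h2 : 0 ≤ δ * (a / δ) ^ (q + 1) := by positivity
    linarith
  · have h1 : x ^ 2 ≤ a / δ := by rw [le_div_iff₀ hδ]; linarith
    have : a * x ^ (2 * q) ≤ δ * (a / δ) ^ (q + 1) := by
      calc a * x ^ (2 * q) ≤ a * (a / δ) ^ q := by
            rw [pow_mul]
            exact mul_le_mul_of_nonneg_left (pow_le_pow_left₀ (by positivity) h1 q) ha
        _ = _ := by rw [pow_succ]; field_simp
    have h2 : 0 ≤ δ * x ^ (2 * (q + 1)) := by positivity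
    linarith

namespace BddMoments

variable {Ω : Type*} [MeasurableSpace Ω] {μ : Measure Ω} [IsProbabilityMeasure μ] {I : Type*}

/-- The difference of powers contains the factor `x - y`, which carries the scale `c`; the cofactor
has bounded moments. -/
theorem mul_pow_sub_pow {x y : I → Ω → ℝ} {c : I → ℝ} (hx : BddMoments μ x) (hy : BddMoments μ y)
    (hxy : BddMoments μ (fun i ω => c i * (x i ω - y i ω))) (k : ℕ) :
    BddMoments μ (fun i ω => c i * (x i ω ^ k - y i ω ^ k)) := by
  have h := (BddMoments.sum (Finset.range k) (z := fun a i ω => x i ω ^ a * y i ω ^ (k - 1 - a))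
    fun a _ => (hx.pow a).mul (hy.pow (k - 1 - a))).mul hxy
  convert h using 3 with i ω
  rw [← geom_sum₂_mul]; ring

end BddMoments

namespace LocallyDependent

variable {Ω E : Type*} [mΩ : MeasurableSpace Ω] {μ : Measure Ω}
  {m : E → MeasurableSpace Ω} {win : ℤ → Set E} {D : ℤ} {Y : ℕ → ℤ → Ω → ℝ}

/-- Windows around levels more than `D` apart are disjoint, so the two functions depend on disjoint
sets of independent sources. -/
theorem integral_mul_of_far (h : LocallyDependent μ m win D Y) {A B : Set ℤ}
    (hAB : ∀ a ∈ A, ∀ c ∈ B, D < |a - c|) {f g : Ω → ℝ}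
    (hf : Measurable[⨆ e ∈ ⋃ a ∈ A, win a, m e] f)
    (hg : Measurable[⨆ e ∈ ⋃ a ∈ B, win a, m e] g) :
    ∫ ω, f ω * g ω ∂μ = (∫ ω, f ω ∂μ) * ∫ ω, g ω ∂μ := by
  have hd : Disjoint (⋃ a ∈ A, win a) (⋃ a ∈ B, win a) := by
    simp only [Set.disjoint_iUnion_left, Set.disjoint_iUnion_right]
    exact fun a ha c hc => h.disj _ _ (hAB _ hc _ ha)
  have hi := indep_iSup_of_disjoint h.le h.indep hd
  have hle : ∀ S : Set E, (⨆ e ∈ S, m e) ≤ mΩ := fun S => iSup₂_le fun e _ => h.le e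
  have hfg : IndepFun f g μ := (IndepFun_iff_Indep f g μ).2
    (indep_of_indep_of_le_left (indep_of_indep_of_le_right hi hg.comap_le) hf.comap_le)
  exact hfg.integral_fun_mul_eq_mul_integral (hf.mono (hle _) le_rfl).aestronglyMeasurable
    (hg.mono (hle _) le_rfl).aestronglyMeasurable

theorem meas_of_mem (h : LocallyDependent μ m win D Y) (n : ℕ) {A : Set ℤ} {a : ℤ} (ha : a ∈ A) :
    Measurable[⨆ e ∈ ⋃ a ∈ A, win a, m e] (Y n a) :=
  (h.meas n a).mono (biSup_mono fun _ he => Set.mem_biUnion ha he) le_rfl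

variable [IsProbabilityMeasure μ]

omit [IsProbabilityMeasure μ] in
theorem bdd_entry (h : LocallyDependent μ m win D Y) :
    BddMoments μ (fun (p : ℕ × ℤ) ω => Y p.1 p.2 ω) := by
  have h1 := h.bdd.const_mul (c := fun p => (√(p.1 : ℝ))⁻¹) (C := 1) fun p => by
    rw [abs_of_nonneg (by positivity)]
    rcases Nat.eq_zero_or_pos p.1 with h0 | h0
    · simp [h0]
    · refine inv_le_one_of_one_le₀ (Real.one_le_sqrt.2 ?_)
      exact_mod_cast h0
  convert h1 using 3 with p ω
  -- Row `0` cannot be recovered from its multiple by `√0`, but it vanishes since its index interval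
  -- is empty.
  rcases Nat.eq_zero_or_pos p.1 with h0 | h0
  · have : Y p.1 p.2 = 0 := h.zero _ _ (by simp [h0])
    simp [this]
  · have : √(p.1 : ℝ) ≠ 0 := by positivity
    field_simp

theorem bdd_nearSum_scaled (h : LocallyDependent μ m win D Y) (r : ℤ) :
    BddMoments μ (fun (p : ℕ × ℤ) ω => √(p.1 : ℝ) * nearSum r Y p.1 p.2 ω) := by
  have := BddMoments.sum (Finset.Icc (-r) r)
    (z := fun e (p : ℕ × ℤ) ω => √(p.1 : ℝ) * Y p.1 (p.2 + e) ω)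
    fun e _ => h.bdd.reindex (fun p : ℕ × ℤ => (p.1, p.2 + e))
  simpa only [nearSum, Finset.mul_sum] using this

theorem bdd_nearSum (h : LocallyDependent μ m win D Y) (r : ℤ) :
    BddMoments μ (fun (p : ℕ × ℤ) ω => nearSum r Y p.1 p.2 ω) := by
  simpa only [nearSum] using BddMoments.sum (Finset.Icc (-r) r)
    (z := fun e (p : ℕ × ℤ) ω => Y p.1 (p.2 + e) ω)
    fun e _ => h.bdd_entry.reindex (fun p : ℕ × ℤ => (p.1, p.2 + e))

omit [IsProbabilityMeasure μ] in
theorem rowSum_sub_nearSum (h : LocallyDependent μ m win D Y) (r : ℤ) (n : ℕ) (i : ℤ) (ω : Ω) :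
    rowSum Y n ω - nearSum r Y n i ω =
      ∑ a ∈ Finset.Icc (1 : ℤ) n \ Finset.Icc (i - r) (i + r), Y n a ω := by
  have h1 : nearSum r Y n i ω = ∑ a ∈ Finset.Icc (1 : ℤ) n ∩ Finset.Icc (i - r) (i + r), Y n a ω := by
    rw [nearSum, Finset.inter_comm]
    have h2 : ∑ a ∈ Finset.Icc (i - r) (i + r), Y n a ω = ∑ e ∈ Finset.Icc (-r) r, Y n (i + e) ω := by
      refine Finset.sum_nbij' (fun a => a - i) (fun e => i + e) ?_ ?_ ?_ ?_ ?_
      all_goals intros; (simp_all only [Finset.mem_Icc]; first | (constructor <;> linarith) | ring_nf)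
    rw [← h2]
    symm
    apply Finset.sum_subset Finset.inter_subset_left
    intro a ha hna
    rw [h.zero n a fun hc => hna (Finset.mem_inter.2 ⟨ha, hc⟩)]; rfl
  rw [h1, rowSum, ← Finset.sum_inter_add_sum_sdiff (Finset.Icc (1 : ℤ) n)
    (Finset.Icc (i - r) (i + r)), add_sub_cancel_left]

omit [IsProbabilityMeasure μ] in
theorem measurable_far (h : LocallyDependent μ m win D Y) (r : ℤ) (n : ℕ) (i : ℤ) :
    Measurable[⨆ e ∈ ⋃ a ∈ {a : ℤ | r < |i - a|}, win a, m e]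
      (fun ω => rowSum Y n ω - nearSum r Y n i ω) := by
  simp only [h.rowSum_sub_nearSum]
  refine Finset.measurable_fun_sum _ fun a ha => h.meas_of_mem n ?_
  simp only [Finset.mem_sdiff, Finset.mem_Icc, Set.mem_ofPred_eq] at ha ⊢
  by_contra hc
  rw [not_lt, abs_le] at hc
  exact ha.2 ⟨by linarith [hc.2], by linarith [hc.1]⟩

omit [IsProbabilityMeasure μ] in
theorem measurable_near (h : LocallyDependent μ m win D Y) (r : ℤ) (n : ℕ) (i : ℤ) :
    Measurable[⨆ e ∈ ⋃ a ∈ {a : ℤ | |i - a| ≤ r}, win a, m e] (nearSum r Y n i) := by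
  refine Finset.measurable_fun_sum _ fun a ha => h.meas_of_mem n ?_
  simp only [Finset.mem_Icc, Set.mem_ofPred_eq] at ha ⊢
  rw [abs_le]
  constructor <;> linarith [ha.1, ha.2]

theorem bdd_rowSum_single (h : LocallyDependent μ m win D Y) (n : ℕ) :
    BddMoments μ (fun (_ : Unit) ω => rowSum Y n ω) := by
  simpa only [rowSum] using BddMoments.sum (Finset.Icc (1 : ℤ) n)
    (z := fun a (_ : Unit) ω => Y n a ω) fun a _ => h.bdd_entry.reindex (fun _ : Unit => (n, a))

theorem integral_mul_far_eq_zero (h : LocallyDependent μ m win D Y) (n : ℕ) (i : ℤ) (k : ℕ) :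
    ∫ ω, Y n i ω * (rowSum Y n ω - nearSum D Y n i ω) ^ k ∂μ = 0 := by
  rw [h.integral_mul_of_far (A := {i}) (B := {a | D < |i - a|}) (by simp)
    (h.meas_of_mem n rfl) ((h.measurable_far D n i).pow_const k), h.centered, zero_mul]

/-- One factor of the power is expanded. The centred `Y n i` is independent of the part of the row
farther than `D` from `i`, so subtracting the power of that part changes nothing; what remains is a
difference of powers that is small with `nearSum`. -/
theorem integral_rowSum_pow_succ (h : LocallyDependent μ m win D Y) (n k : ℕ) :
    ∫ ω, rowSum Y n ω ^ (k + 1) ∂μ = ∑ i ∈ Finset.Icc (1 : ℤ) n,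
      ∫ ω, Y n i ω * (rowSum Y n ω ^ k - (rowSum Y n ω - nearSum D Y n i ω) ^ k) ∂μ := by
  have hS := h.bdd_rowSum_single n
  have hYu : ∀ i, BddMoments μ (fun (_ : Unit) ω => Y n i ω) := fun i =>
    h.bdd_entry.reindex (fun _ : Unit => (n, i))
  have hNu : ∀ i, BddMoments μ (fun (_ : Unit) ω => nearSum D Y n i ω) := fun i =>
    (h.bdd_nearSum D).reindex (fun _ : Unit => (n, i))
  have h1 : ∀ i, ∫ ω, Y n i ω * (rowSum Y n ω ^ k - (rowSum Y n ω - nearSum D Y n i ω) ^ k) ∂μ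
      = ∫ ω, Y n i ω * rowSum Y n ω ^ k ∂μ := fun i => by
    simp only [mul_sub]
    rw [integral_sub (((hYu i).mul (hS.pow k)).integrable ())
      (((hYu i).mul ((hS.sub (hNu i)).pow k)).integrable ()), h.integral_mul_far_eq_zero, sub_zero]
  simp only [h1]
  rw [← integral_finsetSum _ fun i _ => ((hYu i).mul (hS.pow k)).integrable ()]
  refine integral_congr_ae (Eventually.of_forall fun ω => ?_)
  simp only [← Finset.sum_mul]
  rw [pow_succ, mul_comm]; rfl

/-- In the expansion of `E S^{2q+2}` each of the `n` terms is at most `1/n` times `½ E S^{2q+2} +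
K`, because `n |Y| |nearSum|` has bounded moments. Summing gives `E S^{2q+2} ≤ ½ E S^{2q+2} + K`,
hence the bound `2K`. -/
theorem bdd_rowSum (h : LocallyDependent μ m win D Y) :
    BddMoments μ (fun n ω => rowSum Y n ω) := by
  refine BddMoments.of_even_moments (fun n => (h.bdd_rowSum_single n).measurable ()) fun p => ?_
  rcases p with _ | q
  · exact ⟨1, fun n => by simp⟩
  -- Convexity bounds `(|s| + |v|)^{2q+2}` with the constant `2^{2q+1}`; this `δ` turns it into the
  -- coefficient `1/2`. The variable `T` collects all that does not involve the row sum.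
  set δ : ℝ := (2 ^ (2 * q + 2))⁻¹ with hδ
  have hδ0 : 0 < δ := by positivity
  set T : ℕ × ℤ → Ω → ℝ := fun p ω => 1 / 2 * nearSum D Y p.1 p.2 ω ^ (2 * (q + 1)) +
    δ * (((2 * q + 1) / δ) * |(√(p.1 : ℝ) * Y p.1 p.2 ω) * (√(p.1 : ℝ) * nearSum D Y p.1 p.2 ω)|)
      ^ (q + 1) with hT
  have hTb : BddMoments μ T := by
    refine BddMoments.add ?_ ?_
    · exact ((h.bdd_nearSum D).pow _).const_mul (c := fun _ => 1 / 2) (C := 1 / 2)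
        (fun _ => by norm_num [abs_of_pos])
    · refine BddMoments.const_mul (c := fun _ => δ) (C := δ) (fun _ => (abs_of_pos hδ0).le) ?_
      refine BddMoments.pow ?_ _
      exact BddMoments.const_mul (c := fun _ => (2 * q + 1) / δ) (C := |(2 * q + 1) / δ|)
        (fun _ => le_rfl) ((h.bdd.mul (h.bdd_nearSum_scaled D)).abs)
  obtain ⟨K, hK0, hK⟩ := hTb.exists_abs_integral_le
  refine ⟨2 * K, fun n => ⟨(h.bdd_rowSum_single n).integrable_pow () _, ?_⟩⟩
  rcases Nat.eq_zero_or_pos n with rfl | hn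
  · simp only [rowSum]; simp; exact hK0
  have hn' : (0 : ℝ) < n := by exact_mod_cast hn
  have hS := h.bdd_rowSum_single n
  have hpt : ∀ i ω, (n : ℝ) * (Y n i ω * (rowSum Y n ω ^ (2 * q + 1) -
      (rowSum Y n ω - nearSum D Y n i ω) ^ (2 * q + 1))) ≤
      1 / 2 * rowSum Y n ω ^ (2 * (q + 1)) + T (n, i) ω := by
    intro i ω
    set y := Y n i ω
    set s := rowSum Y n ω
    set v := nearSum D Y n i ω
    have e1 : |s ^ (2 * q + 1) - (s - v) ^ (2 * q + 1)| ≤ |v| * (2 * q + 1) * (|s| + |v|) ^ (2 * q) := by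
      have := abs_pow_sub_pow_le s (s - v) (2 * q + 1)
      rw [sub_sub_cancel] at this
      refine this.trans ?_
      push_cast
      refine mul_le_mul_of_nonneg_left (pow_le_pow_left₀ (by positivity) ?_ _) (by positivity)
      exact max_le (by linarith [abs_nonneg v]) (abs_sub _ _)
    have e2 : (n : ℝ) * (|y| * |v|) = |(√(n : ℝ) * y) * (√(n : ℝ) * v)| := by
      rw [show (√(n : ℝ) * y) * (√(n : ℝ) * v) = (√(n : ℝ) * √(n : ℝ)) * (y * v) by ring,
        Real.mul_self_sqrt hn'.le, abs_mul, abs_mul, abs_of_pos hn']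
    have e3 := mul_pow_le_add_mul_pow (a := (2 * q + 1) * ((n : ℝ) * (|y| * |v|)))
      (x := |s| + |v|) (by positivity) (by positivity) hδ0 q
    have e4 : (|s| + |v|) ^ (2 * (q + 1)) ≤ 2 ^ (2 * q + 1) * (s ^ (2 * (q + 1)) + v ^ (2 * (q + 1))) := by
      have := add_pow_le (abs_nonneg s) (abs_nonneg v) (2 * (q + 1))
      rwa [Even.pow_abs (even_two_mul _), Even.pow_abs (even_two_mul _)] at this
    have e5 : δ * 2 ^ (2 * q + 1) = 1 / 2 := by
      rw [hδ, pow_succ _ (2 * q + 1)]; field_simp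
    calc (n : ℝ) * (y * (s ^ (2 * q + 1) - (s - v) ^ (2 * q + 1)))
        ≤ n * (|y| * (|v| * (2 * q + 1) * (|s| + |v|) ^ (2 * q))) := by
          refine mul_le_mul_of_nonneg_left ((le_abs_self _).trans ?_) hn'.le
          rw [abs_mul]
          exact mul_le_mul_of_nonneg_left e1 (abs_nonneg _)
      _ = (2 * q + 1) * ((n : ℝ) * (|y| * |v|)) * (|s| + |v|) ^ (2 * q) := by ring
      _ ≤ _ := e3
      _ ≤ δ * (2 ^ (2 * q + 1) * (s ^ (2 * (q + 1)) + v ^ (2 * (q + 1)))) +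
          δ * ((2 * q + 1) * ((n : ℝ) * (|y| * |v|)) / δ) ^ (q + 1) := by gcongr
      _ = 1 / 2 * s ^ (2 * (q + 1)) + T (n, i) ω := by
          simp only [hT]
          rw [← e2, ← mul_assoc, e5]; ring
  have hYu : ∀ i, BddMoments μ (fun (_ : Unit) ω => Y n i ω) := fun i =>
    h.bdd_entry.reindex (fun _ : Unit => (n, i))
  have hNu : ∀ i, BddMoments μ (fun (_ : Unit) ω => nearSum D Y n i ω) := fun i =>
    (h.bdd_nearSum D).reindex (fun _ : Unit => (n, i))
  have hsum := h.integral_rowSum_pow_succ n (2 * q + 1)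
  have hi : ∀ i ∈ Finset.Icc (1 : ℤ) n, ∫ ω, Y n i ω * (rowSum Y n ω ^ (2 * q + 1) -
      (rowSum Y n ω - nearSum D Y n i ω) ^ (2 * q + 1)) ∂μ ≤
      (n : ℝ)⁻¹ * (1 / 2 * (∫ ω, rowSum Y n ω ^ (2 * (q + 1)) ∂μ) + K) := by
    intro i _
    rw [inv_mul_eq_div, le_div_iff₀' hn', ← integral_const_mul]
    have i1 := (((hYu i).mul ((hS.pow (2 * q + 1)).sub ((hS.sub (hNu i)).pow (2 * q + 1)))).integrable
      ()).const_mul (n : ℝ)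
    have i2 : Integrable (fun ω => 1 / 2 * rowSum Y n ω ^ (2 * (q + 1))) μ :=
      (hS.integrable_pow () _).const_mul _
    refine (integral_mono i1 (i2.add (hTb.integrable (n, i))) (hpt i)).trans ?_
    simp only [Pi.add_apply]
    rw [integral_add i2 (hTb.integrable (n, i)), integral_const_mul]
    linarith [(le_abs_self _).trans (hK (n, i))]
  have hfin := Finset.sum_le_sum hi
  rw [← hsum, Finset.sum_const, Int.card_Icc, nsmul_eq_mul] at hfin
  have hc : (((n : ℤ) + 1 - 1).toNat : ℝ) = n := by simp
  rw [hc, ← mul_assoc, mul_inv_cancel₀ hn'.ne', one_mul] at hfin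
  have e : 2 * q + 1 + 1 = 2 * (q + 1) := by ring
  rw [e] at hfin
  linarith

/-- The moments of the row sums satisfy the Gaussian recursion asymptotically. -/
theorem tendsto_moment_recursion (h : LocallyDependent μ m win D Y) (q : ℕ) :
    Tendsto (fun n => ∫ ω, rowSum Y n ω ^ (q + 2) ∂μ -
      (q + 1) * ((∫ ω, rowSum Y n ω ^ 2 ∂μ) * ∫ ω, rowSum Y n ω ^ q ∂μ)) atTop (𝓝 0) := by
  -- Two radii are needed: `R` drops the entries within `D` of the level and is independent of `y`,
  -- while `Q` drops those within `2D` and is independent of `y * N`.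
  set S : ℕ × ℤ → Ω → ℝ := fun p ω => rowSum Y p.1 ω
  set N : ℕ × ℤ → Ω → ℝ := fun p ω => nearSum D Y p.1 p.2 ω
  set M : ℕ × ℤ → Ω → ℝ := fun p ω => nearSum (D + D) Y p.1 p.2 ω
  set R : ℕ × ℤ → Ω → ℝ := fun p ω => S p ω - N p ω
  set Q : ℕ × ℤ → Ω → ℝ := fun p ω => S p ω - M p ω
  set y : ℕ × ℤ → Ω → ℝ := fun p ω => Y p.1 p.2 ω
  have hS : BddMoments μ S := h.bdd_rowSum.reindex (fun p : ℕ × ℤ => p.1)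
  have hN : BddMoments μ N := h.bdd_nearSum D
  have hM : BddMoments μ M := h.bdd_nearSum (D + D)
  have hR : BddMoments μ R := hS.sub hN
  have hQ : BddMoments μ Q := hS.sub hM
  have hy : BddMoments μ y := h.bdd_entry
  have hN' : BddMoments μ (fun p ω => √(p.1 : ℝ) * N p ω) := h.bdd_nearSum_scaled D
  have hM' : BddMoments μ (fun p ω => √(p.1 : ℝ) * M p ω) := h.bdd_nearSum_scaled (D + D)
  have hSQ : BddMoments μ (fun p ω => √(p.1 : ℝ) * (S p ω - Q p ω)) := by
    simpa only [Q, sub_sub_cancel] using hM'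
  have hRQ : BddMoments μ (fun p ω => √(p.1 : ℝ) * (R p ω - Q p ω)) := by
    convert hM'.sub hN' using 3; simp only [R, Q]; ring
  have hyN : BddMoments μ (fun p ω => (√(p.1 : ℝ) * y p ω) * (√(p.1 : ℝ) * N p ω)) := h.bdd.mul hN'
  have hQfar : ∀ p, ∫ ω, (y p ω * N p ω) * Q p ω ^ q ∂μ =
      (∫ ω, y p ω * N p ω ∂μ) * ∫ ω, Q p ω ^ q ∂μ := fun p => by
    -- For negative `D` the near sum is empty; otherwise the level itself lies in its own
    -- neighbourhood.
    rcases lt_or_ge D 0 with hD | hD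
    · have : ∀ ω, N p ω = 0 := fun ω => by
        simp only [N, nearSum]; rw [Finset.Icc_eq_empty (by linarith)]; simp
      simp [this]
    refine h.integral_mul_of_far (A := {a | |p.2 - a| ≤ D}) (B := {a | D + D < |p.2 - a|}) ?_ ?_
      ((h.measurable_far (D + D) p.1 p.2).pow_const q)
    · intro a ha c hc
      simp only [Set.mem_ofPred_eq] at ha hc
      have := abs_sub_le p.2 a c
      linarith
    · exact (h.meas_of_mem p.1 (by simpa using hD)).mul (h.measurable_near D p.1 p.2)
  -- The product `y * N` has size `1/n`, and replacing `S` and `R` by `Q`, then `Q` by `S` after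
  -- factoring, costs a further `n^{-1/2}`. Each error is therefore `O(n^{-3/2})`, and the sum over
  -- `n` levels is `O(n^{-1/2})`.
  have key : ∀ c : ℕ, c ≤ q → ∃ K : ℝ, ∀ p : ℕ × ℤ, (p.1 * √(p.1 : ℝ)) *
      |∫ ω, (y p ω * N p ω) * (S p ω ^ c * R p ω ^ (q - c)) ∂μ -
        (∫ ω, y p ω * N p ω ∂μ) * ∫ ω, S p ω ^ q ∂μ| ≤ K := by
    intro c hc
    have hF : BddMoments μ (fun p ω => ((√(p.1 : ℝ) * y p ω) * (√(p.1 : ℝ) * N p ω)) *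
        (S p ω ^ c * (√(p.1 : ℝ) * (R p ω ^ (q - c) - Q p ω ^ (q - c))) +
          (√(p.1 : ℝ) * (S p ω ^ c - Q p ω ^ c)) * Q p ω ^ (q - c))) :=
      hyN.mul (((hS.pow c).mul (hR.mul_pow_sub_pow hQ hRQ (q - c))).add
        ((hS.mul_pow_sub_pow hQ hSQ c).mul (hQ.pow (q - c))))
    obtain ⟨K₁, h₁0, h₁⟩ := hF.exists_abs_integral_le
    obtain ⟨K₂, h₂0, h₂⟩ := hyN.exists_abs_integral_le
    obtain ⟨K₃, h₃0, h₃⟩ := (hS.mul_pow_sub_pow hQ hSQ q).exists_abs_integral_le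
    refine ⟨K₁ + K₂ * K₃, fun p => ?_⟩
    have hsq : √(p.1 : ℝ) * √(p.1 : ℝ) = p.1 := Real.mul_self_sqrt (Nat.cast_nonneg _)
    have e1 : (p.1 * √(p.1 : ℝ)) * (∫ ω, (y p ω * N p ω) * (S p ω ^ c * R p ω ^ (q - c)) ∂μ -
        (∫ ω, y p ω * N p ω ∂μ) * ∫ ω, S p ω ^ q ∂μ) =
        (∫ ω, ((√(p.1 : ℝ) * y p ω) * (√(p.1 : ℝ) * N p ω)) *
        (S p ω ^ c * (√(p.1 : ℝ) * (R p ω ^ (q - c) - Q p ω ^ (q - c))) +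
          (√(p.1 : ℝ) * (S p ω ^ c - Q p ω ^ c)) * Q p ω ^ (q - c)) ∂μ) -
        (∫ ω, (√(p.1 : ℝ) * y p ω) * (√(p.1 : ℝ) * N p ω) ∂μ) *
          ∫ ω, √(p.1 : ℝ) * (S p ω ^ q - Q p ω ^ q) ∂μ := by
      have a1 : ∀ ω, ((√(p.1 : ℝ) * y p ω) * (√(p.1 : ℝ) * N p ω)) *
        (S p ω ^ c * (√(p.1 : ℝ) * (R p ω ^ (q - c) - Q p ω ^ (q - c))) +
          (√(p.1 : ℝ) * (S p ω ^ c - Q p ω ^ c)) * Q p ω ^ (q - c)) = (p.1 * √(p.1 : ℝ)) *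
          ((y p ω * N p ω) * (S p ω ^ c * R p ω ^ (q - c)) - (y p ω * N p ω) * Q p ω ^ q) := fun ω => by
        have a0 : Q p ω ^ q = Q p ω ^ c * Q p ω ^ (q - c) := by rw [← pow_add, Nat.add_sub_cancel' hc]
        rw [a0]
        linear_combination ((y p ω * N p ω) * √(p.1 : ℝ) *
          (S p ω ^ c * R p ω ^ (q - c) - Q p ω ^ c * Q p ω ^ (q - c))) * hsq
      have a2 : ∀ ω, (√(p.1 : ℝ) * y p ω) * (√(p.1 : ℝ) * N p ω) = p.1 * (y p ω * N p ω) := fun ω => by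
        conv_rhs => rw [← hsq]
        ring
      simp only [a1]
      simp only [a2, integral_const_mul]
      rw [integral_sub, integral_sub, hQfar]
      · ring
      · exact (hS.pow q).integrable p
      · exact (hQ.pow q).integrable p
      · exact ((hy.mul hN).mul ((hS.pow c).mul (hR.pow _))).integrable p
      · exact ((hy.mul hN).mul (hQ.pow q)).integrable p
    have hnn : 0 ≤ (p.1 * √(p.1 : ℝ)) := by positivity
    rw [show ∀ z : ℝ, (p.1 * √(p.1 : ℝ)) * |z| = |(p.1 * √(p.1 : ℝ)) * z| from fun z => by
      rw [abs_mul, abs_of_nonneg hnn], e1]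
    refine (abs_sub _ _).trans (add_le_add (h₁ p) ?_)
    rw [abs_mul]
    exact mul_le_mul (h₂ p) (h₃ p) (abs_nonneg _) h₂0
  choose! K hK using key
  -- Factoring `S^{k+1} - R^{k+1}` by `S - R = N` gives `k + 1` summands per level. The case `k = 0`
  -- identifies the second moment with the sum of the `E[y * N]`.
  have hexp : ∀ k n, ∫ ω, rowSum Y n ω ^ (k + 2) ∂μ = ∑ i ∈ Finset.Icc (1 : ℤ) n,
      ∑ c ∈ Finset.range (k + 1),
        ∫ ω, (y (n, i) ω * N (n, i) ω) * (S (n, i) ω ^ c * R (n, i) ω ^ (k - c)) ∂μ := by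
    intro k n
    rw [h.integral_rowSum_pow_succ n (k + 1)]
    refine Finset.sum_congr rfl fun i _ => ?_
    rw [← integral_finsetSum _ fun c _ =>
      ((hy.mul hN).mul ((hS.pow c).mul (hR.pow (k - c)))).integrable (n, i)]
    refine integral_congr_ae (Eventually.of_forall fun ω => ?_)
    simp only [← Finset.mul_sum]
    have := geom_sum₂_mul (S (n, i) ω) (R (n, i) ω) (k + 1)
    simp only [Nat.add_sub_cancel] at this
    change y (n, i) ω * (S (n, i) ω ^ (k + 1) - R (n, i) ω ^ (k + 1)) = _
    rw [← this]; simp only [R]; ring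
  have hbound : ∀ n : ℕ, 1 ≤ n → |∫ ω, rowSum Y n ω ^ (q + 2) ∂μ -
      (q + 1) * ((∫ ω, rowSum Y n ω ^ 2 ∂μ) * ∫ ω, rowSum Y n ω ^ q ∂μ)| ≤
      (∑ c ∈ Finset.range (q + 1), K c) * (√(n : ℝ))⁻¹ := by
    intro n hn
    have hn' : (0 : ℝ) < n := by exact_mod_cast hn
    have hs : 0 < √(n : ℝ) := Real.sqrt_pos.2 hn'
    have e2 : ∫ ω, rowSum Y n ω ^ 2 ∂μ = ∑ i ∈ Finset.Icc (1 : ℤ) n,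
        ∫ ω, y (n, i) ω * N (n, i) ω ∂μ := by
      have := hexp 0 n
      simpa using this
    have e3 : ∫ ω, rowSum Y n ω ^ (q + 2) ∂μ -
      (q + 1) * ((∫ ω, rowSum Y n ω ^ 2 ∂μ) * ∫ ω, rowSum Y n ω ^ q ∂μ) =
      ∑ i ∈ Finset.Icc (1 : ℤ) n, ∑ c ∈ Finset.range (q + 1),
        (∫ ω, (y (n, i) ω * N (n, i) ω) * (S (n, i) ω ^ c * R (n, i) ω ^ (q - c)) ∂μ -
        (∫ ω, y (n, i) ω * N (n, i) ω ∂μ) * ∫ ω, S (n, i) ω ^ q ∂μ) := by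
      simp only [Finset.sum_sub_distrib]
      rw [← hexp, e2]
      simp only [Finset.sum_const, Finset.card_range, nsmul_eq_mul, S]
      rw [← Finset.mul_sum, ← Finset.sum_mul]
      push_cast
      ring
    rw [e3]
    calc _ ≤ ∑ i ∈ Finset.Icc (1 : ℤ) n, ∑ c ∈ Finset.range (q + 1), (n * √(n : ℝ))⁻¹ * K c := by
          refine (Finset.abs_sum_le_sum_abs _ _).trans (Finset.sum_le_sum fun i _ => ?_)
          refine (Finset.abs_sum_le_sum_abs _ _).trans (Finset.sum_le_sum fun c hc => ?_)
          rw [inv_mul_eq_div, le_div_iff₀' (by positivity)]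
          exact hK c (Nat.lt_succ_iff.1 (Finset.mem_range.1 hc)) (n, i)
      _ = (∑ c ∈ Finset.range (q + 1), K c) * (√(n : ℝ))⁻¹ := by
          rw [Finset.sum_const, Int.card_Icc, nsmul_eq_mul, ← Finset.mul_sum]
          have hc : (((n : ℤ) + 1 - 1).toNat : ℝ) = n := by simp
          rw [hc]
          field_simp
  refine squeeze_zero_norm' ((eventually_ge_atTop 1).mono fun n hn => ?_)
    (a := fun n : ℕ => (∑ c ∈ Finset.range (q + 1), K c) * (√(n : ℝ))⁻¹) ?_
  · rw [Real.norm_eq_abs]; exact hbound n hn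
  · have : Tendsto (fun n : ℕ => (√(n : ℝ))⁻¹) atTop (𝓝 0) :=
      (Real.tendsto_sqrt_atTop.comp tendsto_natCast_atTop_atTop).inv_tendsto_atTop
    simpa using this.const_mul (∑ c ∈ Finset.range (q + 1), K c)

end LocallyDependent

/-! ### Gaussian moments and the method of moments -/

section MomentMethod

open scoped NNReal Nat

theorem integrable_pow_gaussianReal (v : ℝ≥0) (k : ℕ) :
    Integrable (fun x : ℝ => x ^ k) (gaussianReal 0 v) := by
  rcases Nat.eq_zero_or_pos k with rfl | hk
  · simp
  · have h := (memLp_id_gaussianReal (μ := 0) (v := v) (k : ℝ≥0)).integrable_norm_rpow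
      (by simpa using hk.ne') (by simp)
    refine h.mono' (by fun_prop) (Eventually.of_forall fun x => ?_)
    simp

/-- Gaussian integration by parts for monomials. -/
theorem integral_pow_add_two_gaussianReal (v : ℝ≥0) (q : ℕ) :
    ∫ x, x ^ (q + 2) ∂gaussianReal 0 v = (q + 1) * (v * ∫ x, x ^ q ∂gaussianReal 0 v) := by
  rcases eq_or_ne v 0 with rfl | hv
  · simp [gaussianReal_zero_var]
  have hv' : (v : ℝ) ≠ 0 := by exact_mod_cast hv
  have hint : ∀ k : ℕ, Integrable (fun x : ℝ => gaussianPDFReal 0 v x * x ^ k) := by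
    intro k
    have h := integrable_pow_gaussianReal v k
    rw [gaussianReal_of_var_ne_zero _ hv, gaussianPDF_def,
      integrable_withDensity_iff_integrable_smul' (by fun_prop) (by simp)] at h
    refine h.congr (Eventually.of_forall fun x => ?_)
    simp [gaussianPDFReal_nonneg]
  have hd : ∀ x, HasDerivAt (gaussianPDFReal 0 v) (-(x / v) * gaussianPDFReal 0 v x) x := by
    intro x
    have h1 : HasDerivAt (fun y : ℝ => -(y - 0) ^ 2 / (2 * v)) (-(x / v)) x := by
      have h0 : HasDerivAt (fun y : ℝ => -(y - 0) ^ 2 / (2 * (v : ℝ)))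
          (-(2 * (x - 0) ^ (2 - 1) * 1) / (2 * v)) x := by
        simpa using ((((hasDerivAt_id x).sub_const 0).pow 2).neg).div_const (2 * (v : ℝ))
      convert h0 using 1
      field_simp
      simp
    have h2 := (h1.exp).const_mul (√(2 * Real.pi * v))⁻¹
    rw [gaussianPDFReal_def]
    exact h2.congr_deriv (by simp only; ring)
  have key := integral_mul_deriv_eq_deriv_mul_of_integrable
    (u := fun x : ℝ => x ^ (q + 1)) (u' := fun x => ((q + 1 : ℕ) : ℝ) * x ^ q)
    (v := gaussianPDFReal 0 v) (v' := fun x => -(x / v) * gaussianPDFReal 0 v x)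
    (fun x _ => by simpa using hasDerivAt_pow (q + 1) x) (fun x _ => hd x)
    (((hint (q + 2)).const_mul (-(v : ℝ)⁻¹)).congr (Eventually.of_forall fun x => by
      simp only [Pi.mul_apply]; ring))
    (((hint q).const_mul ((q + 1 : ℕ) : ℝ)).congr (Eventually.of_forall fun x => by
      simp only [Pi.mul_apply]; ring))
    ((hint (q + 1)).congr (Eventually.of_forall fun x => by simp only [Pi.mul_apply]; ring))
  rw [integral_gaussianReal_eq_integral_smul hv, integral_gaussianReal_eq_integral_smul hv]
  simp only [smul_eq_mul]
  have e1 : ∫ x : ℝ, x ^ (q + 1) * (-(x / v) * gaussianPDFReal 0 v x) =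
      -(v : ℝ)⁻¹ * ∫ x, gaussianPDFReal 0 v x * x ^ (q + 2) := by
    rw [← integral_const_mul]; congr 1; ext x; ring
  have e2 : ∫ x : ℝ, ((q + 1 : ℕ) : ℝ) * x ^ q * gaussianPDFReal 0 v x =
      (q + 1) * ∫ x, gaussianPDFReal 0 v x * x ^ q := by
    rw [← integral_const_mul]; congr 1; ext x; push_cast; ring
  rw [e1, e2] at key
  field_simp at key
  linarith

/-- The left side is the Taylor remainder bound of order `2p` for the Gaussian characteristic
function; as a term of an exponential series it tends to zero with `p`. -/
theorem pow_mul_integral_gaussianReal_div_factorial (v : ℝ≥0) (t : ℝ) (p : ℕ) :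
    t ^ (2 * p) * (∫ x, x ^ (2 * p) ∂gaussianReal 0 v) / (2 * p)! = (t ^ 2 * v / 2) ^ p / p ! := by
  induction p with
  | zero => simp
  | succ p ih =>
    rw [show 2 * (p + 1) = 2 * p + 2 by ring, integral_pow_add_two_gaussianReal, pow_succ _ p,
      Nat.factorial_succ, Nat.factorial_succ, Nat.factorial_succ]
    have h1 : ((2 * p)! : ℝ) ≠ 0 := by positivity
    have h2 : (p ! : ℝ) ≠ 0 := by positivity
    push_cast
    have h3 : (2 * (p : ℝ) + 1) ≠ 0 := by positivity
    have h4 : (2 * (p : ℝ) + 1 + 1) ≠ 0 := by positivity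
    have h5 : ((p : ℝ) + 1) ≠ 0 := by positivity
    calc _ = (t ^ (2 * p) * (∫ x, x ^ (2 * p) ∂gaussianReal 0 v) / (2 * p)!) *
          (t ^ 2 * v / (2 * p + 1 + 1)) := by field_simp; ring
      _ = (t ^ 2 * v / 2) ^ p / p ! * (t ^ 2 * v / (2 * p + 1 + 1)) := by rw [ih]
      _ = _ := by field_simp; ring

/-- Up to the factor `c`, the derivative of the remainder of order `n + 1` is the remainder of order
`n`, so the bound integrates. A general `c` on the imaginary unit circle covers both signs of the
real argument. -/
theorem norm_exp_mul_sub_sum_le {c : ℂ} (hc : c.re = 0) (hn : ‖c‖ = 1) (n : ℕ) {x : ℝ}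
    (hx : 0 ≤ x) :
    ‖Complex.exp (c * x) - ∑ j ∈ Finset.range n, (c * x) ^ j / (j ! : ℂ)‖ ≤ x ^ n / n ! := by
  induction n generalizing x with
  | zero => simp [Complex.norm_exp, hc]
  | succ n ih =>
    have hsum : ∀ y : ℝ, HasDerivAt
        (fun y : ℝ => ∑ j ∈ Finset.range (n + 1), (c * y) ^ j / (j ! : ℂ))
        (c * ∑ j ∈ Finset.range n, (c * y) ^ j / (j ! : ℂ)) y := by
      intro y
      simp only [Finset.sum_range_succ', pow_zero]
      rw [Finset.mul_sum]
      refine (HasDerivAt.fun_sum fun j _ => ?_).add_const _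
      have h0 : HasDerivAt (fun y : ℝ => c * (y : ℂ)) c y := by
        simpa using (Complex.ofRealCLM.hasDerivAt (x := y)).const_mul c
      have h1 := (h0.pow (j + 1)).div_const (((j + 1)! : ℕ) : ℂ)
      refine h1.congr_deriv ?_
      rw [Nat.factorial_succ]
      have h2 : ((j ! : ℕ) : ℂ) ≠ 0 := by exact_mod_cast Nat.factorial_ne_zero j
      have h3 : ((j : ℂ) + 1) ≠ 0 := by exact_mod_cast Nat.succ_ne_zero j
      push_cast
      field_simp
    have hder : ∀ y : ℝ, HasDerivAt
        (fun y : ℝ => Complex.exp (c * y) - ∑ j ∈ Finset.range (n + 1), (c * y) ^ j / (j ! : ℂ))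
        (c * (Complex.exp (c * y) - ∑ j ∈ Finset.range n, (c * y) ^ j / (j ! : ℂ))) y := by
      intro y
      have h0 : HasDerivAt (fun y : ℝ => c * (y : ℂ)) c y := by
        simpa using (Complex.ofRealCLM.hasDerivAt (x := y)).const_mul c
      refine (h0.cexp.sub (hsum y)).congr_deriv ?_
      ring
    refine image_norm_le_of_norm_deriv_right_le_deriv_boundary (a := 0) (b := x)
      (B := fun y => y ^ (n + 1) / ((n + 1)! : ℝ)) (B' := fun y => y ^ n / (n ! : ℝ))
      (fun y _ => (hder y).continuousAt.continuousWithinAt)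
      (fun y _ => (hder y).hasDerivWithinAt) ?_ ?_ ?_ (Set.right_mem_Icc.2 hx)
    · simp [Finset.sum_range_succ']
    · intro y
      have := (hasDerivAt_pow (n + 1) y).div_const ((n + 1)! : ℝ)
      refine this.congr_deriv ?_
      rw [Nat.factorial_succ]; push_cast; field_simp
    · intro y hy
      rw [norm_mul, hn, one_mul]
      exact ih hy.1

theorem norm_exp_mul_I_sub_sum_le (n : ℕ) (x : ℝ) :
    ‖Complex.exp (x * Complex.I) - ∑ j ∈ Finset.range n, (x * Complex.I) ^ j / (j ! : ℂ)‖ ≤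
      |x| ^ n / n ! := by
  rcases le_total 0 x with hx | hx
  · rw [abs_of_nonneg hx, mul_comm]
    exact norm_exp_mul_sub_sum_le Complex.I_re Complex.norm_I n hx
  · have := norm_exp_mul_sub_sum_le (c := -Complex.I) (by simp) (by simp) n (neg_nonneg.2 hx)
    rw [abs_of_nonpos hx]
    simpa [mul_comm] using this

/-- The Taylor bound integrated in `ω`. The order is even so that the remainder is a moment and not
an absolute moment. -/
theorem norm_charFun_sub_sum_le {Ω : Type*} [MeasurableSpace Ω] {μ : Measure Ω}
    [IsProbabilityMeasure μ] {X : Ω → ℝ} (hX : AEMeasurable X μ)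
    (hint : ∀ j : ℕ, Integrable (fun ω => X ω ^ j) μ) (t : ℝ) (p : ℕ) :
    ‖charFun (μ.map X) t - ∑ j ∈ Finset.range (2 * p),
      (t * Complex.I) ^ j / (j ! : ℂ) * ((∫ ω, X ω ^ j ∂μ : ℝ) : ℂ)‖ ≤
      t ^ (2 * p) * (∫ ω, X ω ^ (2 * p) ∂μ) / (2 * p)! := by
  have h1 : charFun (μ.map X) t = ∫ ω, Complex.exp ((t * X ω : ℝ) * Complex.I) ∂μ := by
    rw [charFun_apply_real, integral_map hX (by fun_prop)]
    simp
  have hi : ∀ j : ℕ, Integrable (fun ω => ((t * X ω : ℝ) * Complex.I) ^ j / (j ! : ℂ)) μ := by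
    intro j
    have : Integrable (fun ω => (t * Complex.I) ^ j / (j ! : ℂ) * ((X ω ^ j : ℝ) : ℂ)) μ :=
      (hint j).ofReal.const_mul _
    refine this.congr (Eventually.of_forall fun ω => ?_)
    simp only; push_cast; ring
  have h2 : ∑ j ∈ Finset.range (2 * p),
      (t * Complex.I) ^ j / (j ! : ℂ) * ((∫ ω, X ω ^ j ∂μ : ℝ) : ℂ) =
      ∫ ω, ∑ j ∈ Finset.range (2 * p), ((t * X ω : ℝ) * Complex.I) ^ j / (j ! : ℂ) ∂μ := by
    rw [integral_finsetSum _ fun j _ => hi j]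
    refine Finset.sum_congr rfl fun j _ => ?_
    rw [← integral_complex_ofReal, ← integral_const_mul]
    refine integral_congr_ae (Eventually.of_forall fun ω => ?_)
    simp only; push_cast; ring
  have hexp : Integrable (fun ω => Complex.exp ((t * X ω : ℝ) * Complex.I)) μ :=
    (integrable_const (1 : ℝ)).mono' (by fun_prop) (Eventually.of_forall fun ω => by
      rw [Complex.norm_exp_ofReal_mul_I])
  rw [h1, h2, ← integral_sub hexp (integrable_finsetSum _ fun j _ => hi j)]
  refine (norm_integral_le_integral_norm _).trans ?_
  rw [← integral_const_mul, ← integral_div]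
  refine integral_mono_of_nonneg (Eventually.of_forall fun ω => norm_nonneg _)
    (((hint (2 * p)).const_mul _).div_const _) (Eventually.of_forall fun ω => ?_)
  refine (norm_exp_mul_I_sub_sum_le (2 * p) (t * X ω)).trans (le_of_eq ?_)
  rw [Even.pow_abs (even_two_mul p), mul_pow]

/-- The method of moments for a centred Gaussian limit. -/
theorem tendstoInDistribution_of_tendsto_moments {Ω : Type*} [MeasurableSpace Ω] {μ : Measure Ω}
    [IsProbabilityMeasure μ] {X : ℕ → Ω → ℝ} (hX : ∀ n, AEMeasurable (X n) μ)
    (hint : ∀ n (j : ℕ), Integrable (fun ω => X n ω ^ j) μ) (v : ℝ≥0)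
    (h : ∀ j : ℕ, Tendsto (fun n => ∫ ω, X n ω ^ j ∂μ) atTop (𝓝 (∫ x, x ^ j ∂gaussianReal 0 v))) :
    TendstoInDistribution X atTop id (fun _ => μ) (gaussianReal 0 v) where
  forall_aemeasurable := hX
  tendsto := by
    refine ProbabilityMeasure.tendsto_iff_tendsto_charFun.2 fun t => ?_
    change Tendsto (fun n => charFun (μ.map (X n)) t) atTop
      (𝓝 (charFun ((gaussianReal 0 v).map id) t))
    set ψ := charFun ((gaussianReal 0 v).map id) t
    have hG := fun p => norm_charFun_sub_sum_le (μ := gaussianReal 0 v) (X := id) aemeasurable_id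
      (integrable_pow_gaussianReal v) t p
    have hZ := fun n p => norm_charFun_sub_sum_le (hX n) (hint n) t p
    simp only [id] at hG
    rw [Metric.tendsto_atTop]
    intro e he
    -- Choose `p` so that the Gaussian remainder is below `e / 4`. Convergence of the moment of
    -- order `2p` then bounds the remainder of `X n`, and the Taylor polynomials differ by less than
    -- `e / 4` eventually.
    have hlim := FloorSemiring.tendsto_pow_div_factorial_atTop (t ^ 2 * v / 2 : ℝ)
    obtain ⟨p, hp⟩ := (hlim.eventually (gt_mem_nhds (show (0 : ℝ) < e / 4 by linarith))).exists
    rw [← pow_mul_integral_gaussianReal_div_factorial] at hp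
    have l1 : Tendsto (fun n => t ^ (2 * p) * (∫ ω, X n ω ^ (2 * p) ∂μ) / (2 * p)!) atTop
        (𝓝 (t ^ (2 * p) * (∫ x, x ^ (2 * p) ∂gaussianReal 0 v) / (2 * p)!)) :=
      ((h (2 * p)).const_mul _).div_const _
    have l2 : Tendsto (fun n => ∑ j ∈ Finset.range (2 * p),
        (t * Complex.I) ^ j / (j ! : ℂ) * ((∫ ω, X n ω ^ j ∂μ : ℝ) : ℂ)) atTop
        (𝓝 (∑ j ∈ Finset.range (2 * p),
        (t * Complex.I) ^ j / (j ! : ℂ) * ((∫ x, x ^ j ∂gaussianReal 0 v : ℝ) : ℂ))) :=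
      tendsto_finsetSum _ fun j _ =>
        ((Complex.continuous_ofReal.tendsto _).comp (h j)).const_mul _
    obtain ⟨n₁, hn₁⟩ := eventually_atTop.1 (l1.eventually (gt_mem_nhds hp))
    obtain ⟨n₂, hn₂⟩ := Metric.tendsto_atTop.1 l2 (e / 4) (by linarith)
    refine ⟨max n₁ n₂, fun n hn => ?_⟩
    have a1 := (hZ n p).trans_lt (hn₁ n ((le_max_left _ _).trans hn))
    have a2 := hn₂ n ((le_max_right _ _).trans hn)
    have a3 := (hG p).trans_lt hp
    rw [← dist_eq_norm] at a1 a3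
    have b1 := dist_triangle (charFun (μ.map (X n)) t) (∑ j ∈ Finset.range (2 * p),
        (t * Complex.I) ^ j / (j ! : ℂ) * ((∫ ω, X n ω ^ j ∂μ : ℝ) : ℂ)) ψ
    have b2 := dist_triangle (∑ j ∈ Finset.range (2 * p),
        (t * Complex.I) ^ j / (j ! : ℂ) * ((∫ ω, X n ω ^ j ∂μ : ℝ) : ℂ))
        (∑ j ∈ Finset.range (2 * p),
        (t * Complex.I) ^ j / (j ! : ℂ) * ((∫ x, x ^ j ∂gaussianReal 0 v : ℝ) : ℂ)) ψ
    rw [dist_comm] at a3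
    linarith

/-- The central limit theorem for locally dependent arrays, with convergence of moments. -/
theorem LocallyDependent.tendstoNormal {Ω E : Type*} [MeasurableSpace Ω] {μ : Measure Ω}
    [IsProbabilityMeasure μ] {m : E → MeasurableSpace Ω} {win : ℤ → Set E} {D : ℤ}
    {Y : ℕ → ℤ → Ω → ℝ} (h : LocallyDependent μ m win D Y) {s : ℝ}
    (hs : Tendsto (fun n => ∫ ω, rowSum Y n ω ^ 2 ∂μ) atTop (𝓝 s)) :
    TendstoNormal μ (rowSum Y) s := by
  have hs0 : 0 ≤ s := ge_of_tendsto' hs fun n => integral_nonneg fun ω => sq_nonneg _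
  have hv : ((s.toNNReal : ℝ≥0) : ℝ) = s := Real.coe_toNNReal s hs0
  have hint : ∀ n (j : ℕ), Integrable (fun ω => rowSum Y n ω ^ j) μ :=
    fun n j => h.bdd_rowSum.integrable_pow n j
  -- The recursion advances by two orders, so the induction carries two consecutive moments.
  have hmom : ∀ j : ℕ,
      Tendsto (fun n => ∫ ω, rowSum Y n ω ^ j ∂μ) atTop
        (𝓝 (∫ x, x ^ j ∂gaussianReal 0 s.toNNReal)) ∧
      Tendsto (fun n => ∫ ω, rowSum Y n ω ^ (j + 1) ∂μ) atTop
        (𝓝 (∫ x, x ^ (j + 1) ∂gaussianReal 0 s.toNNReal)) := by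
    intro j
    induction j with
    | zero =>
      refine ⟨by simp, ?_⟩
      -- For exponent `1` the expansion contains differences of zeroth powers only.
      have : ∀ n, ∫ ω, rowSum Y n ω ^ (0 + 1) ∂μ = 0 := fun n => by
        rw [h.integral_rowSum_pow_succ]; simp
      simp_rw [this]
      simp
    | succ j ih =>
      refine ⟨ih.2, ?_⟩
      have h1 := (h.tendsto_moment_recursion j).add ((hs.mul ih.1).const_mul ((j : ℝ) + 1))
      rw [zero_add] at h1
      rw [integral_pow_add_two_gaussianReal, hv]
      refine h1.congr fun n => ?_
      ring
  exact ⟨hs0, tendstoInDistribution_of_tendsto_moments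
    (fun n => (h.bdd_rowSum.measurable n).aemeasurable) hint _ fun j => (hmom j).1,
    fun j => ⟨fun n => hint n j, (hmom j).1⟩⟩

end MomentMethod

/-! ### Traces of powers as sums over closed paths -/

/-- The entry of the infinite tridiagonal matrix that belongs to a step from level `i` to
level `j`. -/
def stepWeight (d b : ℤ → ℝ) (i j : ℤ) : ℝ :=
  if i = j then d i else if j = i + 1 then b i else if i = j + 1 then b j else 0

/-- The product of the entries along a path. -/
def pathWeight {k : ℕ} (d b : ℤ → ℝ) (γ : Fin (k + 1) → ℤ) : ℝ :=
  ∏ u : Fin k, stepWeight d b (γ u.castSucc) (γ u.succ)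

/-- The path moved up by `i` levels. -/
def shiftPath {k : ℕ} (i : ℤ) (γ : Fin (k + 1) → ℤ) : Fin (k + 1) → ℤ := fun u => γ u + i

open Classical in
/-- The paths of length `k` with levels between `1` and `n`. -/
noncomputable def closedPaths (k n : ℕ) : Finset (Fin (k + 1) → ℤ) :=
  (Fintype.piFinset fun _ : Fin (k + 1) => Finset.Icc (1 : ℤ) n).filter IsPath

theorem mem_closedPaths {k n : ℕ} {γ : Fin (k + 1) → ℤ} :
    γ ∈ closedPaths k n ↔ (∀ u, 1 ≤ γ u ∧ γ u ≤ n) ∧ IsPath γ := by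
  simp [closedPaths]

theorem matrix_pow_apply_eq_sum {ι R : Type*} [Fintype ι] [DecidableEq ι] [CommRing R]
    (A : Matrix ι ι R) (k : ℕ) (i j : ι) :
    (A ^ k) i j = ∑ g : Fin (k + 1) → ι, if g 0 = i ∧ g (Fin.last k) = j then
      ∏ u : Fin k, A (g u.castSucc) (g u.succ) else 0 := by
  induction k generalizing i with
  | zero =>
    rw [← (Equiv.funUnique (Fin 1) ι).symm.sum_comp]
    simp [Matrix.one_apply, ite_and]
  | succ k ih =>
    rw [pow_succ', Matrix.mul_apply, ← (Fin.consEquiv fun _ => ι).sum_comp, Fintype.sum_prod_type]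
    simp only [ih, Finset.mul_sum]
    rw [Finset.sum_comm, Finset.sum_comm (γ := ι)]
    refine Finset.sum_congr rfl fun g _ => ?_
    simp only [Fin.consEquiv_apply, Fin.cons_zero, Fin.prod_univ_succ, Fin.castSucc_zero,
      Fin.cons_succ, ← Fin.succ_castSucc, ← Fin.succ_last, ite_and]
    simp

/-- Row `i` is level `n - i`: the matrix lists its entries downwards, and with this reversal the
weight of a step no longer depends on `n`. -/
theorem matA_eq_stepWeight (d b : ℕ → ℝ) (n : ℕ) (i j : Fin n) :
    matA d b n i j = stepWeight (fun l => d l.toNat) (fun l => b l.toNat) (n - i) (n - j) := by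
  have hi := i.2
  have hj := j.2
  have e1 : ((n : ℤ) - (i : ℕ)).toNat = n - i := by omega
  have e2 : ((n : ℤ) - (j : ℕ)).toNat = n - j := by omega
  simp only [matA, stepWeight, e1, e2, Fin.ext_iff]
  have c1 : ((n : ℤ) - (i : ℕ) = n - (j : ℕ)) ↔ (i : ℕ) = j := by omega
  have c2 : ((n : ℤ) - (i : ℕ) = n - (j : ℕ) + 1) ↔ (i : ℕ) + 1 = j := by omega
  have c3 : ((n : ℤ) - (j : ℕ) = n - (i : ℕ) + 1) ↔ (j : ℕ) + 1 = i := by omega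
  simp only [c1, c2, c3]
  split_ifs <;> first | rfl | omega

theorem stepWeight_eq_zero {d b : ℤ → ℝ} {i j : ℤ} (h : ¬ |i - j| ≤ 1) : stepWeight d b i j = 0 := by
  rw [abs_le] at h
  simp only [stepWeight]
  split_ifs <;> first | rfl | omega

theorem stepWeight_congr {d b d' b' : ℤ → ℝ} (hd : ∀ l, 1 ≤ l → d l = d' l)
    (hb : ∀ l, 1 ≤ l → b l = b' l) {i j : ℤ} (hi : 1 ≤ i) (hj : 1 ≤ j) :
    stepWeight d b i j = stepWeight d' b' i j := by
  simp only [stepWeight, hd i hi, hb i hi, hb j hj]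

theorem trace_matA_pow (d b : ℕ → ℝ) (n k : ℕ) :
    (matA d b n ^ k).trace =
      ∑ γ ∈ closedPaths k n, pathWeight (fun l => d l.toNat) (fun l => b l.toNat) γ := by
  classical
  simp only [Matrix.trace, Matrix.diag_apply, matrix_pow_apply_eq_sum]
  rw [Finset.sum_comm]
  have h1 : ∑ γ ∈ closedPaths k n, pathWeight (fun l => d l.toNat) (fun l => b l.toNat) γ =
      ∑ γ ∈ Fintype.piFinset fun _ : Fin (k + 1) => Finset.Icc (1 : ℤ) n,
        if γ 0 = γ (Fin.last k) then pathWeight (fun l => d l.toNat) (fun l => b l.toNat) γ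
        else 0 := by
    rw [closedPaths, Finset.sum_filter]
    refine Finset.sum_congr rfl fun γ _ => ?_
    by_cases h0 : γ 0 = γ (Fin.last k)
    · by_cases hγ : IsPath γ
      · rw [if_pos hγ, if_pos h0]
      · rw [if_neg hγ, if_pos h0]
        have : ∃ u : Fin k, ¬ |γ u.castSucc - γ u.succ| ≤ 1 := by
          by_contra! hc
          exact hγ ⟨h0, hc⟩
        obtain ⟨u, hu⟩ := this
        exact (Finset.prod_eq_zero (Finset.mem_univ u) (stepWeight_eq_zero hu)).symm
    · rw [if_neg h0, if_neg fun hγ => h0 hγ.1]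
  rw [h1]
  -- Strings of rows correspond to strings of levels by reflection; strings with a jump were given
  -- weight zero.
  refine Finset.sum_of_injOn (fun g u => (n : ℤ) - (g u : ℕ)) ?_ ?_ ?_ ?_
  · intro g _ g' _ hgg
    funext u
    have := congrFun hgg u
    simp only at this
    ext; omega
  · intro g _
    simp only [Finset.mem_coe, Fintype.mem_piFinset, Finset.mem_Icc]
    intro u
    have := (g u).2
    omega
  · intro γ hγ hn
    simp only [Fintype.mem_piFinset, Finset.mem_Icc] at hγ
    refine absurd ⟨fun u => ⟨((n : ℤ) - γ u).toNat, ?_⟩, Finset.mem_coe.2 (Finset.mem_univ _), ?_⟩ hn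
    · have := hγ u; omega
    · funext u
      have := hγ u
      simp only
      omega
  · intro g _
    have hc : ((n : ℤ) - (g 0 : ℕ) = n - (g (Fin.last k) : ℕ)) ↔ g (Fin.last k) = g 0 := by
      rw [Fin.ext_iff]; omega
    simp only [hc, ite_and, pathWeight, matA_eq_stepWeight]
    simp

theorem isPath_shiftPath {k : ℕ} {γ : Fin (k + 1) → ℤ} {i : ℤ} :
    IsPath (shiftPath i γ) ↔ IsPath γ := by
  simp [IsPath, shiftPath]

theorem crossings_shiftPath {k : ℕ} (γ : Fin (k + 1) → ℤ) (i h : ℤ) :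
    crossings (h + i) (shiftPath i γ) = crossings h γ := by
  have : ∀ a : ℤ, a + i = h + i + 1 ↔ a = h + 1 := fun a => by constructor <;> intro <;> linarith
  simp [crossings, shiftPath, this]

theorem flats_shiftPath {k : ℕ} (γ : Fin (k + 1) → ℤ) (i h : ℤ) :
    flats (h + i) (shiftPath i γ) = flats h γ := by
  simp [flats, shiftPath]

theorem pathMax_shiftPath {k : ℕ} (γ : Fin (k + 1) → ℤ) (i : ℤ) :
    pathMax (shiftPath i γ) = pathMax γ + i := by
  apply le_antisymm
  · refine Finset.sup'_le _ _ fun u _ => ?_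
    simpa [shiftPath] using le_pathMax γ u
  · obtain ⟨u, hu⟩ := exists_pathMax γ
    rw [← hu]
    exact le_pathMax (shiftPath i γ) u

theorem shiftPath_shiftPath {k : ℕ} (γ : Fin (k + 1) → ℤ) (i j : ℤ) :
    shiftPath i (shiftPath j γ) = shiftPath (j + i) γ := by
  funext u; simp [shiftPath, add_assoc]

theorem shiftPath_zero {k : ℕ} (γ : Fin (k + 1) → ℤ) : shiftPath 0 γ = γ := by
  funext u; simp [shiftPath]

theorem shareLevel_shiftPath {k l : ℕ} (γ₁ : Fin (k + 1) → ℤ) (γ₂ : Fin (l + 1) → ℤ) (i : ℤ) :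
    ShareLevel (shiftPath i γ₁) (shiftPath i γ₂) ↔ ShareLevel γ₁ γ₂ := by
  constructor
  · rintro ⟨h, hh⟩
    have e : ∀ {k : ℕ} (γ : Fin (k + 1) → ℤ), crossings h (shiftPath i γ) = crossings (h - i) γ ∧
        flats h (shiftPath i γ) = flats (h - i) γ := fun γ => by
      rw [← crossings_shiftPath γ i, ← flats_shiftPath γ i, sub_add_cancel]; simp
    refine ⟨h - i, ?_⟩
    simpa only [(e _).1, (e _).2] using hh
  · rintro ⟨h, hh⟩
    refine ⟨h + i, ?_⟩
    simpa only [crossings_shiftPath, flats_shiftPath] using hh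

/-- The weight of a path in terms of its crossing numbers and its numbers of flat steps. -/
theorem pathWeight_eq_prod {k : ℕ} (d b : ℤ → ℝ) {γ : Fin (k + 1) → ℤ} (hγ : IsPath γ)
    {H : Finset ℤ} (hH : ∀ u, γ u ∈ H) :
    pathWeight d b γ = (∏ h ∈ H, d h ^ flats h γ) * ∏ h ∈ H, b h ^ crossings h γ := by
  have key : ∀ u : Fin k, stepWeight d b (γ u.castSucc) (γ u.succ) =
      (∏ h ∈ H, if γ u.castSucc = h ∧ γ u.succ = h then d h else 1) *
      ∏ h ∈ H, if (γ u.castSucc = h ∧ γ u.succ = h + 1) ∨ (γ u.castSucc = h + 1 ∧ γ u.succ = h)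
        then b h else 1 := by
    intro u
    have hs := abs_le.1 (hγ.2 u)
    have h1 := hH u.castSucc
    have h2 := hH u.succ
    generalize γ u.castSucc = x at *
    generalize γ u.succ = y at *
    have hxy : x = y ∨ y = x + 1 ∨ x = y + 1 := by omega
    rcases hxy with rfl | rfl | rfl
    · rw [Finset.prod_eq_single x, Finset.prod_eq_one]
      · simp [stepWeight]
      · intro h _; rw [if_neg]; omega
      · intro h _ hne; rw [if_neg]; exact fun hc => hne hc.1.symm
      · exact fun hc => absurd h1 hc
    · rw [Finset.prod_eq_one, Finset.prod_eq_single x]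
      · simp [stepWeight]
      · intro h _ hne; rw [if_neg]; omega
      · exact fun hc => absurd h1 hc
      · intro h _; rw [if_neg]; omega
    · rw [Finset.prod_eq_one, Finset.prod_eq_single y]
      · have : y ≠ y + 1 + 1 := by omega
        simp [stepWeight, this]
      · intro h _ hne; rw [if_neg]; omega
      · exact fun hc => absurd h2 hc
      · intro h _; rw [if_neg]; omega
  simp only [pathWeight, key]
  rw [Finset.prod_mul_distrib, Finset.prod_comm, Finset.prod_comm (s := Finset.univ)]
  congr 1
  · refine Finset.prod_congr rfl fun h _ => ?_
    rw [Finset.prod_ite]; simp [flats]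
  · refine Finset.prod_congr rfl fun h _ => ?_
    rw [Finset.prod_ite]; simp [crossings]

/-- Every step is flat or crosses one line. The count is read off from the weight with all entries
equal to `2`, by comparing exponents. -/
theorem sum_flats_add_sum_crossings {k : ℕ} {γ : Fin (k + 1) → ℤ} (hγ : IsPath γ)
    {H : Finset ℤ} (hH : ∀ u, γ u ∈ H) :
    ∑ h ∈ H, flats h γ + ∑ h ∈ H, crossings h γ = k := by
  have h1 := pathWeight_eq_prod (fun _ => 2) (fun _ => 2) hγ hH
  have h2 : pathWeight (fun _ => 2) (fun _ => 2) γ = 2 ^ k := by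
    have : ∀ u : Fin k, stepWeight (fun _ => 2) (fun _ => 2) (γ u.castSucc) (γ u.succ) = 2 := by
      intro u
      have hs := abs_le.1 (hγ.2 u)
      simp only [stepWeight]
      split_ifs <;> first | rfl | omega
    simp [pathWeight, this]
  rw [h2, Finset.prod_pow_eq_pow_sum, Finset.prod_pow_eq_pow_sum, ← pow_add] at h1
  exact (pow_right_injective₀ (by norm_num : (0 : ℝ) < 2) (by norm_num) h1).symm

/-- A closed path crosses every line an even number of times. -/
theorem even_crossings {k : ℕ} {γ : Fin (k + 1) → ℤ} (hγ : IsPath γ) (h : ℤ) :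
    Even (crossings h γ) := by
  -- The sign tells the side of the line. The product of the signs at the two ends of a step is `-1`
  -- exactly for a crossing; around a closed path every sign occurs in matching pairs, so the total
  -- product is `1`.
  set s : ℤ → ℤ := fun x => if x ≤ h then 1 else -1 with hs
  have hs2 : ∀ x, s x * s x = 1 := fun x => by simp only [hs]; split_ifs <;> norm_num
  have key : ∀ u : Fin k, (if (γ u.castSucc = h ∧ γ u.succ = h + 1) ∨
      (γ u.castSucc = h + 1 ∧ γ u.succ = h) then (-1 : ℤ) else 1) =
      s (γ u.castSucc) * s (γ u.succ) := by
    intro u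
    have hstep := abs_le.1 (hγ.2 u)
    simp only [hs]
    split_ifs <;> omega
  have h1 : (-1 : ℤ) ^ crossings h γ = ∏ u : Fin k, s (γ u.castSucc) * s (γ u.succ) := by
    simp only [← key]
    rw [Finset.prod_ite]; simp [crossings]
  have h2 : ∏ u : Fin k, s (γ u.castSucc) = ∏ u : Fin k, s (γ u.succ) := by
    have e1 := Fin.prod_univ_castSucc (fun u : Fin (k + 1) => s (γ u))
    have e2 := Fin.prod_univ_succ (fun u : Fin (k + 1) => s (γ u))
    rw [e1, ← hγ.1, mul_comm] at e2
    have h0 : s (γ 0) ≠ 0 := fun hc => by simpa [hc] using hs2 (γ 0)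
    exact mul_left_cancel₀ h0 e2
  rw [Finset.prod_mul_distrib, h2, ← Finset.prod_mul_distrib] at h1
  simp only [hs2, Finset.prod_const_one] at h1
  by_contra hodd
  rw [Nat.not_even_iff_odd] at hodd
  rw [hodd.neg_one_pow] at h1
  norm_num at h1

/-! ### The random entries as independent sources -/

/-- The assumptions on the entries of the matrix. -/
structure Entries {Ω : Type*} [MeasurableSpace Ω] (μ : Measure Ω) (α ε : ℝ) (d b : ℕ → Ω → ℝ)
    (m : ℕ → ℝ) (C : ℕ → ℕ → ℝ) (v : ℝ) : Prop where
  α_pos : 0 < α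
  ε_nonneg : 0 ≤ ε
  ε_le : ε ≤ α
  d_meas : ∀ n, 1 ≤ n → Measurable (d n)
  b_meas : ∀ n, 1 ≤ n → Measurable (b n)
  indep : iIndepFun (Sum.elim (fun n : ℕ+ => d n) (fun n : ℕ+ => b n)) μ
  b_int : ∀ n, 1 ≤ n → ∀ k : ℕ, Integrable (fun ω => |b n ω| ^ k) μ
  m_zero : m 0 = 1
  b_moment : ∀ k : ℕ,
    Tendsto (fun n : ℕ => ∫ ω, (b n ω / (n : ℝ) ^ α) ^ k ∂μ) atTop (𝓝 (m k))
  d_int : ∀ n, 1 ≤ n → ∀ k : ℕ, Integrable (fun ω => |d n ω| ^ k) μ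
  d_bdd : ∀ k : ℕ, ∃ K : ℝ, ∀ n, 1 ≤ n → ∫ ω, |d n ω| ^ k ∂μ ≤ K
  d_var : Tendsto (fun n => Var[d n; μ]) atTop (𝓝 v)
  z_cov : ∀ k l : ℕ, Even k → Even l →
    Tendsto (fun n => cov[zfl μ α ε b n k, zfl μ α ε b n l; μ]) atTop (𝓝 (C k l))
  z_bdd : ∀ k r : ℕ, 1 ≤ k → 1 ≤ r →
    ∃ K : ℝ, ∀ n, 1 ≤ n → ∫ ω, |zfl μ α ε b n k ω| ^ r ∂μ ≤ K

/-- Adding constants to an independent family. -/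
theorem iIndepFun_of_subtype_of_const {Ω ι : Type*} [MeasurableSpace Ω] {μ : Measure Ω}
    [IsProbabilityMeasure μ] {f : ι → Ω → ℝ} {p : ι → Prop}
    (h : iIndepFun (fun i : {i // p i} => f i) μ) (hc : ∀ i, ¬ p i → ∃ c, f i = fun _ => c) :
    iIndepFun f μ := by
  classical
  rw [iIndepFun_iff_measure_inter_preimage_eq_mul] at h ⊢
  intro S sets hS
  -- The preimage of a set under a constant is everything, which drops out of intersection and
  -- product, or empty, which makes both sides zero.
  by_cases hall : ∀ i ∈ S, ¬ p i → f i ⁻¹' sets i = Set.univ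
  · have h1 := h (S.subtype p) (sets := fun i => sets i) fun i hi => hS i (by simpa using hi)
    have e1 : ⋂ i ∈ S, f i ⁻¹' sets i = ⋂ i ∈ S.subtype p, f i ⁻¹' sets i := by
      ext ω
      simp only [Set.mem_iInter, Finset.mem_subtype, Subtype.forall]
      refine ⟨fun hω i _ hi => hω i hi, fun hω i hi => ?_⟩
      by_cases hp : p i
      · exact hω i hp hi
      · rw [hall i hi hp]; trivial
    rw [e1, h1, Finset.prod_subtype_eq_prod_filter (f := fun i => μ (f i ⁻¹' sets i)),
      Finset.prod_filter]
    refine Finset.prod_congr rfl fun i hi => ?_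
    split_ifs with hp
    · rfl
    · rw [hall i hi hp, measure_univ]
  · push Not at hall
    obtain ⟨i, hi, hp, hne⟩ := hall
    obtain ⟨c, hcc⟩ := hc i hp
    have h0 : f i ⁻¹' sets i = ∅ := by
      rw [hcc] at hne ⊢
      by_cases hm : c ∈ sets i <;> simp_all
    rw [Finset.prod_eq_zero hi (by rw [h0, measure_empty])]
    refine measure_mono_null (Set.iInter₂_subset i hi) (by rw [h0, measure_empty])

section Sources

variable {Ω : Type*}

/-- The extension by zero to all integer levels. -/
def extendZero (f : ℕ → Ω → ℝ) (j : ℤ) (ω : Ω) : ℝ := if 1 ≤ j then f j.toNat ω else 0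

/-- All entries of the matrix, the diagonal ones on the left. -/
def source (d b : ℕ → Ω → ℝ) : ℤ ⊕ ℤ → Ω → ℝ := Sum.elim (extendZero d) (extendZero b)

/-- The product of the random entries along a path. -/
def pathVar {k : ℕ} (d b : ℕ → Ω → ℝ) (γ : Fin (k + 1) → ℤ) (ω : Ω) : ℝ :=
  pathWeight (fun j => extendZero d j ω) (fun j => extendZero b j ω) γ

/-- The sources at distance at most `r` from level `i`. -/
def window (r i : ℤ) : Set (ℤ ⊕ ℤ) := {e | |Sum.elim id id e - i| ≤ r}

theorem disjoint_window {r i j : ℤ} (h : 2 * r < |i - j|) :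
    Disjoint (window r i) (window r j) := by
  rw [Set.disjoint_left]
  intro e he he'
  simp only [window, Set.mem_ofPred_eq] at he he'
  have := abs_sub_le i (Sum.elim id id e) j
  rw [abs_sub_comm i (Sum.elim id id e)] at this
  linarith

theorem extendZero_of_lt {f : ℕ → Ω → ℝ} {j : ℤ} (hj : ¬ 1 ≤ j) : extendZero f j = fun _ => 0 := by
  funext ω; simp [extendZero, hj]

theorem extendZero_of_le {f : ℕ → Ω → ℝ} {j : ℤ} (hj : 1 ≤ j) : extendZero f j = f j.toNat := by
  funext ω; simp [extendZero, hj]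

/-- The entry read by a step is indexed by one of the two levels that the step joins, hence by a
level of the path. -/
theorem measurable_pathVar {k : ℕ} (d b : ℕ → Ω → ℝ) {γ : Fin (k + 1) → ℤ} (r i : ℤ)
    (hγ : ∀ u, |γ u - i| ≤ r) :
    Measurable[⨆ e ∈ window r i, MeasurableSpace.comap (source d b e) inferInstance]
      (pathVar d b γ) := by
  have hs : ∀ e ∈ window r i,
      Measurable[⨆ e ∈ window r i, MeasurableSpace.comap (source d b e) inferInstance]
        (source d b e) := fun e he =>
    (comap_measurable (source d b e)).mono
      (le_iSup₂ (f := fun e _ => MeasurableSpace.comap (source d b e) inferInstance) e he) le_rfl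
  unfold pathVar pathWeight
  refine Finset.measurable_fun_prod _ fun u _ => ?_
  have hd : ∀ u, Measurable[⨆ e ∈ window r i, MeasurableSpace.comap (source d b e) inferInstance]
      (extendZero d (γ u)) := fun u => hs (Sum.inl (γ u)) (hγ u)
  have hb : ∀ u, Measurable[⨆ e ∈ window r i, MeasurableSpace.comap (source d b e) inferInstance]
      (extendZero b (γ u)) := fun u => hs (Sum.inr (γ u)) (hγ u)
  simp only [stepWeight]
  split_ifs
  · exact hd _
  · exact hb _
  · exact hb _
  · exact measurable_const

end Sources

namespace Entries

variable {Ω : Type*} [MeasurableSpace Ω] {μ : Measure Ω} {α ε : ℝ} {d b : ℕ → Ω → ℝ}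
    {m : ℕ → ℝ} {C : ℕ → ℕ → ℝ} {v : ℝ}

theorem measurable_extendZero_d (h : Entries μ α ε d b m C v) (j : ℤ) :
    Measurable (extendZero d j) := by
  by_cases hj : 1 ≤ j
  · rw [extendZero_of_le hj]; exact h.d_meas _ (by omega)
  · rw [extendZero_of_lt hj]; exact measurable_const

theorem measurable_extendZero_b (h : Entries μ α ε d b m C v) (j : ℤ) :
    Measurable (extendZero b j) := by
  by_cases hj : 1 ≤ j
  · rw [extendZero_of_le hj]; exact h.b_meas _ (by omega)
  · rw [extendZero_of_lt hj]; exact measurable_const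

theorem measurable_source (h : Entries μ α ε d b m C v) (e : ℤ ⊕ ℤ) : Measurable (source d b e) := by
  rcases e with j | j
  · exact h.measurable_extendZero_d j
  · exact h.measurable_extendZero_b j

variable [IsProbabilityMeasure μ]

/-- At positive levels the sources are the given independent family reindexed; at all other levels
they are the constant `0`. -/
theorem iIndepFun_source (h : Entries μ α ε d b m C v) : iIndepFun (source d b) μ := by
  refine iIndepFun_of_subtype_of_const (p := fun e => 1 ≤ Sum.elim id id e) ?_ ?_
  · set φ : {e : ℤ ⊕ ℤ // 1 ≤ Sum.elim id id e} → ℕ+ ⊕ ℕ+ := fun e => match e with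
      | ⟨Sum.inl j, hj⟩ => Sum.inl ⟨j.toNat, by simp at hj; omega⟩
      | ⟨Sum.inr j, hj⟩ => Sum.inr ⟨j.toNat, by simp at hj; omega⟩ with hφ
    have hinj : Function.Injective φ := by
      rintro ⟨i | i, hi⟩ ⟨j | j, hj⟩ hij
      · have e : i.toNat = j.toNat := congrArg PNat.val (Sum.inl.inj hij)
        have hi' : 1 ≤ i := hi
        have hj' : 1 ≤ j := hj
        exact Subtype.ext (congrArg Sum.inl (by omega))
      · exact absurd hij (by simp [hφ])
      · exact absurd hij (by simp [hφ])
      · have e : i.toNat = j.toNat := congrArg PNat.val (Sum.inr.inj hij)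
        have hi' : 1 ≤ i := hi
        have hj' : 1 ≤ j := hj
        exact Subtype.ext (congrArg Sum.inr (by omega))
    have h1 := h.indep.precomp hinj
    convert h1 using 1
    funext e
    rcases e with ⟨j | j, hj⟩
    · exact extendZero_of_le hj
    · exact extendZero_of_le hj
  · rintro (j | j) hj
    · exact ⟨0, extendZero_of_lt hj⟩
    · exact ⟨0, extendZero_of_lt hj⟩

theorem bdd_single_d (h : Entries μ α ε d b m C v) (j : ℤ) :
    BddMoments μ (fun (_ : Unit) => extendZero d j) := by
  refine ⟨fun _ => h.measurable_extendZero_d j, fun r => ⟨_, fun _ => ⟨?_, le_rfl⟩⟩⟩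
  by_cases hj : 1 ≤ j
  · rw [extendZero_of_le hj]; exact h.d_int _ (by omega) r
  · rw [extendZero_of_lt hj]; exact integrable_const _

theorem bdd_single_b (h : Entries μ α ε d b m C v) (j : ℤ) :
    BddMoments μ (fun (_ : Unit) => extendZero b j) := by
  refine ⟨fun _ => h.measurable_extendZero_b j, fun r => ⟨_, fun _ => ⟨?_, le_rfl⟩⟩⟩
  by_cases hj : 1 ≤ j
  · rw [extendZero_of_le hj]; exact h.b_int _ (by omega) r
  · rw [extendZero_of_lt hj]; exact integrable_const _

theorem bdd_single_pathVar (h : Entries μ α ε d b m C v) {k : ℕ} (γ : Fin (k + 1) → ℤ) :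
    BddMoments μ (fun (_ : Unit) => pathVar d b γ) := by
  refine BddMoments.prod Finset.univ (z := fun u (_ : Unit) ω =>
    stepWeight (fun j => extendZero d j ω) (fun j => extendZero b j ω) (γ (Fin.castSucc u))
      (γ (Fin.succ u))) fun u _ => ?_
  simp only [stepWeight]
  split_ifs
  · exact h.bdd_single_d _
  · exact h.bdd_single_b _
  · exact h.bdd_single_b _
  · exact BddMoments.const (c := fun _ => 0) (C := 0) (by simp)

end Entries

/-! ### Fluctuations of products of entries -/

/-- A family of variables with bounded moments whose fluctuations have size `s⁻¹`. -/
def Concentrated {Ω : Type*} [MeasurableSpace Ω] (μ : Measure Ω) {I : Type*} (s : I → ℝ)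
    (x : I → Ω → ℝ) : Prop :=
  BddMoments μ x ∧ ∃ c : I → ℝ, (∃ K, ∀ i, |c i| ≤ K) ∧
    BddMoments μ (fun i ω => s i * (x i ω - c i))

namespace Concentrated

variable {Ω : Type*} [MeasurableSpace Ω] {μ : Measure Ω} {I : Type*} {s : I → ℝ}
  {x y : I → Ω → ℝ}

theorem reindex {J : Type*} (hx : Concentrated μ s x) (f : J → I) :
    Concentrated μ (fun j => s (f j)) (fun j => x (f j)) :=
  let ⟨h, c, ⟨K, hK⟩, hc⟩ := hx
  ⟨h.reindex f, fun j => c (f j), ⟨K, fun _ => hK _⟩, hc.reindex f⟩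

theorem sumElim {J : Type*} {t : J → ℝ} {z : J → Ω → ℝ} (hx : Concentrated μ s x)
    (hz : Concentrated μ t z) : Concentrated μ (Sum.elim s t) (Sum.elim x z) := by
  have aux : ∀ {p : I → Ω → ℝ} {q : J → Ω → ℝ}, BddMoments μ p → BddMoments μ q →
      BddMoments μ (Sum.elim p q) := fun {p q} hp hq => by
    refine ⟨fun i => ?_, fun r => ?_⟩
    · rcases i with i | j
      · exact hp.1 i
      · exact hq.1 j
    · obtain ⟨K, hK⟩ := hp.2 r
      obtain ⟨K', hK'⟩ := hq.2 r
      refine ⟨max K K', fun i => ?_⟩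
      rcases i with i | j
      · exact ⟨(hK i).1, (hK i).2.trans (le_max_left _ _)⟩
      · exact ⟨(hK' j).1, (hK' j).2.trans (le_max_right _ _)⟩
  obtain ⟨h, c, ⟨K, hK⟩, hc⟩ := hx
  obtain ⟨h', c', ⟨K', hK'⟩, hc'⟩ := hz
  refine ⟨aux h h', Sum.elim c c', ⟨max K K', fun i => ?_⟩, ?_⟩
  · rcases i with i | j
    · exact (hK i).trans (le_max_left _ _)
    · exact (hK' j).trans (le_max_right _ _)
  · convert aux hc hc' using 1
    funext i
    rcases i with i | j <;> rfl

variable [IsProbabilityMeasure μ]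

-- Write `xy - cc' = (x - c) y + c (y - c')`.
omit [IsProbabilityMeasure μ] in
theorem mul (hx : Concentrated μ s x) (hy : Concentrated μ s y) :
    Concentrated μ s (fun i ω => x i ω * y i ω) := by
  obtain ⟨h, c, ⟨K, hK⟩, hc⟩ := hx
  obtain ⟨h', c', ⟨K', hK'⟩, hc'⟩ := hy
  refine ⟨h.mul h', fun i => c i * c' i, ⟨K * K', fun i => ?_⟩, ?_⟩
  · rw [abs_mul]
    exact mul_le_mul (hK i) (hK' i) (abs_nonneg _) ((abs_nonneg _).trans (hK i))
  · convert (hc.mul h').add (hc'.const_mul hK) using 3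
    ring

theorem prod {κ : Type*} (S : Finset κ) {z : κ → I → Ω → ℝ} (h : ∀ a ∈ S, Concentrated μ s (z a)) :
    Concentrated μ s (fun i ω => ∏ a ∈ S, z a i ω) := by
  classical
  induction S using Finset.induction_on with
  | empty =>
    refine ⟨by simpa using BddMoments.const (μ := μ) (c := fun _ : I => (1 : ℝ)) (C := 1) (by simp),
      fun _ => 1, ⟨1, by simp⟩, ?_⟩
    simpa using BddMoments.const (μ := μ) (c := fun _ : I => (0 : ℝ)) (C := 0) (by simp)
  | insert a S ha ih =>
    simp only [Finset.prod_insert ha]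
    exact (h a (Finset.mem_insert_self _ _)).mul
      (ih fun c hc => h c (Finset.mem_insert_of_mem hc))

/-- The reference constant cancels on centring. Hence products may be compared with products of
constants, although the mean is what enters the fluctuation. -/
theorem center (hx : Concentrated μ s x) :
    BddMoments μ (fun i ω => s i * (x i ω - ∫ ω', x i ω' ∂μ)) := by
  obtain ⟨h, c, _, hc⟩ := hx
  convert hc.center using 3 with i ω
  rw [integral_const_mul, integral_sub (h.integrable i) (integrable_const _)]
  simp
  ring

end Concentrated

/-! ### The fluctuation as a locally dependent row sum -/

/-- A matrix size together with a level of the matrix of that size. -/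
abbrev LevelIdx : Type := {p : ℕ × ℤ // 1 ≤ p.2 ∧ p.2 ≤ p.1}

theorem LevelIdx.one_le_cast (p : LevelIdx) : (1 : ℝ) ≤ (p.1.1 : ℝ) := by
  have := p.2
  exact_mod_cast (show (1 : ℤ) ≤ p.1.1 by omega)

/-- The part of `tr (A_n ^ k)` that comes from the closed paths, as a random variable. -/
noncomputable def traceSum {Ω : Type*} (d b : ℕ → Ω → ℝ) (k n : ℕ) (ω : Ω) : ℝ :=
  ∑ γ ∈ closedPaths k n, pathVar d b γ ω

/-- The factor `n^{ε - 1/2 - αk}` of the fluctuation of `tr (A_n ^ k)` in `S_n(x^k)`. -/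
noncomputable def normalizer (α ε : ℝ) (k n : ℕ) : ℝ :=
  (n : ℝ) ^ (ε + 1 / 2) * (1 / (n : ℝ)) * (((n : ℝ) ^ α)⁻¹) ^ k

open Classical in
/-- The closed paths of length `k` that start at level `0`. -/
noncomputable def rootedPaths (k : ℕ) : Finset (Fin (k + 1) → ℤ) :=
  (Fintype.piFinset fun _ : Fin (k + 1) => Finset.Icc (-(k : ℤ)) k).filter
    fun γ => IsPath γ ∧ γ 0 = 0

theorem mem_rootedPaths {k : ℕ} {γ : Fin (k + 1) → ℤ} :
    γ ∈ rootedPaths k ↔ IsPath γ ∧ γ 0 = 0 := by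
  simp only [rootedPaths, Finset.mem_filter, Fintype.mem_piFinset, Finset.mem_Icc,
    and_iff_right_iff_imp]
  rintro ⟨h, h0⟩ u
  have := abs_le.1 (h.abs_sub_le u 0)
  rw [h0] at this
  constructor <;> linarith [this.1, this.2]

open Classical in
/-- The contribution of the paths that start at level `i` to `S_n(P)`. -/
noncomputable def localTerm {Ω : Type*} [MeasurableSpace Ω] (μ : Measure Ω) (α ε : ℝ)
    (d b : ℕ → Ω → ℝ) (P : Polynomial ℝ) (n : ℕ) (i : ℤ) (ω : Ω) : ℝ :=
  ∑ k ∈ Finset.range (P.natDegree + 1), P.coeff k * (normalizer α ε k n *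
    ∑ γ ∈ rootedPaths k, if shiftPath i γ ∈ closedPaths k n then
      pathVar d b (shiftPath i γ) ω - ∫ ω', pathVar d b (shiftPath i γ) ω' ∂μ else 0)

/-- Every closed path is, in exactly one way, a path rooted at `0` moved to its starting level. -/
theorem sum_closedPaths_eq {M : Type*} [AddCommMonoid M] (k n : ℕ) (f : (Fin (k + 1) → ℤ) → M) :
    open Classical in
    ∑ i ∈ Finset.Icc (1 : ℤ) n, ∑ γ ∈ rootedPaths k,
      (if shiftPath i γ ∈ closedPaths k n then f (shiftPath i γ) else 0) =
      ∑ γ ∈ closedPaths k n, f γ := by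
  classical
  rw [← Finset.sum_product', ← Finset.sum_filter]
  refine Finset.sum_bij' (fun p _ => shiftPath p.1 p.2) (fun γ _ => (γ 0, shiftPath (-γ 0) γ))
    ?_ ?_ ?_ ?_ ?_
  · intro p hp
    exact (Finset.mem_filter.1 hp).2
  · intro γ hγ
    have h := mem_closedPaths.1 hγ
    simp only [Finset.mem_filter, Finset.mem_product, mem_rootedPaths, Finset.mem_Icc,
      shiftPath_shiftPath, neg_add_cancel, shiftPath_zero, isPath_shiftPath]
    exact ⟨⟨h.1 0, h.2, by simp [shiftPath]⟩, hγ⟩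
  · intro p hp
    have h := (mem_rootedPaths.1 (Finset.mem_product.1 (Finset.mem_filter.1 hp).1).2).2
    have e : shiftPath p.1 p.2 0 = p.1 := by simp [shiftPath, h]
    rw [e, shiftPath_shiftPath]
    simp [shiftPath_zero]
  · intro γ _
    simp [shiftPath_shiftPath, shiftPath_zero]
  · intro p _
    rfl

namespace Entries

variable {Ω : Type*} [MeasurableSpace Ω] {μ : Measure Ω} [IsProbabilityMeasure μ] {α ε : ℝ}
  {d b : ℕ → Ω → ℝ} {m : ℕ → ℝ} {C : ℕ → ℕ → ℝ} {v : ℝ}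

-- Since `ε ≤ α`, the power `y^{ε-α}` decreases in `y`. This passes from the normalization at a
-- level `x` of the matrix to that at its size `y`.
omit [IsProbabilityMeasure μ] in
theorem rpow_mul_inv_rpow_le (h : Entries μ α ε d b m C v) {x y : ℝ} (hx : 1 ≤ x) (hxy : x ≤ y) :
    |y ^ ε * (y ^ α)⁻¹ * (x ^ α * (x ^ ε)⁻¹)| ≤ 1 := by
  have hx0 : 0 < x := by linarith
  have hy0 : 0 < y := by linarith
  have e1 : y ^ ε * (y ^ α)⁻¹ = y ^ (ε - α) := by rw [Real.rpow_sub hy0, div_eq_mul_inv]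
  have e2 : x ^ α * (x ^ ε)⁻¹ = (x ^ (ε - α))⁻¹ := by
    rw [Real.rpow_sub hx0, inv_div, div_eq_mul_inv]
  rw [e1, e2, abs_of_nonneg (by positivity)]
  have := Real.rpow_le_rpow_of_nonpos hx0 hxy (show ε - α ≤ 0 by linarith [h.ε_le])
  exact mul_inv_le_one_of_le₀ this (by positivity)

omit [IsProbabilityMeasure μ] in
theorem rpow_mul_inv_rpow_le_one (h : Entries μ α ε d b m C v) {y : ℝ} (hy : 1 ≤ y) :
    |y ^ ε * (y ^ α)⁻¹| ≤ 1 := by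
  simpa using h.rpow_mul_inv_rpow_le le_rfl hy

theorem abs_inv_rpow_le_one {y a : ℝ} (hy : 1 ≤ y) (ha : 0 ≤ a) : |(y ^ a)⁻¹| ≤ 1 := by
  rw [abs_of_nonneg (by positivity)]
  exact inv_le_one_of_one_le₀ (Real.one_le_rpow hy ha)

theorem bdd_d (h : Entries μ α ε d b m C v) :
    BddMoments μ (fun p : LevelIdx => extendZero d p.1.2) := by
  refine ⟨fun p => h.measurable_extendZero_d _, fun r => ?_⟩
  obtain ⟨K, hK⟩ := h.d_bdd r
  refine ⟨K, fun p => ⟨(h.bdd_single_d _).integrable_abs_pow () r, ?_⟩⟩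
  simp only [extendZero_of_le p.2.1]
  exact hK _ (by have := p.2; omega)

theorem bdd_zfl (h : Entries μ α ε d b m C v) :
    BddMoments μ (fun p : LevelIdx => zfl μ α ε b p.1.2.toNat 1) := by
  have hu : ∀ j : ℕ, 1 ≤ j → BddMoments μ (fun _ : Unit => zfl μ α ε b j 1) := fun j hj => by
    have h1 := h.bdd_single_b j
    rw [extendZero_of_le (by exact_mod_cast hj)] at h1
    have h2 := ((h1.const_mul (c := fun _ => ((j : ℝ) ^ α)⁻¹) (C := |((j : ℝ) ^ α)⁻¹|)
      fun _ => le_rfl).center).const_mul (c := fun _ => (j : ℝ) ^ ε) (C := |(j : ℝ) ^ ε|)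
      fun _ => le_rfl
    convert h2 using 3
    simp only [zfl, pow_one, Int.toNat_natCast, div_eq_inv_mul]
  have hp : ∀ p : LevelIdx, 1 ≤ p.1.2.toNat := fun p => by have := p.2; omega
  refine ⟨fun p => (hu _ (hp p)).measurable (), fun r => ?_⟩
  rcases Nat.eq_zero_or_pos r with rfl | hr
  · exact ⟨1, fun p => by simp⟩
  obtain ⟨K, hK⟩ := h.z_bdd 1 r le_rfl hr
  exact ⟨K, fun p => ⟨(hu _ (hp p)).integrable_abs_pow () r, hK _ (hp p)⟩⟩

/-- The reference constant is `0`: a diagonal entry is bounded in all moments and divided by `n^α`,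
which dominates `n^ε`. -/
theorem concentrated_d (h : Entries μ α ε d b m C v) :
    Concentrated μ (fun p : LevelIdx => (p.1.1 : ℝ) ^ ε)
      (fun p ω => ((p.1.1 : ℝ) ^ α)⁻¹ * extendZero d p.1.2 ω) := by
  refine ⟨h.bdd_d.const_mul fun p => abs_inv_rpow_le_one p.one_le_cast h.α_pos.le, fun _ => 0,
    ⟨0, by simp⟩, ?_⟩
  convert h.bdd_d.const_mul fun p => h.rpow_mul_inv_rpow_le_one p.one_le_cast using 3
  ring

/-- The reference constant is the rescaled mean. At level `j` the fluctuation scaled by `n^ε` is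
`z_j^1` times `n^{ε-α} / j^{ε-α}`, which is at most `1`. -/
theorem concentrated_b (h : Entries μ α ε d b m C v) :
    Concentrated μ (fun p : LevelIdx => (p.1.1 : ℝ) ^ ε)
      (fun p ω => ((p.1.1 : ℝ) ^ α)⁻¹ * extendZero b p.1.2 ω) := by
  have hlev : ∀ p : LevelIdx, (1 : ℝ) ≤ p.1.2 ∧ (p.1.2 : ℝ) ≤ p.1.1 := fun p =>
    ⟨by exact_mod_cast p.2.1, by exact_mod_cast p.2.2⟩
  have hcast : ∀ p : LevelIdx, ((p.1.2.toNat : ℕ) : ℝ) = p.1.2 := fun p => by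
    have := p.2
    exact_mod_cast Int.toNat_of_nonneg (show 0 ≤ p.1.2 by omega)
  set c : LevelIdx → ℝ := fun p => ((p.1.1 : ℝ) ^ α)⁻¹ * ∫ ω, extendZero b p.1.2 ω ∂μ
  have hc : ∃ K, ∀ p, |c p| ≤ K := by
    -- A convergent sequence is bounded, and `j ≤ n` makes division by `n^α` stronger than by `j^α`.
    have hb := (h.b_moment 1).abs.bddAbove_range
    obtain ⟨K, hK⟩ := hb
    refine ⟨K, fun p => ?_⟩
    have h1 := hK ⟨p.1.2.toNat, rfl⟩
    simp only [pow_one, integral_div, hcast] at h1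
    have hx : (0 : ℝ) < p.1.2 := by linarith [(hlev p).1]
    have hxa : 0 < (p.1.2 : ℝ) ^ α := by positivity
    have hle : (p.1.2 : ℝ) ^ α ≤ (p.1.1 : ℝ) ^ α :=
      Real.rpow_le_rpow hx.le (hlev p).2 h.α_pos.le
    refine le_trans ?_ h1
    simp only [c]
    rw [extendZero_of_le p.2.1, abs_mul, abs_div, div_eq_inv_mul]
    refine mul_le_mul_of_nonneg_right ?_ (abs_nonneg _)
    rw [abs_of_nonneg (by positivity), abs_of_pos hxa]
    exact inv_anti₀ hxa hle
  have hfl : BddMoments μ (fun (p : LevelIdx) ω => (p.1.1 : ℝ) ^ ε *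
      (((p.1.1 : ℝ) ^ α)⁻¹ * extendZero b p.1.2 ω - c p)) := by
    convert h.bdd_zfl.const_mul fun p => h.rpow_mul_inv_rpow_le (hlev p).1 (hlev p).2 using 3
      with p ω
    have hx : (0 : ℝ) < p.1.2 := by linarith [(hlev p).1]
    have hxa : (p.1.2 : ℝ) ^ α ≠ 0 := by positivity
    have hxe : (p.1.2 : ℝ) ^ ε ≠ 0 := by positivity
    simp only [c, zfl, pow_one, integral_div, hcast, extendZero_of_le p.2.1]
    field_simp
  obtain ⟨K, hK⟩ := hc
  refine ⟨?_, c, ⟨K, hK⟩, hfl⟩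
  have h1 := (BddMoments.const (μ := μ) hK).add (hfl.const_mul fun p =>
    abs_inv_rpow_le_one p.one_le_cast h.ε_nonneg)
  convert h1 using 3 with p ω
  have : (p.1.1 : ℝ) ^ ε ≠ 0 := by
    have := p.one_le_cast
    positivity
  field_simp
  ring

theorem concentrated_pathVar (h : Entries μ α ε d b m C v) (k : ℕ) :
    Concentrated μ
      (fun q : {q : ℕ × (Fin (k + 1) → ℤ) // q.2 ∈ closedPaths k q.1} => (q.1.1 : ℝ) ^ ε)
      (fun q ω => (((q.1.1 : ℝ) ^ α)⁻¹) ^ k * pathVar d b q.1.2 ω) := by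
  have hlev : ∀ (q : {q : ℕ × (Fin (k + 1) → ℤ) // q.2 ∈ closedPaths k q.1}) u,
      1 ≤ q.1.2 u ∧ q.1.2 u ≤ q.1.1 := fun q u => (mem_closedPaths.1 q.2).1 u
  have hstep : ∀ u ∈ (Finset.univ : Finset (Fin k)), Concentrated μ
      (fun q : {q : ℕ × (Fin (k + 1) → ℤ) // q.2 ∈ closedPaths k q.1} => (q.1.1 : ℝ) ^ ε)
      (fun q ω => ((q.1.1 : ℝ) ^ α)⁻¹ * stepWeight (fun j => extendZero d j ω)
        (fun j => extendZero b j ω) (q.1.2 (Fin.castSucc u)) (q.1.2 (Fin.succ u))) := by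
    intro u _
    -- The left summand selects a diagonal entry and the right one an off-diagonal entry, indexed by
    -- the lower level of the step.
    let f : {q : ℕ × (Fin (k + 1) → ℤ) // q.2 ∈ closedPaths k q.1} → LevelIdx ⊕ LevelIdx :=
      fun q => if q.1.2 u.castSucc = q.1.2 u.succ then Sum.inl ⟨(q.1.1, q.1.2 u.castSucc), hlev q _⟩
        else if q.1.2 u.succ = q.1.2 u.castSucc + 1 then
          Sum.inr ⟨(q.1.1, q.1.2 u.castSucc), hlev q _⟩
        else Sum.inr ⟨(q.1.1, q.1.2 u.succ), hlev q _⟩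
    have h1 := (h.concentrated_d.sumElim h.concentrated_b).reindex f
    convert h1 using 1
    · funext q
      simp only [f]
      split_ifs <;> rfl
    · funext q ω
      have hs := abs_le.1 ((mem_closedPaths.1 q.2).2.2 u)
      simp only [f, stepWeight]
      split_ifs <;> first | rfl | omega
  have hprod := Concentrated.prod Finset.univ hstep
  convert hprod using 3
  rw [Finset.prod_mul_distrib]
  simp [pathVar, pathWeight]

theorem sqrt_mul_normalizer (α ε : ℝ) (k : ℕ) {n : ℕ} (hn : 1 ≤ n) :
    √(n : ℝ) * normalizer α ε k n = (n : ℝ) ^ ε * (((n : ℝ) ^ α)⁻¹) ^ k := by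
  have hn' : (0 : ℝ) < n := by exact_mod_cast hn
  rw [normalizer, Real.rpow_add hn', ← Real.sqrt_eq_rpow]
  have : √(n : ℝ) * √(n : ℝ) = n := Real.mul_self_sqrt hn'.le
  calc _ = (√(n : ℝ) * √(n : ℝ)) * (1 / n) * ((n : ℝ) ^ ε * (((n : ℝ) ^ α)⁻¹) ^ k) := by ring
    _ = _ := by rw [this]; field_simp

/-- After multiplication by `√n` the normalizer is `n^ε n^{-αk}`: each length-`k` factor is rescaled
by `n^{-α}`, and the centred product is magnified by `n^ε`. The number of rooted paths does not
depend on `n`. -/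
theorem bdd_localTerm (h : Entries μ α ε d b m C v) (P : Polynomial ℝ) :
    BddMoments μ (fun (p : ℕ × ℤ) ω => √(p.1 : ℝ) * localTerm μ α ε d b P p.1 p.2 ω) := by
  classical
  have h1 : BddMoments μ (fun (p : ℕ × ℤ) ω => ∑ k ∈ Finset.range (P.natDegree + 1),
      P.coeff k * ∑ γ ∈ rootedPaths k, if shiftPath p.2 γ ∈ closedPaths k p.1 then
      (p.1 : ℝ) ^ ε * ((((p.1 : ℝ) ^ α)⁻¹) ^ k * pathVar d b (shiftPath p.2 γ) ω -
        ∫ ω', (((p.1 : ℝ) ^ α)⁻¹) ^ k * pathVar d b (shiftPath p.2 γ) ω' ∂μ) else 0) := by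
    refine BddMoments.sum _ fun k _ => ?_
    refine BddMoments.const_mul (c := fun _ => P.coeff k) (C := |P.coeff k|) (fun _ => le_rfl) ?_
    refine BddMoments.sum _ fun γ _ => ?_
    refine (h.concentrated_pathVar k).center.of_eq_zero_or fun p => ?_
    by_cases hp : shiftPath p.2 γ ∈ closedPaths k p.1
    · refine Or.inr ⟨⟨(p.1, shiftPath p.2 γ), hp⟩, ?_⟩
      funext ω
      simp only [if_pos hp]
    · refine Or.inl ?_
      funext ω
      simp only [if_neg hp, Pi.zero_apply]
  convert h1 using 3 with p ω
  rcases Nat.eq_zero_or_pos p.1 with h0 | h0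
  · have hempty : ∀ (k : ℕ) (γ : Fin (k + 1) → ℤ), γ ∉ closedPaths k p.1 := fun k γ hγ => by
      have := (mem_closedPaths.1 hγ).1 0
      omega
    rw [show √(p.1 : ℝ) = 0 by simp [h0], zero_mul]
    simp [hempty]
  · rw [localTerm, Finset.mul_sum]
    refine Finset.sum_congr rfl fun k _ => ?_
    rw [mul_left_comm, ← mul_assoc (√(p.1 : ℝ)), sqrt_mul_normalizer α ε k h0, Finset.mul_sum]
    congr 1
    refine Finset.sum_congr rfl fun γ _ => ?_
    split_ifs
    · rw [integral_const_mul]; ring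
    · simp

theorem integrable_pathVar (h : Entries μ α ε d b m C v) {k : ℕ} (γ : Fin (k + 1) → ℤ) :
    Integrable (pathVar d b γ) μ := (h.bdd_single_pathVar γ).integrable ()

/-- A path of length at most `deg P` stays within `deg P` of its starting level, and windows of that
radius are disjoint when the levels are more than `2 deg P` apart. -/
theorem locallyDependent (h : Entries μ α ε d b m C v) (P : Polynomial ℝ) :
    LocallyDependent μ (fun e => MeasurableSpace.comap (source d b e) inferInstance)
      (window P.natDegree) (2 * P.natDegree) (localTerm μ α ε d b P) where
  le e := (h.measurable_source e).comap_le
  indep := h.iIndepFun_source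
  disj i j hij := disjoint_window hij
  meas n i := by
    refine Finset.measurable_fun_sum _ fun k hk => Measurable.const_mul (Measurable.const_mul
      (Finset.measurable_fun_sum _ fun γ hγ => ?_) _) _
    split_ifs
    · refine (measurable_pathVar d b _ i fun u => ?_).sub_const _
      obtain ⟨hγ, h0⟩ := mem_rootedPaths.1 hγ
      have h1 := hγ.abs_sub_le u 0
      rw [h0, sub_zero] at h1
      simp only [shiftPath, add_sub_cancel_right]
      refine h1.trans ?_
      have := Finset.mem_range.1 hk
      exact_mod_cast Nat.lt_succ_iff.1 this
    · exact measurable_const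
  zero n i hi := by
    funext ω
    refine Finset.sum_eq_zero fun k _ => ?_
    rw [Finset.sum_eq_zero, mul_zero, mul_zero]
    intro γ hγ
    rw [if_neg]
    intro hc
    have h1 := (mem_closedPaths.1 hc).1 0
    simp only [shiftPath, (mem_rootedPaths.1 hγ).2, zero_add] at h1
    exact hi (Finset.mem_Icc.2 h1)
  centered n i := by
    classical
    have hint : ∀ (k : ℕ) (γ : Fin (k + 1) → ℤ), Integrable (fun ω =>
        if shiftPath i γ ∈ closedPaths k n then pathVar d b (shiftPath i γ) ω -
        ∫ ω', pathVar d b (shiftPath i γ) ω' ∂μ else 0) μ := by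
      intro k γ
      split_ifs
      · exact (h.integrable_pathVar _).sub (integrable_const _)
      · exact integrable_const _
    simp only [localTerm]
    rw [integral_finsetSum _ fun k _ => ((integrable_finsetSum _ fun γ _ => hint k γ).const_mul
      _).const_mul _]
    refine Finset.sum_eq_zero fun k _ => ?_
    rw [integral_const_mul, integral_const_mul, integral_finsetSum _ fun γ _ => hint k γ,
      Finset.sum_eq_zero, mul_zero, mul_zero]
    intro γ _
    split_ifs
    · rw [integral_sub (h.integrable_pathVar _) (integrable_const _)]; simp
    · simp
  bdd := h.bdd_localTerm P

theorem integrable_traceSum (h : Entries μ α ε d b m C v) (k n : ℕ) :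
    Integrable (traceSum d b k n) μ :=
  integrable_finsetSum _ fun γ _ => h.integrable_pathVar γ

omit [MeasurableSpace Ω] in
theorem trP_eq (α : ℝ) (d b : ℕ → Ω → ℝ) (P : Polynomial ℝ) (n : ℕ) (ω : Ω) :
    trP α d b P n ω = ∑ k ∈ Finset.range (P.natDegree + 1),
      P.coeff k * (1 / (n : ℝ) * (((n : ℝ) ^ α)⁻¹) ^ k * traceSum d b k n ω) := by
  rw [trP, Polynomial.aeval_eq_sum_range, Matrix.trace_sum, Finset.mul_sum]
  refine Finset.sum_congr rfl fun k _ => ?_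
  rw [matX, smul_pow, Matrix.trace_smul, Matrix.trace_smul, trace_matA_pow, smul_eq_mul,
    smul_eq_mul, traceSum]
  have : ∀ γ ∈ closedPaths k n, pathWeight (fun l => d l.toNat ω) (fun l => b l.toNat ω) γ =
      pathVar d b γ ω := fun γ hγ => by
    have hl := (mem_closedPaths.1 hγ).1
    refine Finset.prod_congr rfl fun u _ => stepWeight_congr ?_ ?_ (hl _).1 (hl _).1
    · intro l hl; simp [extendZero, hl]
    · intro l hl; simp [extendZero, hl]
  rw [Finset.sum_congr rfl this]
  ring

theorem fluct_eq (h : Entries μ α ε d b m C v) (P : Polynomial ℝ) (n : ℕ) (ω : Ω) :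
    fluct μ α ε d b P n ω = ∑ k ∈ Finset.range (P.natDegree + 1),
      P.coeff k * (normalizer α ε k n *
        (traceSum d b k n ω - ∫ ω', traceSum d b k n ω' ∂μ)) := by
  simp only [fluct, trP_eq]
  rw [integral_finsetSum _ fun k _ => ((h.integrable_traceSum k n).const_mul _).const_mul _,
    ← Finset.sum_sub_distrib, Finset.mul_sum]
  refine Finset.sum_congr rfl fun k _ => ?_
  rw [integral_const_mul, integral_const_mul, normalizer]
  ring

theorem fluct_eq_rowSum (h : Entries μ α ε d b m C v) (P : Polynomial ℝ) :
    fluct μ α ε d b P = rowSum (localTerm μ α ε d b P) := by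
  classical
  funext n ω
  rw [h.fluct_eq]
  simp only [rowSum, localTerm]
  rw [Finset.sum_comm]
  refine Finset.sum_congr rfl fun k _ => ?_
  rw [← Finset.mul_sum, ← Finset.mul_sum,
    sum_closedPaths_eq k n fun γ => pathVar d b γ ω - ∫ ω', pathVar d b γ ω' ∂μ]
  have e : ∫ ω', traceSum d b k n ω' ∂μ = ∑ γ ∈ closedPaths k n, ∫ ω', pathVar d b γ ω' ∂μ :=
    integral_finsetSum _ fun γ _ => h.integrable_pathVar γ
  rw [e, traceSum, Finset.sum_sub_distrib]

end Entries

/-! ### Covariances of path weights -/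

theorem integral_finset_prod_eq {Ω ι : Type*} [MeasurableSpace Ω] {μ : Measure Ω}
    [IsProbabilityMeasure μ] {X : ι → Ω → ℝ} (hX : iIndepFun X μ) (hm : ∀ i, Measurable (X i))
    (S : Finset ι) (c : ι → ℕ) :
    ∫ ω, ∏ i ∈ S, X i ω ^ c i ∂μ = ∏ i ∈ S, ∫ ω, X i ω ^ c i ∂μ := by
  have h1 := (hX.comp (fun i x => x ^ c i) fun i => by fun_prop).precomp
    (g := fun i : S => (i : ι)) Subtype.val_injective
  have h2 := h1.integral_fun_prod_eq_prod_integral fun i =>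
    ((hm i).pow_const (c i)).aestronglyMeasurable
  simp only [Function.comp_apply] at h2
  rw [← Finset.prod_coe_sort S]
  rw [← h2]
  refine integral_congr_ae (Eventually.of_forall fun ω => ?_)
  simp only
  rw [← Finset.prod_coe_sort S]

/-- `γ` is a closed path with levels in `H` that crosses only lines with index in `J`. -/
structure PathIn {k : ℕ} (H J : Finset ℤ) (γ : Fin (k + 1) → ℤ) : Prop where
  isPath : IsPath γ
  mem : ∀ u, γ u ∈ H
  sub : J ⊆ H
  crossings_eq_zero : ∀ h ∈ H, h ∉ J → crossings h γ = 0

theorem pathWeight_shiftPath {k : ℕ} (d b : ℤ → ℝ) (γ : Fin (k + 1) → ℤ) (i : ℤ) :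
    pathWeight d b (shiftPath i γ) = pathWeight (fun h => d (h + i)) (fun h => b (h + i)) γ := by
  refine Finset.prod_congr rfl fun u _ => ?_
  have e : ∀ x y : ℤ, x + i = y + i + 1 ↔ x = y + 1 := fun x y => by omega
  simp only [stepWeight, shiftPath, add_left_inj, e]

theorem pathVar_shiftPath {Ω : Type*} (d b : ℕ → Ω → ℝ) {k : ℕ} {γ : Fin (k + 1) → ℤ}
    {H J : Finset ℤ} (hγ : PathIn H J γ) (i : ℤ) (ω : Ω) :
    pathVar d b (shiftPath i γ) ω = (∏ h ∈ H, extendZero d (h + i) ω ^ flats h γ) *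
      ∏ h ∈ J, extendZero b (h + i) ω ^ crossings h γ := by
  rw [pathVar, pathWeight_shiftPath, pathWeight_eq_prod _ _ hγ.isPath hγ.mem]
  congr 1
  symm
  refine Finset.prod_subset hγ.sub fun h hH hJ => ?_
  rw [hγ.crossings_eq_zero h hH hJ, pow_zero]

namespace Entries

variable {Ω : Type*} [MeasurableSpace Ω] {μ : Measure Ω} [IsProbabilityMeasure μ] {α ε : ℝ}
  {d b : ℕ → Ω → ℝ} {m : ℕ → ℝ} {C : ℕ → ℕ → ℝ} {v : ℝ}

theorem integral_prod_mul_prod (h : Entries μ α ε d b m C v) (H J : Finset ℤ) (i : ℤ)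
    (f a : ℤ → ℕ) :
    ∫ ω, (∏ h ∈ H, extendZero d (h + i) ω ^ f h) * ∏ h ∈ J, extendZero b (h + i) ω ^ a h ∂μ =
      (∏ h ∈ H, ∫ ω, extendZero d (h + i) ω ^ f h ∂μ) *
        ∏ h ∈ J, ∫ ω, extendZero b (h + i) ω ^ a h ∂μ := by
  have hinj : Function.Injective (Sum.map (fun h : ℤ => h + i) fun h : ℤ => h + i) :=
    Sum.map_injective.2 ⟨add_left_injective i, add_left_injective i⟩
  have h1 := integral_finset_prod_eq (h.iIndepFun_source.precomp hinj)
    (fun e => h.measurable_source _) (H.disjSum J) (Sum.elim f a)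
  simpa [Finset.prod_disjSum, source] using h1

theorem cov_pathVar (h : Entries μ α ε d b m C v) {k l : ℕ} {γ₁ : Fin (k + 1) → ℤ}
    {γ₂ : Fin (l + 1) → ℤ} {H J : Finset ℤ} (h₁ : PathIn H J γ₁) (h₂ : PathIn H J γ₂) (i : ℤ) :
    cov[pathVar d b (shiftPath i γ₁), pathVar d b (shiftPath i γ₂); μ] =
      (∏ h ∈ H, ∫ ω, extendZero d (h + i) ω ^ (flats h γ₁ + flats h γ₂) ∂μ) *
        (∏ h ∈ J, ∫ ω, extendZero b (h + i) ω ^ (crossings h γ₁ + crossings h γ₂) ∂μ) -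
      (∏ h ∈ H, (∫ ω, extendZero d (h + i) ω ^ flats h γ₁ ∂μ) *
          ∫ ω, extendZero d (h + i) ω ^ flats h γ₂ ∂μ) *
        ∏ h ∈ J, (∫ ω, extendZero b (h + i) ω ^ crossings h γ₁ ∂μ) *
          ∫ ω, extendZero b (h + i) ω ^ crossings h γ₂ ∂μ := by
  rw [covariance_eq_sub ((h.bdd_single_pathVar _).memLp_two ())
    ((h.bdd_single_pathVar _).memLp_two ())]
  congr 1
  · rw [← h.integral_prod_mul_prod]
    refine integral_congr_ae (Eventually.of_forall fun ω => ?_)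
    simp only [Pi.mul_apply, pathVar_shiftPath d b h₁, pathVar_shiftPath d b h₂, pow_add,
      Finset.prod_mul_distrib]
    ring
  · simp only [pathVar_shiftPath d b h₁, pathVar_shiftPath d b h₂, h.integral_prod_mul_prod,
      Finset.prod_mul_distrib]
    ring

/-- Each source has exponent zero in one of the two paths, so its joint moment is the product of its
separate moments. -/
theorem cov_pathVar_of_not_shareLevel (h : Entries μ α ε d b m C v) {k l : ℕ}
    {γ₁ : Fin (k + 1) → ℤ} {γ₂ : Fin (l + 1) → ℤ} (h₁ : IsPath γ₁) (h₂ : IsPath γ₂)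
    (hs : ¬ ShareLevel γ₁ γ₂) : cov[pathVar d b γ₁, pathVar d b γ₂; μ] = 0 := by
  set H : Finset ℤ := Finset.univ.image γ₁ ∪ Finset.univ.image γ₂
  have p₁ : PathIn H H γ₁ := ⟨h₁, fun u => Finset.mem_union_left _ (Finset.mem_image_of_mem _
    (Finset.mem_univ _)), subset_rfl, fun _ h1 h2 => absurd h1 h2⟩
  have p₂ : PathIn H H γ₂ := ⟨h₂, fun u => Finset.mem_union_right _ (Finset.mem_image_of_mem _
    (Finset.mem_univ _)), subset_rfl, fun _ h1 h2 => absurd h1 h2⟩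
  have h0 := h.cov_pathVar p₁ p₂ 0
  rw [shiftPath_zero, shiftPath_zero] at h0
  rw [h0, sub_eq_zero]
  have aux : ∀ (X : Ω → ℝ) (p q : ℕ), ¬ (p ≠ 0 ∧ q ≠ 0) →
      ∫ ω, X ω ^ (p + q) ∂μ = (∫ ω, X ω ^ p ∂μ) * ∫ ω, X ω ^ q ∂μ := by
    intro X p q hpq
    rcases not_and_or.1 hpq with hp | hq
    · rw [not_not] at hp; simp [hp]
    · rw [not_not] at hq; simp [hq]
  congr 1
  · exact Finset.prod_congr rfl fun j _ => aux _ _ _ fun hc => hs ⟨j, Or.inr hc⟩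
  · exact Finset.prod_congr rfl fun j _ => aux _ _ _ fun hc => hs ⟨j, Or.inl hc⟩

end Entries

/-! ### Pairs of paths that share a level -/

theorem exists_of_flats {k : ℕ} {γ : Fin (k + 1) → ℤ} {i : ℤ} (h : flats i γ ≠ 0) :
    ∃ u, γ u = i := by
  rw [flats, Finset.card_ne_zero] at h
  obtain ⟨u, hu⟩ := h
  exact ⟨_, (Finset.mem_filter.1 hu).2.1⟩

theorem ShareLevel.exists_eq {k l : ℕ} {γ₁ : Fin (k + 1) → ℤ} {γ₂ : Fin (l + 1) → ℤ}
    (h : ShareLevel γ₁ γ₂) : ∃ u w, γ₁ u = γ₂ w := by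
  obtain ⟨i, ⟨h1, h2⟩ | ⟨h1, h2⟩⟩ := h
  · obtain ⟨u, hu⟩ := exists_of_crossings h1
    obtain ⟨w, hw⟩ := exists_of_crossings h2
    exact ⟨u, w, hu.trans hw.symm⟩
  · obtain ⟨u, hu⟩ := exists_of_flats h1
    obtain ⟨w, hw⟩ := exists_of_flats h2
    exact ⟨u, w, hu.trans hw.symm⟩

/-- The common levels of two paths that share a level and have joint maximum `0`. -/
noncomputable def levelRange (k l : ℕ) : Finset ℤ := Finset.Icc (-((k + l : ℕ) : ℤ)) 0

/-- One path reaches level `0` and the two meet at some level; from there neither can descend below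
`-(k + l)`. -/
theorem mem_levelRange_of_share {k l : ℕ} {γ₁ : Fin (k + 1) → ℤ} {γ₂ : Fin (l + 1) → ℤ}
    (h₁ : IsPath γ₁) (h₂ : IsPath γ₂) (hm : max (pathMax γ₁) (pathMax γ₂) = 0)
    (hs : ShareLevel γ₁ γ₂) : (∀ u, γ₁ u ∈ levelRange k l) ∧ ∀ u, γ₂ u ∈ levelRange k l := by
  obtain ⟨a, c, hac⟩ := hs.exists_eq
  have A : ∀ u v, γ₁ u - γ₁ v ≤ k := fun u v => (abs_le.1 (h₁.abs_sub_le u v)).2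
  have B : ∀ u v, γ₂ u - γ₂ v ≤ l := fun u v => (abs_le.1 (h₂.abs_sub_le u v)).2
  have m1 : pathMax γ₁ ≤ 0 := hm ▸ le_max_left _ _
  have m2 : pathMax γ₂ ≤ 0 := hm ▸ le_max_right _ _
  obtain ⟨a', ha'⟩ := exists_pathMax γ₁
  obtain ⟨c', hc'⟩ := exists_pathMax γ₂
  have hk : (0 : ℤ) ≤ k := Int.natCast_nonneg k
  have hl : (0 : ℤ) ≤ l := Int.natCast_nonneg l
  simp only [levelRange, Finset.mem_Icc]
  push_cast
  have hcase : pathMax γ₁ = 0 ∨ pathMax γ₂ = 0 := by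
    rcases max_choice (pathMax γ₁) (pathMax γ₂) with h | h
    · left; rw [← h, hm]
    · right; rw [← h, hm]
  constructor
  · intro u
    refine ⟨?_, (le_pathMax γ₁ u).trans m1⟩
    rcases hcase with h | h
    · linarith [A a' u]
    · linarith [A a u, B c' c]
  · intro u
    refine ⟨?_, (le_pathMax γ₂ u).trans m2⟩
    rcases hcase with h | h
    · linarith [B c u, A a' a]
    · linarith [B c' u]

open Classical in
/-- The pairs of paths of lengths `k` and `l`, flat steps allowed, that share a level and have
joint maximum `0`. -/
noncomputable def sharedPairs (k l : ℕ) : Finset ((Fin (k + 1) → ℤ) × (Fin (l + 1) → ℤ)) :=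
  ((Fintype.piFinset fun _ : Fin (k + 1) => levelRange k l) ×ˢ
    (Fintype.piFinset fun _ : Fin (l + 1) => levelRange k l)).filter fun p =>
      IsPath p.1 ∧ IsPath p.2 ∧ max (pathMax p.1) (pathMax p.2) = 0 ∧ ShareLevel p.1 p.2

theorem mem_sharedPairs {k l : ℕ} {p : (Fin (k + 1) → ℤ) × (Fin (l + 1) → ℤ)} :
    p ∈ sharedPairs k l ↔
      IsPath p.1 ∧ IsPath p.2 ∧ max (pathMax p.1) (pathMax p.2) = 0 ∧ ShareLevel p.1 p.2 := by
  simp only [sharedPairs, Finset.mem_filter, Finset.mem_product, Fintype.mem_piFinset,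
    and_iff_right_iff_imp]
  rintro ⟨h1, h2, h3, h4⟩
  exact mem_levelRange_of_share h1 h2 h3 h4

theorem pathIn_of_mem_sharedPairs {k l : ℕ} {p : (Fin (k + 1) → ℤ) × (Fin (l + 1) → ℤ)}
    (hp : p ∈ sharedPairs k l) :
    PathIn (levelRange k l) (levels k l) p.1 ∧ PathIn (levelRange k l) (levels k l) p.2 := by
  obtain ⟨h1, h2, h3, h4⟩ := mem_sharedPairs.1 hp
  obtain ⟨r1, r2⟩ := mem_levelRange_of_share h1 h2 h3 h4
  have hsub : levels k l ⊆ levelRange k l := Finset.Ico_subset_Icc_self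
  have key : ∀ {n : ℕ} {γ : Fin (n + 1) → ℤ}, (∀ u, γ u ∈ levelRange k l) →
      ∀ h ∈ levelRange k l, h ∉ levels k l → crossings h γ = 0 := by
    intro n γ hγ h hh hn
    simp only [levelRange, levels, Finset.mem_Icc, Finset.mem_Ico] at hγ hh hn
    -- The only remaining line is the one between `0` and `1`, above the joint maximum.
    have h0 : h = 0 := by omega
    rw [crossings, Finset.card_eq_zero, Finset.filter_eq_empty_iff]
    intro u _
    have a1 := (hγ u.castSucc).2
    have a2 := (hγ u.succ).2
    omega
  exact ⟨⟨h1, r1, hsub, key r1⟩, ⟨h2, r2, hsub, key r2⟩⟩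

open Classical in
/-- The contribution to the covariance of `tr (A_n ^ k)` and `tr (A_n ^ l)` of the pairs of paths
with joint maximum `i`. -/
noncomputable def covIncrement {Ω : Type*} [MeasurableSpace Ω] (μ : Measure Ω) (d b : ℕ → Ω → ℝ)
    (k l : ℕ) (i : ℤ) : ℝ :=
  ∑ p ∈ sharedPairs k l, if (∀ u, 1 ≤ shiftPath i p.1 u) ∧ ∀ u, 1 ≤ shiftPath i p.2 u then
    cov[pathVar d b (shiftPath i p.1), pathVar d b (shiftPath i p.2); μ] else 0

/-- Pairs without a shared level are uncorrelated. Any other pair is uniquely a pair with joint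
maximum `0`, raised by its own joint maximum `i`. The increments do not depend on `n`, so the
covariance becomes a partial sum of one fixed sequence. -/
theorem Entries.cov_traceSum {Ω : Type*} [MeasurableSpace Ω] {μ : Measure Ω}
    [IsProbabilityMeasure μ] {α ε : ℝ} {d b : ℕ → Ω → ℝ} {m : ℕ → ℝ} {C : ℕ → ℕ → ℝ} {v : ℝ}
    (h : Entries μ α ε d b m C v) (k l n : ℕ) :
    cov[traceSum d b k n, traceSum d b l n; μ] =
      ∑ i ∈ Finset.Icc (1 : ℤ) n, covIncrement μ d b k l i := by
  classical
  have e1 : cov[traceSum d b k n, traceSum d b l n; μ] =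
      ∑ γ₁ ∈ closedPaths k n, ∑ γ₂ ∈ closedPaths l n, cov[pathVar d b γ₁, pathVar d b γ₂; μ] := by
    have := covariance_fun_sum_fun_sum' (μ := μ) (s := closedPaths k n) (t := closedPaths l n)
      (X := fun γ => pathVar d b γ) (Y := fun γ => pathVar d b γ)
      (fun γ _ => (h.bdd_single_pathVar γ).memLp_two ())
      (fun γ _ => (h.bdd_single_pathVar γ).memLp_two ())
    exact this
  rw [e1, ← Finset.sum_product' (f := fun γ₁ γ₂ => cov[pathVar d b γ₁, pathVar d b γ₂; μ])]
  simp only [covIncrement]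
  rw [← Finset.sum_product', ← Finset.sum_filter]
  symm
  have hmaxle : ∀ {q : ℕ} (γ : Fin (q + 1) → ℤ) (c : ℤ), pathMax γ ≤ c ↔ ∀ u, γ u ≤ c := by
    intro q γ c
    exact ⟨fun hh u => (le_pathMax γ u).trans hh, fun hh => Finset.sup'_le _ _ fun u _ => hh u⟩
  refine Finset.sum_of_injOn (fun x => (shiftPath x.1 x.2.1, shiftPath x.1 x.2.2)) ?_ ?_ ?_ ?_
  · rintro ⟨i, p⟩ hx ⟨j, q⟩ hy hxy
    simp only [Finset.coe_filter, Finset.mem_product, mem_sharedPairs, Set.mem_ofPred_eq] at hx hy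
    simp only [Prod.mk.injEq] at hxy
    have m1 := hx.1.2.2.2.1
    have m2 := hy.1.2.2.2.1
    have e1 := congrArg pathMax hxy.1
    have e2 := congrArg pathMax hxy.2
    simp only [pathMax_shiftPath] at e1 e2
    have hij : i = j := by omega
    subst hij
    have aux : ∀ {q : ℕ} {γ γ' : Fin (q + 1) → ℤ}, shiftPath i γ = shiftPath i γ' → γ = γ' := by
      intro q γ γ' hh
      funext u
      have := congrFun hh u
      simpa [shiftPath] using this
    rw [Prod.mk.injEq]
    exact ⟨rfl, Prod.ext (aux hxy.1) (aux hxy.2)⟩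
  · rintro ⟨i, p⟩ hx
    simp only [Finset.coe_filter, Finset.mem_product, mem_sharedPairs, Set.mem_ofPred_eq,
      Finset.mem_Icc] at hx
    simp only [Finset.mem_coe, Finset.mem_product, mem_closedPaths, isPath_shiftPath]
    obtain ⟨⟨⟨_, hi⟩, h1, h2, h3, _⟩, l1, l2⟩ := hx
    have m1 := (hmaxle p.1 0).1 (h3 ▸ le_max_left _ _)
    have m2 := (hmaxle p.2 0).1 (h3 ▸ le_max_right _ _)
    refine ⟨⟨fun u => ⟨l1 u, ?_⟩, h1⟩, ⟨fun u => ⟨l2 u, ?_⟩, h2⟩⟩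
    · have := m1 u; simp only [shiftPath]; omega
    · have := m2 u; simp only [shiftPath]; omega
  · rintro ⟨γ₁, γ₂⟩ hg hn
    simp only [Finset.mem_product, mem_closedPaths] at hg
    obtain ⟨⟨l1, h1⟩, ⟨l2, h2⟩⟩ := hg
    refine h.cov_pathVar_of_not_shareLevel h1 h2 fun hs => hn ?_
    set M := max (pathMax γ₁) (pathMax γ₂) with hM
    refine ⟨(M, (shiftPath (-M) γ₁, shiftPath (-M) γ₂)), ?_, ?_⟩
    · simp only [Finset.coe_filter, Finset.mem_product, mem_sharedPairs, Set.mem_ofPred_eq,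
        Finset.mem_Icc, isPath_shiftPath, shareLevel_shiftPath, pathMax_shiftPath,
        shiftPath_shiftPath, neg_add_cancel, shiftPath_zero]
      refine ⟨⟨⟨?_, ?_⟩, h1, h2, ?_, hs⟩, fun u => (l1 u).1, fun u => (l2 u).1⟩
      · exact ((l1 0).1.trans (le_pathMax γ₁ 0)).trans (le_max_left _ _)
      · exact max_le ((hmaxle _ _).2 fun u => (l1 u).2) ((hmaxle _ _).2 fun u => (l2 u).2)
      · rw [max_add_add_right, ← hM, add_neg_cancel]
    · simp only [shiftPath_shiftPath, neg_add_cancel, shiftPath_zero]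
  · rintro ⟨i, p⟩ _
    rfl

/-! ### Limits of shifted entries -/

/-- The size `j + i` of the entries at level `j` relative to `i`. -/
noncomputable def levelRatio (j : ℤ) (i : ℕ) : ℝ := ((j + i).toNat : ℝ) / i

theorem tendsto_toNat_add (j : ℤ) : Tendsto (fun i : ℕ => (j + i).toNat) atTop atTop := by
  refine tendsto_atTop.2 fun c => ?_
  filter_upwards [eventually_ge_atTop (j.natAbs + c)] with i hi
  omega

theorem eventually_one_le_add (j : ℤ) : ∀ᶠ i : ℕ in atTop, 1 ≤ j + i := by
  filter_upwards [eventually_ge_atTop (j.natAbs + 1)] with i hi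
  omega

theorem tendsto_levelRatio (j : ℤ) : Tendsto (levelRatio j) atTop (𝓝 1) := by
  have h1 : Tendsto (fun i : ℕ => (j : ℝ) / i + 1) atTop (𝓝 (0 + 1)) :=
    (tendsto_const_div_atTop_nhds_zero_nat (j : ℝ)).add_const 1
  rw [zero_add] at h1
  refine h1.congr' ?_
  filter_upwards [eventually_one_le_add j, eventually_gt_atTop 0] with i hi h0
  have h0' : (i : ℝ) ≠ 0 := by positivity
  have e : (((j + i).toNat : ℕ) : ℝ) = (j : ℝ) + i := by
    have : (((j + i).toNat : ℕ) : ℤ) = j + i := Int.toNat_of_nonneg (by omega)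
    exact_mod_cast this
  rw [levelRatio, e]
  field_simp

theorem tendsto_levelRatio_rpow (j : ℤ) (s : ℝ) :
    Tendsto (fun i => levelRatio j i ^ s) atTop (𝓝 1) := by
  simpa using (tendsto_levelRatio j).rpow_const (p := s) (Or.inl one_ne_zero)

theorem levelRatio_rpow (j : ℤ) (i : ℕ) (s : ℝ) :
    levelRatio j i ^ s = ((j + i).toNat : ℝ) ^ s / (i : ℝ) ^ s :=
  Real.div_rpow (by positivity) (by positivity) s

/-- The product rule for differences: one factor is varied at a time, the others converge to their
common limits. -/
theorem tendsto_mul_prod_sub_prod {ι : Type*} [DecidableEq ι] (S : Finset ι) {w : ℕ → ℝ}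
    {x y : ι → ℕ → ℝ} {c z : ι → ℝ} (hx : ∀ h, Tendsto (x h) atTop (𝓝 (z h)))
    (hy : ∀ h, Tendsto (y h) atTop (𝓝 (z h)))
    (hc : ∀ h, Tendsto (fun i => w i * (x h i - y h i)) atTop (𝓝 (c h))) :
    Tendsto (fun i => w i * (∏ h ∈ S, x h i - ∏ h ∈ S, y h i)) atTop
      (𝓝 (∑ h ∈ S, c h * ∏ g ∈ S.erase h, z g)) := by
  induction S using Finset.induction_on with
  | empty => simp
  | insert a S ha ih =>
    have h1 := ((hc a).mul (tendsto_finsetProd S fun h _ => hx h)).add ((hy a).mul ih)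
    have e : ∑ h ∈ insert a S, c h * ∏ g ∈ (insert a S).erase h, z g =
        c a * ∏ h ∈ S, z h + z a * ∑ h ∈ S, c h * ∏ g ∈ S.erase h, z g := by
      rw [Finset.sum_insert ha, Finset.erase_insert ha, Finset.mul_sum]
      congr 1
      refine Finset.sum_congr rfl fun h hh => ?_
      have hne : h ≠ a := fun hh' => ha (hh' ▸ hh)
      rw [Finset.erase_insert_of_ne hne.symm, Finset.prod_insert (by simp [ha])]
      ring
    rw [e]
    refine h1.congr fun i => ?_
    rw [Finset.prod_insert ha, Finset.prod_insert ha]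
    ring

/-! ### Averages of regularly growing sequences -/

/-- After rescaling, the quotient is the slope of `x ^ s` between `i/(i+1)` and `1`. -/
theorem tendsto_rpow_succ_sub (s : ℝ) :
    Tendsto (fun i : ℕ => (((i + 1 : ℕ) : ℝ) ^ s - (i : ℝ) ^ s) / ((i + 1 : ℕ) : ℝ) ^ (s - 1)) atTop
      (𝓝 s) := by
  have hd : HasDerivAt (fun x : ℝ => x ^ s) s 1 := by
    simpa using Real.hasDerivAt_rpow_const (x := 1) (p := s) (Or.inl one_ne_zero)
  have hslope := hasDerivAt_iff_tendsto_slope.1 hd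
  have hx : Tendsto (fun i : ℕ => 1 - 1 / ((i : ℝ) + 1)) atTop (𝓝[≠] 1) := by
    refine tendsto_nhdsWithin_iff.2 ⟨?_, Eventually.of_forall fun i => ?_⟩
    · simpa using (tendsto_one_div_add_atTop_nhds_zero_nat (𝕜 := ℝ)).const_sub 1
    · have : 1 / ((i : ℝ) + 1) ≠ 0 := by positivity
      simp only [Set.mem_compl_iff, Set.mem_singleton_iff]
      intro h
      exact this (by linarith)
  refine (hslope.comp hx).congr fun i => ?_
  have hp : (0 : ℝ) < (i : ℝ) + 1 := by positivity
  have e1 : 1 - 1 / ((i : ℝ) + 1) = i / ((i : ℝ) + 1) := by field_simp; ring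
  simp only [Function.comp_apply, slope_def_field, e1, Real.one_rpow]
  rw [Real.div_rpow (by positivity) hp.le]
  push_cast
  rw [Real.rpow_sub hp, Real.rpow_one]
  have : (0 : ℝ) < ((i : ℝ) + 1) ^ s := by positivity
  have e2 : (i : ℝ) / (i + 1) - 1 = - (1 / ((i : ℝ) + 1)) := by field_simp; ring
  rw [e2]
  field_simp
  ring

/-- Stolz-Cesàro: the increments `(i+1)^s - i^s` sum to `n^s` and are asymptotic to `s i^{s-1}`, so
`G - (L/s) g` is negligible against `g` and stays so after summation. -/
theorem tendsto_rpow_mul_sum {s L : ℝ} (hs : 0 < s) {G : ℤ → ℝ}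
    (hG : Tendsto (fun i : ℕ => (i : ℝ) ^ (1 - s) * G i) atTop (𝓝 L)) :
    Tendsto (fun n : ℕ => (n : ℝ) ^ (-s) * ∑ i ∈ Finset.Icc (1 : ℤ) n, G i) atTop (𝓝 (L / s)) := by
  set g : ℕ → ℝ := fun i => ((i + 1 : ℕ) : ℝ) ^ s - (i : ℝ) ^ s with hg
  have hg0 : ∀ i, 0 ≤ g i := fun i => by
    have := Real.rpow_le_rpow (Nat.cast_nonneg i) (show (i : ℝ) ≤ ((i + 1 : ℕ) : ℝ) by simp) hs.le
    simp only [hg]; linarith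
  have hsum : ∀ n, ∑ i ∈ Finset.range n, g i = (n : ℝ) ^ s := fun n => by
    rw [Finset.sum_range_sub (fun i : ℕ => (i : ℝ) ^ s)]
    simp [Real.zero_rpow hs.ne']
  have htop : Tendsto (fun n => ∑ i ∈ Finset.range n, g i) atTop atTop := by
    simp only [hsum]
    exact (tendsto_rpow_atTop hs).comp tendsto_natCast_atTop_atTop
  have hratio : Tendsto (fun i : ℕ => (G ((i : ℤ) + 1) - L / s * g i) / ((i + 1 : ℕ) : ℝ) ^ (s - 1))
      atTop (𝓝 0) := by
    have h1 := (tendsto_add_atTop_iff_nat 1).2 hG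
    have h2 := h1.sub ((tendsto_rpow_succ_sub s).const_mul (L / s))
    rw [div_mul_cancel₀ _ hs.ne', sub_self] at h2
    refine h2.congr fun i => ?_
    have hp : (0 : ℝ) < ((i + 1 : ℕ) : ℝ) := by positivity
    have e : ((i + 1 : ℕ) : ℝ) ^ (1 - s) = (((i + 1 : ℕ) : ℝ) ^ (s - 1))⁻¹ := by
      rw [← Real.rpow_neg hp.le]; congr 1; ring
    rw [e]
    push_cast
    simp only [hg]
    push_cast
    ring
  have ho : (fun i : ℕ => G ((i : ℤ) + 1) - L / s * g i) =o[atTop] g := by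
    have h1 : (fun i : ℕ => G ((i : ℤ) + 1) - L / s * g i) =o[atTop]
        fun i : ℕ => ((i + 1 : ℕ) : ℝ) ^ (s - 1) := by
      refine (Asymptotics.isLittleO_iff_tendsto' (Eventually.of_forall fun i hi => ?_)).2 hratio
      exact absurd hi (by positivity)
    refine h1.trans_isBigO ?_
    exact Asymptotics.isBigO_of_div_tendsto_nhds_of_ne_zero (tendsto_rpow_succ_sub s) hs.ne'
  have h3 := (ho.sum_range hg0 htop).tendsto_div_nhds_zero.add_const (L / s)
  rw [zero_add] at h3
  refine h3.congr' ?_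
  filter_upwards [eventually_gt_atTop 0] with n hn
  have hn' : (0 : ℝ) < n := by exact_mod_cast hn
  have hp : (0 : ℝ) < (n : ℝ) ^ s := by positivity
  have e : ∑ i ∈ Finset.Icc (1 : ℤ) n, G i = ∑ i ∈ Finset.range n, G ((i : ℤ) + 1) := by
    symm
    refine Finset.sum_bij (fun i _ => (i : ℤ) + 1) ?_ ?_ ?_ ?_
    · intro i hi
      have := Finset.mem_range.1 hi
      simp only [Finset.mem_Icc]; omega
    · intro i _ j _ hij
      omega
    · intro j hj
      simp only [Finset.mem_Icc] at hj
      exact ⟨(j - 1).toNat, Finset.mem_range.2 (by omega), by omega⟩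
    · intro i _; rfl
  rw [Finset.sum_sub_distrib, ← Finset.mul_sum, hsum, e, Real.rpow_neg hn'.le]
  field_simp
  ring

/-! ### Limits of moments of entries near a high level -/

namespace Entries

variable {Ω : Type*} [MeasurableSpace Ω] {μ : Measure Ω} [IsProbabilityMeasure μ] {α ε : ℝ}
  {d b : ℕ → Ω → ℝ} {m : ℕ → ℝ} {C : ℕ → ℕ → ℝ} {v : ℝ}

omit [IsProbabilityMeasure μ] in
theorem integral_extendZero_div_pow (α : ℝ) (b : ℕ → Ω → ℝ) (a : ℕ) {j : ℤ} {i : ℕ} (hi : 0 < i)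
    (hj : 1 ≤ j + i) :
    ∫ ω, (extendZero b (j + i) ω / (i : ℝ) ^ α) ^ a ∂μ = (levelRatio j i ^ α) ^ a *
      ∫ ω, (b (j + i).toNat ω / ((j + i).toNat : ℝ) ^ α) ^ a ∂μ := by
  rw [← integral_const_mul, extendZero_of_le hj]
  have h1 : (0 : ℝ) < (j + i).toNat := by exact_mod_cast (by omega : 0 < (j + i).toNat)
  have h2 : (0 : ℝ) < i := by exact_mod_cast hi
  refine integral_congr_ae (Eventually.of_forall fun ω => ?_)
  simp only
  rw [← mul_pow, levelRatio_rpow]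
  congr 1
  have : (0 : ℝ) < ((j + i).toNat : ℝ) ^ α := by positivity
  field_simp

-- A fixed offset `j` is harmless: the ratio of `(j + i)^α` to `i^α` tends to `1`.
omit [IsProbabilityMeasure μ] in
theorem tendsto_moment_b (h : Entries μ α ε d b m C v) (j : ℤ) (a : ℕ) :
    Tendsto (fun i : ℕ => ∫ ω, (extendZero b (j + i) ω / (i : ℝ) ^ α) ^ a ∂μ) atTop (𝓝 (m a)) := by
  have h1 := ((tendsto_levelRatio_rpow j α).pow a).mul
    ((h.b_moment a).comp (tendsto_toNat_add j))
  rw [one_pow, one_mul] at h1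
  refine h1.congr' ?_
  filter_upwards [eventually_one_le_add j, eventually_gt_atTop 0] with i hi h0
  rw [integral_extendZero_div_pow α b a h0 hi]
  rfl

theorem cov_zfl (h : Entries μ α ε d b m C v) {n : ℕ} (hn : 1 ≤ n) (a c : ℕ) :
    cov[zfl μ α ε b n a, zfl μ α ε b n c; μ] = (n : ℝ) ^ (2 * ε) *
      (∫ ω, (b n ω / (n : ℝ) ^ α) ^ (a + c) ∂μ -
        (∫ ω, (b n ω / (n : ℝ) ^ α) ^ a ∂μ) * ∫ ω, (b n ω / (n : ℝ) ^ α) ^ c ∂μ) := by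
  have hb : BddMoments μ (fun (_ : Unit) => b n) :=
    ⟨fun _ => h.b_meas n hn, fun r => ⟨_, fun _ => ⟨h.b_int n hn r, le_rfl⟩⟩⟩
  have hq : ∀ a, MemLp (fun ω => (b n ω / (n : ℝ) ^ α) ^ a) 2 μ := fun a => by
    have := ((hb.const_mul (c := fun _ => ((n : ℝ) ^ α)⁻¹) (C := |((n : ℝ) ^ α)⁻¹|)
      fun _ => le_rfl).pow a).memLp_two ()
    convert this using 3
    ring
  have hi : ∀ a, Integrable (fun ω => (b n ω / (n : ℝ) ^ α) ^ a) μ := fun a =>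
    (hq a).integrable one_le_two
  unfold zfl
  rw [covariance_const_mul_left, covariance_const_mul_right,
    covariance_sub_const_left (hi a), covariance_sub_const_right (hi c),
    covariance_eq_sub (hq a) (hq c), ← mul_assoc,
    ← Real.rpow_add (by exact_mod_cast hn), two_mul]
  congr 2
  refine integral_congr_ae (Eventually.of_forall fun ω => ?_)
  simp only [Pi.mul_apply, pow_add]

theorem tendsto_cov_b (h : Entries μ α ε d b m C v) (j : ℤ) {a c : ℕ} (ha : Even a) (hc : Even c) :
    Tendsto (fun i : ℕ => (i : ℝ) ^ (2 * ε) *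
      (∫ ω, (extendZero b (j + i) ω / (i : ℝ) ^ α) ^ (a + c) ∂μ -
        (∫ ω, (extendZero b (j + i) ω / (i : ℝ) ^ α) ^ a ∂μ) *
          ∫ ω, (extendZero b (j + i) ω / (i : ℝ) ^ α) ^ c ∂μ)) atTop (𝓝 (C a c)) := by
  have h1 := ((tendsto_levelRatio_rpow j (-(2 * ε))).mul
    ((tendsto_levelRatio_rpow j α).pow (a + c))).mul
      ((h.z_cov a c ha hc).comp (tendsto_toNat_add j))
  rw [one_pow, one_mul, one_mul] at h1
  refine h1.congr' ?_
  filter_upwards [eventually_one_le_add j, eventually_gt_atTop 0] with i hi h0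
  have h2 : (0 : ℝ) < (j + i).toNat := by exact_mod_cast (by omega : 0 < (j + i).toNat)
  have h3 : (0 : ℝ) < i := by exact_mod_cast h0
  have h4 : (0 : ℝ) < ((j + i).toNat : ℝ) ^ (2 * ε) := by positivity
  have h5 : (0 : ℝ) < (i : ℝ) ^ (2 * ε) := by positivity
  simp only [integral_extendZero_div_pow α b _ h0 hi, Function.comp_apply]
  rw [h.cov_zfl (by omega), levelRatio_rpow j i (-(2 * ε)), Real.rpow_neg h2.le,
    Real.rpow_neg h3.le, pow_add]
  field_simp

/-- The covariance of the two powers is `O(i^{-2ε})` and vanishes in the limit, so the limiting even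
moments multiply as for a constant. -/
theorem moment_add (h : Entries μ α ε d b m C v) (hε : 0 < ε) {a c : ℕ} (ha : Even a)
    (hc : Even c) : m (a + c) = m a * m c := by
  have h1 := h.tendsto_cov_b 0 ha hc
  have h2 : Tendsto (fun i : ℕ => ((i : ℝ) ^ (2 * ε))⁻¹) atTop (𝓝 0) :=
    ((tendsto_rpow_atTop (by positivity : 0 < 2 * ε)).comp
      tendsto_natCast_atTop_atTop).inv_tendsto_atTop
  have h3 := h2.mul h1
  rw [zero_mul] at h3
  have h4 := (h.tendsto_moment_b 0 (a + c)).sub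
    ((h.tendsto_moment_b 0 a).mul (h.tendsto_moment_b 0 c))
  refine sub_eq_zero.1 (tendsto_nhds_unique h4 (h3.congr' ?_))
  filter_upwards [eventually_gt_atTop 0] with i h0
  have h5 : (0 : ℝ) < (i : ℝ) ^ (2 * ε) := by
    have : (0 : ℝ) < i := by exact_mod_cast h0
    positivity
  field_simp

theorem moment_two_mul (h : Entries μ α ε d b m C v) (hε : 0 < ε) (q : ℕ) :
    m (2 * q) = m 2 ^ q := by
  induction q with
  | zero => simpa using h.m_zero
  | succ q ih =>
    rw [mul_add, mul_one, h.moment_add hε (even_two_mul q) even_two, ih, pow_succ]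

theorem exists_abs_moment_d_le (h : Entries μ α ε d b m C v) (f : ℕ) :
    ∃ K, ∀ j, |∫ ω, extendZero d j ω ^ f ∂μ| ≤ K := by
  obtain ⟨K, hK⟩ := h.d_bdd f
  refine ⟨max K 1, fun j => ?_⟩
  by_cases hj : 1 ≤ j
  · rw [extendZero_of_le hj]
    refine (abs_integral_le_integral_abs.trans ?_).trans (le_max_left _ _)
    simpa only [abs_pow] using hK j.toNat (by omega)
  · rw [extendZero_of_lt hj]
    refine le_trans ?_ (le_max_right _ _)
    rcases Nat.eq_zero_or_pos f with rfl | hf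
    · simp
    · simp [hf.ne']

theorem tendsto_var_d (h : Entries μ α ε d b m C v) (j : ℤ) :
    Tendsto (fun i : ℕ => ∫ ω, extendZero d (j + i) ω ^ 2 ∂μ -
      (∫ ω, extendZero d (j + i) ω ∂μ) * ∫ ω, extendZero d (j + i) ω ∂μ) atTop (𝓝 v) := by
  refine (h.d_var.comp (tendsto_toNat_add j)).congr' ?_
  filter_upwards [eventually_one_le_add j] with i hi
  have h1 := (h.bdd_single_d (j + i)).memLp_two ()
  rw [extendZero_of_le hi] at h1 ⊢
  simp only [Function.comp_apply]
  rw [variance_eq_sub h1, sq (∫ ω, d _ ω ∂μ)]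
  rfl

end Entries

/-! ### The limiting covariance of one pair of paths -/

/-- The total number of flat steps at the levels in `H`. -/
def flatSum {k : ℕ} (H : Finset ℤ) (γ : Fin (k + 1) → ℤ) : ℕ := ∑ h ∈ H, flats h γ

theorem flatSum_eq_zero {k : ℕ} {H : Finset ℤ} {γ : Fin (k + 1) → ℤ} (h : flatSum H γ = 0) :
    ∀ j ∈ H, flats j γ = 0 := Finset.sum_eq_zero_iff.1 h

theorem flats_le_flatSum {k : ℕ} {H : Finset ℤ} {γ : Fin (k + 1) → ℤ} {h : ℤ} (hh : h ∈ H) :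
    flats h γ ≤ flatSum H γ :=
  Finset.single_le_sum (f := fun h => flats h γ) (fun _ _ => Nat.zero_le _) hh

theorem PathIn.flatSum_add_sum_crossings {k : ℕ} {H J : Finset ℤ} {γ : Fin (k + 1) → ℤ}
    (hγ : PathIn H J γ) : flatSum H γ + ∑ h ∈ J, crossings h γ = k := by
  refine Eq.trans ?_ (sum_flats_add_sum_crossings hγ.isPath hγ.mem)
  rw [flatSum, Finset.sum_subset hγ.sub hγ.crossings_eq_zero]

theorem PathIn.flats_eq_zero {k : ℕ} {H J : Finset ℤ} {γ : Fin (k + 1) → ℤ}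
    (hγ : PathIn H J γ) {h : ℤ} (hh : h ∉ H) : flats h γ = 0 := by
  by_contra hne
  obtain ⟨u, hu⟩ := exists_of_flats hne
  exact hh (hu ▸ hγ.mem u)

/-- The contribution of a pair of paths without flat steps to the limiting covariance. -/
noncomputable def freeLimit (ε : ℝ) (m : ℕ → ℝ) (C : ℕ → ℕ → ℝ) (J : Finset ℤ) (a c : ℤ → ℕ) : ℝ :=
  open Classical in
  if ε = 0 then ∏ h ∈ J, m (a h + c h) - ∏ h ∈ J, m (a h) * m (c h)
  else ∑ h ∈ J, C (a h) (c h) * ∏ g ∈ J.erase h, m (a g + c g)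

open Classical in
/-- The contribution of a pair of paths to the limiting covariance. -/
noncomputable def pairLimit (α ε : ℝ) (m : ℕ → ℝ) (C : ℕ → ℕ → ℝ) (v : ℝ) {k l : ℕ}
    (H J : Finset ℤ) (γ₁ : Fin (k + 1) → ℤ) (γ₂ : Fin (l + 1) → ℤ) : ℝ :=
  if flatSum H γ₁ = 0 ∧ flatSum H γ₂ = 0 then
    freeLimit ε m C J (fun h => crossings h γ₁) fun h => crossings h γ₂
  else if flatSum H γ₁ = 1 ∧ flatSum H γ₂ = 1 ∧ ε = α ∧
      ∃ h, flats h γ₁ ≠ 0 ∧ flats h γ₂ ≠ 0 then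
    v * ∏ h ∈ J, m (crossings h γ₁) * m (crossings h γ₂)
  else 0

theorem exists_abs_prod_le {ι : Type*} (S : Finset ι) {x : ι → ℕ → ℝ}
    (hx : ∀ h, ∃ K, ∀ i, |x h i| ≤ K) : ∃ K, ∀ i, |∏ h ∈ S, x h i| ≤ K := by
  choose K hK using hx
  refine ⟨∏ h ∈ S, K h, fun i => ?_⟩
  rw [Finset.abs_prod]
  exact Finset.prod_le_prod (fun _ _ => abs_nonneg _) fun h _ => hK h i

theorem tendsto_inv_rpow_pow_mul {α ε : ℝ} {q : ℕ} (h : 2 * ε < α * q) :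
    Tendsto (fun i : ℕ => (((i : ℝ) ^ α)⁻¹) ^ q * (i : ℝ) ^ (2 * ε)) atTop (𝓝 0) := by
  have h1 := (tendsto_rpow_neg_atTop (sub_pos.2 h)).comp (tendsto_natCast_atTop_atTop (R := ℝ))
  refine h1.congr' ?_
  filter_upwards [eventually_gt_atTop 0] with i hi
  have h0 : (0 : ℝ) < i := by exact_mod_cast hi
  rw [Function.comp_apply, neg_sub, Real.rpow_sub h0, Real.rpow_mul_natCast h0.le, inv_pow]
  field_simp

namespace Entries

variable {Ω : Type*} [MeasurableSpace Ω] {μ : Measure Ω} [IsProbabilityMeasure μ] {α ε : ℝ}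
  {d b : ℕ → Ω → ℝ} {m : ℕ → ℝ} {C : ℕ → ℕ → ℝ} {v : ℝ}

/-- For `ε = 0` both products converge. For `ε > 0` they have the same limit by `moment_add`, and
the product rule isolates one covariance of order `i^{-2ε}` at a time; evenness of the exponents
makes its limit `C` available. -/
theorem tendsto_freeLimit (h : Entries μ α ε d b m C v) (J : Finset ℤ) {a c : ℤ → ℕ}
    (ha : ∀ g, Even (a g)) (hc : ∀ g, Even (c g)) :
    Tendsto (fun i : ℕ => (i : ℝ) ^ (2 * ε) *
      (∏ g ∈ J, ∫ ω, (extendZero b (g + i) ω / (i : ℝ) ^ α) ^ (a g + c g) ∂μ -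
        ∏ g ∈ J, (∫ ω, (extendZero b (g + i) ω / (i : ℝ) ^ α) ^ a g ∂μ) *
          ∫ ω, (extendZero b (g + i) ω / (i : ℝ) ^ α) ^ c g ∂μ)) atTop
      (𝓝 (freeLimit ε m C J a c)) := by
  rw [freeLimit]
  split_ifs with hε
  · simp only [hε, mul_zero, Real.rpow_zero, one_mul]
    exact (tendsto_finsetProd _ fun g _ => h.tendsto_moment_b g _).sub
      (tendsto_finsetProd _ fun g _ => (h.tendsto_moment_b g _).mul (h.tendsto_moment_b g _))
  · have hε' : 0 < ε := lt_of_le_of_ne h.ε_nonneg (Ne.symm hε)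
    classical
    refine tendsto_mul_prod_sub_prod J (fun g => h.tendsto_moment_b g _) (fun g => ?_)
      fun g => h.tendsto_cov_b g (ha g) (hc g)
    rw [h.moment_add hε' (ha g) (hc g)]
    exact (h.tendsto_moment_b g _).mul (h.tendsto_moment_b g _)

/-- The identity `MB - M'B' = M (B - B') + (M - M') B'`, with diagonal moments in `M`, `M'` and
rescaled off-diagonal moments in `B`, `B'`. Crossings absorb their share of `i^{-α(k+l)}`, and a
factor `i^{-α}` is left over for every flat step. -/
theorem rpow_mul_cov_pathVar (h : Entries μ α ε d b m C v) {k l : ℕ} {γ₁ : Fin (k + 1) → ℤ}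
    {γ₂ : Fin (l + 1) → ℤ} {H J : Finset ℤ} (h₁ : PathIn H J γ₁) (h₂ : PathIn H J γ₂) {i : ℕ}
    (hi : 0 < i) :
    (i : ℝ) ^ (2 * ε - α * (k + l)) *
        cov[pathVar d b (shiftPath i γ₁), pathVar d b (shiftPath i γ₂); μ] =
      (((i : ℝ) ^ α)⁻¹) ^ (flatSum H γ₁ + flatSum H γ₂) *
        ((∏ h ∈ H, ∫ ω, extendZero d (h + i) ω ^ (flats h γ₁ + flats h γ₂) ∂μ) *
          ((i : ℝ) ^ (2 * ε) *
            (∏ g ∈ J, ∫ ω, (extendZero b (g + i) ω / (i : ℝ) ^ α) ^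
                (crossings g γ₁ + crossings g γ₂) ∂μ -
              ∏ g ∈ J, (∫ ω, (extendZero b (g + i) ω / (i : ℝ) ^ α) ^ crossings g γ₁ ∂μ) *
                ∫ ω, (extendZero b (g + i) ω / (i : ℝ) ^ α) ^ crossings g γ₂ ∂μ))) +
      (((i : ℝ) ^ α)⁻¹) ^ (flatSum H γ₁ + flatSum H γ₂) * (i : ℝ) ^ (2 * ε) *
        ((∏ h ∈ H, ∫ ω, extendZero d (h + i) ω ^ (flats h γ₁ + flats h γ₂) ∂μ) -
          ∏ h ∈ H, (∫ ω, extendZero d (h + i) ω ^ flats h γ₁ ∂μ) *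
            ∫ ω, extendZero d (h + i) ω ^ flats h γ₂ ∂μ) *
        ∏ g ∈ J, (∫ ω, (extendZero b (g + i) ω / (i : ℝ) ^ α) ^ crossings g γ₁ ∂μ) *
          ∫ ω, (extendZero b (g + i) ω / (i : ℝ) ^ α) ^ crossings g γ₂ ∂μ := by
  have h0 : (0 : ℝ) < i := by exact_mod_cast hi
  have hr : (0 : ℝ) < (i : ℝ) ^ α := by positivity
  rw [h.cov_pathVar h₁ h₂]
  have hb : ∀ (g : ℤ) (a : ℕ), ∫ ω, extendZero b (g + i) ω ^ a ∂μ = ((i : ℝ) ^ α) ^ a *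
      ∫ ω, (extendZero b (g + i) ω / (i : ℝ) ^ α) ^ a ∂μ := fun g a => by
    rw [← integral_const_mul]
    refine integral_congr_ae (Eventually.of_forall fun ω => ?_)
    simp only [div_pow]
    field_simp
  simp only [hb]
  have e1 : ∀ (x y : ℤ → ℕ) (u w : ℤ → ℝ), ∏ g ∈ J, (((i : ℝ) ^ α) ^ x g * u g) *
      (((i : ℝ) ^ α) ^ y g * w g) =
      ((i : ℝ) ^ α) ^ (∑ g ∈ J, x g + ∑ g ∈ J, y g) * ∏ g ∈ J, u g * w g := by
    intro x y u w
    rw [← Finset.sum_add_distrib, ← Finset.prod_pow_eq_pow_sum, ← Finset.prod_mul_distrib]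
    refine Finset.prod_congr rfl fun g _ => ?_
    rw [pow_add]; ring
  have e2 : ∀ (x : ℤ → ℕ) (u : ℤ → ℝ), ∏ g ∈ J, (((i : ℝ) ^ α) ^ x g * u g) =
      ((i : ℝ) ^ α) ^ (∑ g ∈ J, x g) * ∏ g ∈ J, u g := by
    intro x u
    rw [← Finset.prod_pow_eq_pow_sum, ← Finset.prod_mul_distrib]
  rw [e1, e2, Finset.sum_add_distrib]
  have e3 : (i : ℝ) ^ (2 * ε - α * (k + l)) = (i : ℝ) ^ (2 * ε) *
      (((i : ℝ) ^ α)⁻¹) ^ (flatSum H γ₁ + flatSum H γ₂) *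
      ((((i : ℝ) ^ α)) ^ (∑ g ∈ J, crossings g γ₁ + ∑ g ∈ J, crossings g γ₂))⁻¹ := by
    have : (k + l : ℝ) = ((flatSum H γ₁ + flatSum H γ₂ +
        (∑ g ∈ J, crossings g γ₁ + ∑ g ∈ J, crossings g γ₂) : ℕ) : ℝ) := by
      rw [← Nat.cast_add]
      congr 1
      have q1 := h₁.flatSum_add_sum_crossings
      have q2 := h₂.flatSum_add_sum_crossings
      omega
    rw [this, Real.rpow_sub h0, Real.rpow_mul_natCast h0.le, pow_add, inv_pow]
    field_simp
  rw [e3]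
  have hr' : (0 : ℝ) < ((i : ℝ) ^ α) ^ (∑ g ∈ J, crossings g γ₁ + ∑ g ∈ J, crossings g γ₂) := by
    positivity
  set R := ((i : ℝ) ^ α) ^ (∑ g ∈ J, crossings g γ₁ + ∑ g ∈ J, crossings g γ₂)
  field_simp
  ring

/-- The off-diagonal part survives only without flat steps. The diagonal part needs a common flat
level, hence at least two flat steps, and has order `i^{2ε-α(F+F')}`; it survives only if `ε = α`
and each path has one flat step. -/
theorem tendsto_rpow_mul_cov_pathVar (h : Entries μ α ε d b m C v) {k l : ℕ}
    {γ₁ : Fin (k + 1) → ℤ} {γ₂ : Fin (l + 1) → ℤ} {H J : Finset ℤ} (h₁ : PathIn H J γ₁)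
    (h₂ : PathIn H J γ₂) :
    Tendsto (fun i : ℕ => (i : ℝ) ^ (2 * ε - α * (k + l)) *
        cov[pathVar d b (shiftPath i γ₁), pathVar d b (shiftPath i γ₂); μ]) atTop
      (𝓝 (pairLimit α ε m C v H J γ₁ γ₂)) := by
  have hα := h.α_pos
  have hεα := h.ε_le
  set F := flatSum H γ₁ with hF
  set F' := flatSum H γ₂ with hF'
  set M : ℕ → ℝ := fun i =>
    ∏ h ∈ H, ∫ ω, extendZero d (h + i) ω ^ (flats h γ₁ + flats h γ₂) ∂μ with hM
  set M' : ℕ → ℝ := fun i => ∏ h ∈ H, (∫ ω, extendZero d (h + i) ω ^ flats h γ₁ ∂μ) *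
            ∫ ω, extendZero d (h + i) ω ^ flats h γ₂ ∂μ with hM'
  set B : ℕ → ℝ := fun i => (i : ℝ) ^ (2 * ε) *
      (∏ g ∈ J, ∫ ω, (extendZero b (g + i) ω / (i : ℝ) ^ α) ^
          (crossings g γ₁ + crossings g γ₂) ∂μ -
        ∏ g ∈ J, (∫ ω, (extendZero b (g + i) ω / (i : ℝ) ^ α) ^ crossings g γ₁ ∂μ) *
          ∫ ω, (extendZero b (g + i) ω / (i : ℝ) ^ α) ^ crossings g γ₂ ∂μ) with hB
  set B' : ℕ → ℝ := fun i =>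
    ∏ g ∈ J, (∫ ω, (extendZero b (g + i) ω / (i : ℝ) ^ α) ^ crossings g γ₁ ∂μ) *
          ∫ ω, (extendZero b (g + i) ω / (i : ℝ) ^ α) ^ crossings g γ₂ ∂μ with hB'
  have hlimB : Tendsto B atTop (𝓝 (freeLimit ε m C J (fun h => crossings h γ₁)
      fun h => crossings h γ₂)) :=
    h.tendsto_freeLimit J (fun g => even_crossings h₁.isPath g)
      fun g => even_crossings h₂.isPath g
  have hlimB' : Tendsto B' atTop (𝓝 (∏ h ∈ J, m (crossings h γ₁) * m (crossings h γ₂))) :=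
    tendsto_finsetProd _ fun g _ => (h.tendsto_moment_b g _).mul (h.tendsto_moment_b g _)
  have hMb : ∃ K, ∀ i, |M i| ≤ K := exists_abs_prod_le H fun g =>
    let ⟨K, hK⟩ := h.exists_abs_moment_d_le (flats g γ₁ + flats g γ₂)
    ⟨K, fun i => hK _⟩
  have hMb' : ∃ K, ∀ i, |M' i| ≤ K := exists_abs_prod_le H fun g => by
    obtain ⟨K, hK⟩ := h.exists_abs_moment_d_le (flats g γ₁)
    obtain ⟨K', hK'⟩ := h.exists_abs_moment_d_le (flats g γ₂)
    refine ⟨K * K', fun i => ?_⟩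
    rw [abs_mul]
    exact mul_le_mul (hK _) (hK' _) (abs_nonneg _) ((abs_nonneg _).trans (hK 0))
  have hzero : ∀ {x y : ℕ → ℝ}, Tendsto x atTop (𝓝 0) → (∃ K, ∀ i, |y i| ≤ K) →
      Tendsto (fun i => x i * y i) atTop (𝓝 0) := fun {x y} hx ⟨K, hK⟩ =>
    hx.zero_mul_isBoundedUnder_le
      (isBoundedUnder_of ⟨K, fun i => by simpa [Real.norm_eq_abs] using hK i⟩)
  have key : Tendsto (fun i : ℕ => (((i : ℝ) ^ α)⁻¹) ^ (F + F') * (M i * B i) +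
      (((i : ℝ) ^ α)⁻¹) ^ (F + F') * (i : ℝ) ^ (2 * ε) * (M i - M' i) * B' i) atTop
      (𝓝 (pairLimit α ε m C v H J γ₁ γ₂)) := by
    have hpow : F + F' ≠ 0 → Tendsto (fun i : ℕ => (((i : ℝ) ^ α)⁻¹) ^ (F + F') * (M i * B i))
        atTop (𝓝 0) := by
      intro hne
      have h1 : Tendsto (fun i : ℕ => (((i : ℝ) ^ α)⁻¹) ^ (F + F') * (i : ℝ) ^ (2 * (0 : ℝ)))
          atTop (𝓝 0) := tendsto_inv_rpow_pow_mul (by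
            have : (0 : ℝ) < ((F + F' : ℕ) : ℝ) := by exact_mod_cast Nat.pos_of_ne_zero hne
            simpa using mul_pos hα this)
      simp only [mul_zero, Real.rpow_zero, mul_one] at h1
      simpa [mul_assoc] using (hzero h1 hMb).mul hlimB
    by_cases hcom : ∃ g, flats g γ₁ ≠ 0 ∧ flats g γ₂ ≠ 0
    · obtain ⟨g, hg1, hg2⟩ := hcom
      have hgH : g ∈ H := by
        by_contra hn
        exact hg1 (h₁.flats_eq_zero hn)
      have hF1 : flats g γ₁ ≤ F := flats_le_flatSum hgH
      have hF2 : flats g γ₂ ≤ F' := flats_le_flatSum hgH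
      rw [pairLimit, if_neg (by omega)]
      split_ifs with hc
      · obtain ⟨c1, c2, c3, -⟩ := hc
        have hz : ∀ {q : ℕ} {γ : Fin (q + 1) → ℤ}, flatSum H γ = 1 → flats g γ ≠ 0 →
            ∀ h ∈ H, flats h γ = if h = g then 1 else 0 := by
          intro q γ c hg h hh
          have s1 := Finset.add_sum_erase H (fun h => flats h γ) hgH
          have s2 : flats g γ + ∑ h ∈ H.erase g, flats h γ = 1 := s1.trans c
          have s3 : ∑ h ∈ H.erase g, flats h γ = 0 := by omega
          split_ifs with hhg
          · rw [hhg]; omega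
          · exact Finset.sum_eq_zero_iff.1 s3 h (Finset.mem_erase.2 ⟨hhg, hh⟩)
        have z1 := hz c1 hg1
        have z2 := hz c2 hg2
        have hM2 : ∀ i, M i = ∫ ω, extendZero d (g + i) ω ^ 2 ∂μ := fun i => by
          simp only [hM]
          rw [Finset.prod_eq_single_of_mem g hgH]
          · rw [z1 g hgH, z2 g hgH]; simp
          · intro h hh hne
            rw [z1 h hh, z2 h hh]; simp [hne]
        have hM2' : ∀ i, M' i = (∫ ω, extendZero d (g + i) ω ∂μ) *
            ∫ ω, extendZero d (g + i) ω ∂μ := fun i => by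
          simp only [hM']
          rw [Finset.prod_eq_single_of_mem g hgH]
          · rw [z1 g hgH, z2 g hgH]; simp
          · intro h hh hne
            rw [z1 h hh, z2 h hh]; simp [hne]
        have h2 := (hpow (by omega)).add ((h.tendsto_var_d g).mul hlimB')
        rw [zero_add] at h2
        refine h2.congr' ?_
        filter_upwards [eventually_gt_atTop 0] with i hi
        have h0 : (0 : ℝ) < i := by exact_mod_cast hi
        -- Two flat steps cost `i^{-2α}`, exactly balanced by `i^{2ε}` with `ε = α`.
        have e : (((i : ℝ) ^ α)⁻¹) ^ (F + F') * (i : ℝ) ^ (2 * ε) = 1 := by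
          rw [hF, hF', c1, c2, c3, mul_comm 2 α, show (2 : ℝ) = ((1 + 1 : ℕ) : ℝ) by norm_num,
            Real.rpow_mul_natCast h0.le, inv_pow]
          exact inv_mul_cancel₀ (by positivity)
        rw [e, hM2, hM2', one_mul]
      · have hlt : 2 * ε < α * ((F + F' : ℕ) : ℝ) := by
          have hor : ε < α ∨ 3 ≤ F + F' := by
            by_contra hn
            push Not at hn
            refine hc ⟨by omega, by omega, le_antisymm hεα hn.1, g, hg1, hg2⟩
          have h2 : (2 : ℝ) ≤ ((F + F' : ℕ) : ℝ) := by exact_mod_cast (by omega : 2 ≤ F + F')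
          rcases hor with hh | hh
          · nlinarith
          · have h3 : (3 : ℝ) ≤ ((F + F' : ℕ) : ℝ) := by exact_mod_cast hh
            nlinarith
        have hMM : ∃ K, ∀ i, |M i - M' i| ≤ K := by
          obtain ⟨K, hK⟩ := hMb
          obtain ⟨K', hK'⟩ := hMb'
          exact ⟨K + K', fun i => (abs_sub _ _).trans (add_le_add (hK i) (hK' i))⟩
        have h2 := (hpow (by omega)).add
          ((hzero (tendsto_inv_rpow_pow_mul hlt) hMM).mul hlimB')
        rwa [zero_mul, zero_add] at h2
    -- Without a common flat level the diagonal moments factor, so only the off-diagonal part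
    -- remains.
    · have hMM : M = M' := by
        funext i
        refine Finset.prod_congr rfl fun g _ => ?_
        by_cases h1 : flats g γ₁ = 0
        · simp [h1]
        · have h2 : flats g γ₂ = 0 := by
            by_contra h2
            exact hcom ⟨g, h1, h2⟩
          simp [h2]
      simp only [hMM, sub_self, mul_zero, zero_mul, add_zero]
      rw [pairLimit]
      by_cases h00 : F = 0 ∧ F' = 0
      · rw [if_pos h00]
        have hM1 : ∀ i, M' i = 1 := fun i => by
          simp only [hM']
          refine Finset.prod_eq_one fun g hg => ?_
          rw [flatSum_eq_zero h00.1 g hg, flatSum_eq_zero h00.2 g hg]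
          simp
        simpa [h00.1, h00.2, hM1] using hlimB
      · rw [if_neg h00, if_neg fun hc => hcom hc.2.2.2]
        rw [← hMM]
        exact hpow (by omega)
  refine key.congr' ?_
  filter_upwards [eventually_gt_atTop 0] with i hi
  rw [h.rpow_mul_cov_pathVar h₁ h₂ hi]

theorem tendsto_covIncrement (h : Entries μ α ε d b m C v) (k l : ℕ) :
    Tendsto (fun i : ℕ => (i : ℝ) ^ (2 * ε - α * (k + l)) * covIncrement μ d b k l i) atTop
      (𝓝 (∑ p ∈ sharedPairs k l,
        pairLimit α ε m C v (levelRange k l) (levels k l) p.1 p.2)) := by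
  classical
  have h1 := tendsto_finsetSum (sharedPairs k l) fun p hp =>
    h.tendsto_rpow_mul_cov_pathVar (pathIn_of_mem_sharedPairs hp).1
      (pathIn_of_mem_sharedPairs hp).2
  refine h1.congr' ?_
  -- Above level `k + l` no shifted pair drops below level `1`, so the boundary condition holds for
  -- every pair.
  filter_upwards [eventually_gt_atTop (k + l)] with i hi
  rw [covIncrement, Finset.mul_sum]
  refine Finset.sum_congr rfl fun p hp => ?_
  rw [if_pos]
  have q1 := (pathIn_of_mem_sharedPairs hp).1.mem
  have q2 := (pathIn_of_mem_sharedPairs hp).2.mem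
  simp only [levelRange, Finset.mem_Icc] at q1 q2
  constructor
  · intro u
    have := (q1 u).1
    simp only [shiftPath]
    omega
  · intro u
    have := (q2 u).1
    simp only [shiftPath]
    omega

omit [IsProbabilityMeasure μ] in
theorem exponent_pos (h : Entries μ α ε d b m C v) {k l : ℕ} (hk : 1 ≤ k) (hl : 1 ≤ l) :
    0 < α * (k + l) + 1 - 2 * ε := by
  have h1 : (1 : ℝ) ≤ k := by exact_mod_cast hk
  have h2 : (1 : ℝ) ≤ l := by exact_mod_cast hl
  nlinarith [h.α_pos, h.ε_le]

/-- With `s = α(k+l) + 1 - 2ε`, which is positive since `ε ≤ α`, the normalizers multiply to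
`n^{-s}` and the increments grow like `i^{s-1}`; the division by `s` comes from the summation. -/
theorem tendsto_normalizer_mul_cov (h : Entries μ α ε d b m C v) {k l : ℕ} (hk : 1 ≤ k)
    (hl : 1 ≤ l) :
    Tendsto (fun n : ℕ => normalizer α ε k n * normalizer α ε l n *
        cov[traceSum d b k n, traceSum d b l n; μ]) atTop
      (𝓝 ((∑ p ∈ sharedPairs k l,
        pairLimit α ε m C v (levelRange k l) (levels k l) p.1 p.2) /
          (α * (k + l) + 1 - 2 * ε))) := by
  have h1 := h.tendsto_covIncrement k l
  have h2 := tendsto_rpow_mul_sum (h.exponent_pos hk hl) (L := ∑ p ∈ sharedPairs k l,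
        pairLimit α ε m C v (levelRange k l) (levels k l) p.1 p.2)
        (G := covIncrement μ d b k l) (by convert h1 using 4; ring)
  refine h2.congr' ?_
  filter_upwards [eventually_gt_atTop 0] with n hn
  have h0 : (0 : ℝ) < n := by exact_mod_cast hn
  rw [h.cov_traceSum, normalizer, normalizer]
  congr 1
  have e1 : ∀ q : ℕ, (((n : ℝ) ^ α)⁻¹) ^ q = (n : ℝ) ^ (-(α * q)) := fun q => by
    rw [Real.rpow_neg h0.le, Real.rpow_mul_natCast h0.le, inv_pow]
  have e2 : 1 / (n : ℝ) = (n : ℝ) ^ (-1 : ℝ) := by rw [Real.rpow_neg_one, one_div]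
  rw [e1, e1, e2, ← Real.rpow_add h0, ← Real.rpow_add h0, ← Real.rpow_add h0, ← Real.rpow_add h0]
  congr 1
  ring

end Entries

/-! ### Counting the paths with one flat step -/

/-- The closed path `γ` has exactly one flat step, at level `0`. -/
structure OneFlat {k : ℕ} (γ : Fin (k + 1) → ℤ) : Prop where
  isPath : IsPath γ
  flats_zero : flats 0 γ = 1
  flats_ne : ∀ h, h ≠ 0 → flats h γ = 0

theorem OneFlat.exists_step {k : ℕ} {γ : Fin (k + 1) → ℤ} (hγ : OneFlat γ) :
    ∃ u : Fin k, γ u.castSucc = 0 ∧ ∀ w : Fin k, γ w.castSucc = γ w.succ ↔ w = u := by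
  obtain ⟨u, hu⟩ := Finset.card_eq_one.1 hγ.flats_zero
  have hmem : ∀ w : Fin k, (γ w.castSucc = 0 ∧ γ w.succ = 0) ↔ w = u := fun w => by
    have := congrArg (w ∈ ·) hu
    simpa using this
  refine ⟨u, ((hmem u).2 rfl).1, fun w => ⟨fun hw => (hmem w).1 ?_, fun hw => ?_⟩⟩
  · by_contra hne
    have h0 : γ w.castSucc ≠ 0 := fun h0 => hne ⟨h0, hw ▸ h0⟩
    have := hγ.flats_ne _ h0
    rw [flats, Finset.card_eq_zero, Finset.filter_eq_empty_iff] at this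
    exact this (Finset.mem_univ w) ⟨rfl, hw.symm⟩
  · have := (hmem w).2 hw
    rw [this.1, this.2]

theorem oneFlat_of_step {k : ℕ} {γ : Fin (k + 1) → ℤ} (hγ : IsPath γ) {u : Fin k}
    (h0 : γ u.castSucc = 0) (h : ∀ w : Fin k, γ w.castSucc = γ w.succ ↔ w = u) : OneFlat γ := by
  refine ⟨hγ, Finset.card_eq_one.2 ⟨u, ?_⟩, fun j hj => ?_⟩
  · ext w
    simp only [Finset.mem_filter, Finset.mem_univ, true_and, Finset.mem_singleton]
    refine ⟨fun hw => (h w).1 (hw.1.trans hw.2.symm), ?_⟩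
    rintro rfl
    exact ⟨h0, ((h w).2 rfl) ▸ h0⟩
  · rw [flats, Finset.card_eq_zero, Finset.filter_eq_empty_iff]
    intro w _ hw
    have := (h w).1 (hw.1.trans hw.2.symm)
    subst this
    exact hj (hw.1.symm.trans h0)

theorem sum_steps {k : ℕ} (γ : Fin (k + 1) → ℤ) :
    ∑ w : Fin k, (γ w.succ - γ w.castSucc) = γ (Fin.last k) - γ 0 := by
  rw [Finset.sum_sub_distrib]
  have h1 := Fin.sum_univ_succ γ
  have h2 := Fin.sum_univ_castSucc γ
  linarith

theorem eq_of_steps_eq {k : ℕ} {γ γ' : Fin (k + 1) → ℤ}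
    (h : ∀ w : Fin k, γ w.succ - γ w.castSucc = γ' w.succ - γ' w.castSucc) {u : Fin (k + 1)}
    (hu : γ u = γ' u) : γ = γ' := by
  have h1 : ∀ j, γ j - γ' j = γ 0 - γ' 0 := by
    intro j
    induction j using Fin.induction with
    | zero => rfl
    | succ j ih => have := h j; omega
  funext j
  have := h1 j
  have := h1 u
  omega

/-- The closed paths of length `k` with exactly one flat step, at level `0`. -/
noncomputable def oneFlatPaths (k : ℕ) : Finset (Fin (k + 1) → ℤ) :=
  open Classical in
  (Fintype.piFinset fun _ : Fin (k + 1) => Finset.Icc (-(k : ℤ)) k).filter OneFlat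

theorem mem_oneFlatPaths {k : ℕ} {γ : Fin (k + 1) → ℤ} : γ ∈ oneFlatPaths k ↔ OneFlat γ := by
  simp only [oneFlatPaths, Finset.mem_filter, Fintype.mem_piFinset, Finset.mem_Icc,
    and_iff_right_iff_imp]
  intro h w
  obtain ⟨u, hu, -⟩ := h.exists_step
  have := abs_le.1 (h.isPath.abs_sub_le w u.castSucc)
  rw [hu] at this
  constructor <;> linarith [this.1, this.2]

/-- The path with steps `s` that is at level `0` at time `u`. -/
def pathOfSteps {k : ℕ} (s : Fin k → ℤ) (u : Fin k) (j : Fin (k + 1)) : ℤ :=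
  (∑ w : Fin k, if (w : ℕ) < j then s w else 0) - ∑ w : Fin k, if (w : ℕ) < u then s w else 0

theorem pathOfSteps_sub {k : ℕ} (s : Fin k → ℤ) (u w : Fin k) :
    pathOfSteps s u w.succ - pathOfSteps s u w.castSucc = s w := by
  have : ∀ x : Fin k, ((if (x : ℕ) < w.succ then s x else 0) -
      if (x : ℕ) < w.castSucc then s x else 0) = if x = w then s x else 0 := by
    intro x
    have e : x = w ↔ (x : ℕ) = w := Fin.ext_iff
    simp only [Fin.val_succ, Fin.val_castSucc, e]
    split_ifs <;> omega
  simp only [pathOfSteps]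
  rw [sub_sub_sub_cancel_right, ← Finset.sum_sub_distrib, Finset.sum_congr rfl fun x _ => this x]
  simp

/-- Choose the position of the flat step; among the other `k - 1` steps exactly half must go up for
the path to close. Since the flat step is at level `0`, these choices determine the path. -/
theorem card_oneFlatPaths {k : ℕ} (hk : Odd k) :
    (oneFlatPaths k).card = k * (k - 1).choose ((k - 1) / 2) := by
  classical
  have hcard : ((Finset.univ : Finset (Fin k)).sigma fun u =>
      (Finset.univ.erase u).powersetCard ((k - 1) / 2)).card =
        k * (k - 1).choose ((k - 1) / 2) := by
    rw [Finset.card_sigma]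
    simp
  rw [← hcard]
  have hstep : ∀ {γ : Fin (k + 1) → ℤ} {u : Fin k}, IsPath γ →
      (∀ w : Fin k, γ w.castSucc = γ w.succ ↔ w = u) → ∀ w, γ w.succ - γ w.castSucc =
        if w = u then 0 else if γ w.succ = γ w.castSucc + 1 then 1 else -1 := by
    intro γ u hγ hu w
    have h1 := abs_le.1 (hγ.2 w)
    have h2 := hu w
    split_ifs with h3 h4
    · have := h2.2 h3; omega
    · omega
    · have : γ w.castSucc ≠ γ w.succ := fun h => h3 (h2.1 h)
      omega
  have : NeZero k := ⟨hk.pos.ne'⟩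
  choose! u hu0 hu using fun (γ : Fin (k + 1) → ℤ) (hγ : OneFlat γ) => hγ.exists_step
  refine Finset.card_bij (fun γ _ => ⟨u γ, Finset.univ.filter fun w : Fin k =>
    γ w.succ = γ w.castSucc + 1⟩) ?_ ?_ ?_
  · intro γ hγ
    have hγ := mem_oneFlatPaths.1 hγ
    have hu := hu γ hγ
    have hs := hstep hγ.isPath hu
    set T := Finset.univ.filter fun w : Fin k => γ w.succ = γ w.castSucc + 1 with hT
    have hTu : T ⊆ Finset.univ.erase (u γ) := by
      intro w hw
      simp only [hT, Finset.mem_filter, Finset.mem_univ, true_and] at hw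
      refine Finset.mem_erase.2 ⟨fun h => ?_, Finset.mem_univ _⟩
      have := (hu w).2 h
      omega
    simp only [Finset.mem_sigma, Finset.mem_univ, true_and, Finset.mem_powersetCard]
    refine ⟨hTu, ?_⟩
    have h1 := sum_steps γ
    rw [← hγ.isPath.1, sub_self] at h1
    have h2 : ∑ w : Fin k, (γ w.succ - γ w.castSucc) =
        ∑ w ∈ Finset.univ.erase (u γ), if w ∈ T then (1 : ℤ) else -1 := by
      rw [← Finset.add_sum_erase _ _ (Finset.mem_univ (u γ))]
      rw [hs (u γ), if_pos rfl, zero_add]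
      refine Finset.sum_congr rfl fun w hw => ?_
      rw [hs w, if_neg (Finset.mem_erase.1 hw).1]
      simp [hT]
    rw [h2, Finset.sum_ite, Finset.sum_const, Finset.sum_const, Finset.filter_mem_eq_inter,
      Finset.inter_eq_right.2 hTu, ← Finset.sdiff_eq_filter, Finset.card_sdiff_of_subset hTu,
      Finset.card_erase_of_mem (Finset.mem_univ _), Finset.card_fin] at h1
    have h3 := Finset.card_le_card hTu
    rw [Finset.card_erase_of_mem (Finset.mem_univ _), Finset.card_fin] at h3
    simp only [nsmul_eq_mul, mul_one, mul_neg] at h1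
    obtain ⟨q, hq⟩ := hk
    omega
  · intro γ hγ γ' hγ' heq
    have hγ := mem_oneFlatPaths.1 hγ
    have hγ' := mem_oneFlatPaths.1 hγ'
    have h1 : u γ = u γ' := congrArg Sigma.fst heq
    have h2 : (Finset.univ.filter fun w : Fin k => γ w.succ = γ w.castSucc + 1) =
        Finset.univ.filter fun w : Fin k => γ' w.succ = γ' w.castSucc + 1 := congrArg Sigma.snd heq
    refine eq_of_steps_eq (u := (u γ).castSucc) (fun w => ?_) ?_
    · rw [hstep hγ.isPath (hu γ hγ), hstep hγ'.isPath (hu γ' hγ'), h1]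
      have h3 := congrArg (w ∈ ·) h2
      simp only [Finset.mem_filter, Finset.mem_univ, true_and, eq_iff_iff] at h3
      simp only [h3]
    · rw [hu0 γ hγ, h1, hu0 γ' hγ']
  · rintro ⟨x, T⟩ hx
    simp only [Finset.mem_sigma, Finset.mem_univ, true_and, Finset.mem_powersetCard] at hx
    obtain ⟨hT, hc⟩ := hx
    set s : Fin k → ℤ := fun w => if w = x then 0 else if w ∈ T then 1 else -1 with hs
    set γ := pathOfSteps s x with hγ
    have hst : ∀ w : Fin k, γ w.succ - γ w.castSucc = s w := pathOfSteps_sub s x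
    have hx0 : γ x.castSucc = 0 := by simp [hγ, pathOfSteps]
    have hsx : s x = 0 := by simp [hs]
    have hs1 : ∀ w, w ≠ x → s w = if w ∈ T then 1 else -1 := fun w hw => by simp [hs, hw]
    have hflat : ∀ w : Fin k, γ w.castSucc = γ w.succ ↔ w = x := by
      intro w
      have h1 := hst w
      constructor
      · intro hw
        by_contra hne
        rw [hs1 w hne] at h1
        split_ifs at h1 <;> omega
      · rintro rfl
        omega
    have hpath : IsPath γ := by
      refine ⟨?_, fun w => ?_⟩
      · have h1 : ∑ w, s w = γ (Fin.last k) - γ 0 :=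
          (Finset.sum_congr rfl fun w _ => (hst w).symm).trans (sum_steps γ)
        rw [← Finset.add_sum_erase _ _ (Finset.mem_univ x), hsx, zero_add,
          Finset.sum_congr rfl fun w hw => hs1 w (Finset.mem_erase.1 hw).1,
          Finset.sum_ite, Finset.sum_const, Finset.sum_const, Finset.filter_mem_eq_inter,
          Finset.inter_eq_right.2 hT, ← Finset.sdiff_eq_filter, Finset.card_sdiff_of_subset hT,
          Finset.card_erase_of_mem (Finset.mem_univ _), Finset.card_fin] at h1
        simp only [nsmul_eq_mul, mul_one, mul_neg] at h1
        obtain ⟨q, hq⟩ := hk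
        omega
      · have h1 := hst w
        rw [abs_le]
        by_cases hw : w = x
        · rw [hw] at h1 ⊢; omega
        · rw [hs1 w hw] at h1
          split_ifs at h1 <;> omega
    have hone := oneFlat_of_step hpath hx0 hflat
    refine ⟨γ, mem_oneFlatPaths.2 hone, ?_⟩
    have e1 : u γ = x := (hflat _).1 ((hu γ hone _).2 rfl)
    have e2 : (Finset.univ.filter fun w : Fin k => γ w.succ = γ w.castSucc + 1) = T := by
      ext w
      simp only [Finset.mem_filter, Finset.mem_univ, true_and]
      have h1 := hst w
      by_cases hw : w = x
      · subst hw
        have : w ∉ T := fun h => (Finset.mem_erase.1 (hT h)).1 rfl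
        simp only [this, iff_false]
        omega
      · rw [hs1 w hw] at h1
        split_ifs at h1 with h2
        · simp only [h2, iff_true]; omega
        · simp only [h2, iff_false]; omega
    rw [e1, e2]

theorem oneFlat_shiftPath {k : ℕ} {H J : Finset ℤ} {γ : Fin (k + 1) → ℤ} (hγ : PathIn H J γ)
    (h1 : flatSum H γ = 1) {g : ℤ} (hg : flats g γ ≠ 0) : OneFlat (shiftPath (-g) γ) := by
  have hgH : g ∈ H := by
    by_contra hn
    exact hg (hγ.flats_eq_zero hn)
  have s1 := Finset.add_sum_erase H (fun h => flats h γ) hgH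
  have s2 : flats g γ + ∑ h ∈ H.erase g, flats h γ = 1 := s1.trans h1
  have s3 : ∑ h ∈ H.erase g, flats h γ = 0 := by omega
  have e : ∀ j, flats j (shiftPath (-g) γ) = flats (j + g) γ := fun j => by
    rw [← flats_shiftPath γ (-g) (j + g), add_neg_cancel_right]
  refine ⟨isPath_shiftPath.2 hγ.isPath, ?_, fun j hj => ?_⟩
  · rw [e, zero_add]; omega
  · rw [e]
    by_cases hjH : j + g ∈ H
    · exact Finset.sum_eq_zero_iff.1 s3 _ (Finset.mem_erase.2 ⟨by omega, hjH⟩)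
    · exact hγ.flats_eq_zero hjH

theorem OneFlat.flatSum_eq_one {k : ℕ} {H : Finset ℤ} {γ : Fin (k + 1) → ℤ} (hγ : OneFlat γ)
    {g : ℤ} (hH : ∀ u, shiftPath g γ u ∈ H) : flatSum H (shiftPath g γ) = 1 := by
  have e : ∀ j, flats j (shiftPath g γ) = flats (j - g) γ := fun j => by
    rw [← flats_shiftPath γ g (j - g), sub_add_cancel]
  obtain ⟨u, hu, -⟩ := hγ.exists_step
  have hgH : g ∈ H := by simpa [shiftPath, hu] using hH u.castSucc
  rw [flatSum, Finset.sum_eq_single_of_mem g hgH]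
  · rw [e, sub_self, hγ.flats_zero]
  · intro j _ hj
    rw [e, hγ.flats_ne _ (by omega)]

-- Translation exchanges two normalizations: joint maximum `0`, and common flat step at level `0`.
-- Under the second the two paths are chosen independently, so the count is a product.
open Classical in
theorem card_sharedPairs_oneFlat {k l : ℕ} (hk : Odd k) (hl : Odd l) :
    ((sharedPairs k l).filter fun p => flatSum (levelRange k l) p.1 = 1 ∧
      flatSum (levelRange k l) p.2 = 1 ∧ ∃ h, flats h p.1 ≠ 0 ∧ flats h p.2 ≠ 0).card =
      (k * (k - 1).choose ((k - 1) / 2)) * (l * (l - 1).choose ((l - 1) / 2)) := by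
  rw [← card_oneFlatPaths hk, ← card_oneFlatPaths hl, ← Finset.card_product]
  symm
  refine Finset.card_bij (fun p _ => (shiftPath (-max (pathMax p.1) (pathMax p.2)) p.1,
    shiftPath (-max (pathMax p.1) (pathMax p.2)) p.2)) ?_ ?_ ?_
  · rintro ⟨γ₁, γ₂⟩ hp
    simp only [Finset.mem_product, mem_oneFlatPaths] at hp
    obtain ⟨h1, h2⟩ := hp
    set M := max (pathMax γ₁) (pathMax γ₂) with hM
    have hflat : flats (-M) (shiftPath (-M) γ₁) ≠ 0 ∧ flats (-M) (shiftPath (-M) γ₂) ≠ 0 := by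
      have e1 := flats_shiftPath γ₁ (-M) 0
      have e2 := flats_shiftPath γ₂ (-M) 0
      rw [zero_add] at e1 e2
      rw [e1, e2, h1.flats_zero, h2.flats_zero]
      simp
    have hmem : (shiftPath (-M) γ₁, shiftPath (-M) γ₂) ∈ sharedPairs k l := by
      rw [mem_sharedPairs]
      refine ⟨isPath_shiftPath.2 h1.isPath, isPath_shiftPath.2 h2.isPath, ?_, -M, Or.inr hflat⟩
      simp only [pathMax_shiftPath]
      rw [max_add_add_right, ← hM, add_neg_cancel]
    have hin := pathIn_of_mem_sharedPairs hmem
    exact Finset.mem_filter.2 ⟨hmem, h1.flatSum_eq_one hin.1.mem, h2.flatSum_eq_one hin.2.mem,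
      -M, hflat⟩
  · rintro ⟨γ₁, γ₂⟩ hp ⟨γ₁', γ₂'⟩ hp' heq
    simp only [Finset.mem_product, mem_oneFlatPaths] at hp hp'
    simp only [Prod.mk.injEq] at heq
    obtain ⟨e1, e2⟩ := heq
    set M := max (pathMax γ₁) (pathMax γ₂)
    set M' := max (pathMax γ₁') (pathMax γ₂')
    have a1 := flats_shiftPath γ₁ (-M) 0
    have a2 := flats_shiftPath γ₁' (-M') (M' - M)
    rw [hp.1.flats_zero, e1] at a1
    -- The translated paths coincide, so `γ₁'` has a flat step at level `M' - M`, and its only flat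
    -- level is `0`.
    have hMM : M' - M = 0 := by
      by_contra hne
      rw [hp'.1.flats_ne _ hne, show M' - M + -M' = 0 + -M by ring, a1] at a2
      exact one_ne_zero a2
    have hMM' : M' = M := by omega
    rw [hMM'] at e1 e2
    have inj : ∀ {q : ℕ} {γ γ' : Fin (q + 1) → ℤ}, shiftPath (-M) γ = shiftPath (-M) γ' →
        γ = γ' := fun {q γ γ'} hh => by
      have := congrArg (shiftPath M) hh
      simpa [shiftPath_shiftPath, shiftPath_zero] using this
    rw [inj e1, inj e2]
  · rintro ⟨γ₁, γ₂⟩ hp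
    obtain ⟨hp, f1, f2, g, hg1, hg2⟩ := Finset.mem_filter.1 hp
    have hin := pathIn_of_mem_sharedPairs hp
    have hmax := (mem_sharedPairs.1 hp).2.2.1
    refine ⟨(shiftPath (-g) γ₁, shiftPath (-g) γ₂), Finset.mem_product.2
      ⟨mem_oneFlatPaths.2 (oneFlat_shiftPath hin.1 f1 hg1),
        mem_oneFlatPaths.2 (oneFlat_shiftPath hin.2 f2 hg2)⟩, ?_⟩
    simp only at hmax
    simp only [pathMax_shiftPath, shiftPath_shiftPath]
    rw [max_add_add_right, hmax]
    simp [shiftPath_zero]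

/-! ### The sum over all pairs -/

theorem PathIn.even_sub_flatSum {k : ℕ} {H J : Finset ℤ} {γ : Fin (k + 1) → ℤ}
    (hγ : PathIn H J γ) : Even (k + flatSum H γ) := by
  have h1 := hγ.flatSum_add_sum_crossings
  have h2 : Even (∑ h ∈ J, crossings h γ) :=
    Finset.even_sum _ fun h _ => even_crossings hγ.isPath h
  obtain ⟨q, hq⟩ := h2
  exact ⟨flatSum H γ + q, by omega⟩

theorem mem_pairs_iff {k l : ℕ} {p : (Fin (k + 1) → ℤ) × (Fin (l + 1) → ℤ)} :
    p ∈ pairs k l ↔ p ∈ sharedPairs k l ∧ flatSum (levelRange k l) p.1 = 0 ∧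
      flatSum (levelRange k l) p.2 = 0 := by
  rw [pairs, Set.Finite.mem_toFinset, mem_sharedPairs]
  constructor
  · rintro ⟨h1, h2, h3, h4, h5, h6⟩
    exact ⟨⟨h1, h2, h3, h4⟩, Finset.sum_eq_zero fun h _ => h5 h, Finset.sum_eq_zero fun h _ => h6 h⟩
  · rintro ⟨h, f1, f2⟩
    have hin := pathIn_of_mem_sharedPairs (mem_sharedPairs.2 h)
    refine ⟨h.1, h.2.1, h.2.2.1, h.2.2.2, fun j => ?_, fun j => ?_⟩
    · by_cases hj : j ∈ levelRange k l
      · exact flatSum_eq_zero f1 j hj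
      · exact hin.1.flats_eq_zero hj
    · by_cases hj : j ∈ levelRange k l
      · exact flatSum_eq_zero f2 j hj
      · exact hin.2.flats_eq_zero hj

theorem prod_eq_pow_half {m : ℕ → ℝ} (hm : ∀ q, m (2 * q) = m 2 ^ q) (S : Finset ℤ) {a : ℤ → ℕ}
    (ha : ∀ g, Even (a g)) : ∏ g ∈ S, m (a g) = m 2 ^ ((∑ g ∈ S, a g) / 2) := by
  choose q hq using fun g => (ha g).two_dvd
  have e : (∑ g ∈ S, a g) / 2 = ∑ g ∈ S, q g := by
    simp only [hq, ← Finset.mul_sum]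
    omega
  rw [e, ← Finset.prod_pow_eq_pow_sum]
  exact Finset.prod_congr rfl fun g _ => by rw [hq, hm]

/-- Crossing numbers are even, so the number of flat steps has the parity of the length. Two even
lengths leave the flat-free pairs. Two odd lengths leave, for `ε = α`, the pairs with one common
flat level, all contributing equally because the even moments are powers of `m 2`. Mixed parities
leave nothing. -/
theorem Entries.sum_pairLimit_div {Ω : Type*} [MeasurableSpace Ω] {μ : Measure Ω}
    [IsProbabilityMeasure μ] {α ε : ℝ} {d b : ℕ → Ω → ℝ} {m : ℕ → ℝ} {C : ℕ → ℕ → ℝ} {v : ℝ}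
    (h : Entries μ α ε d b m C v) (k l : ℕ) :
    (∑ p ∈ sharedPairs k l, pairLimit α ε m C v (levelRange k l) (levels k l) p.1 p.2) /
      (α * (k + l) + 1 - 2 * ε) = covD α ε m C v k l := by
  classical
  have hpar : ∀ p ∈ sharedPairs k l, Even (k + flatSum (levelRange k l) p.1) ∧
      Even (l + flatSum (levelRange k l) p.2) := fun p hp =>
    ⟨(pathIn_of_mem_sharedPairs hp).1.even_sub_flatSum,
      (pathIn_of_mem_sharedPairs hp).2.even_sub_flatSum⟩
  have hm : 0 < ε → ∀ q, m (2 * q) = m 2 ^ q := h.moment_two_mul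
  have hε := h.ε_nonneg
  by_cases heven : Even k ∧ Even l
  · have hsum : ∑ p ∈ sharedPairs k l,
        pairLimit α ε m C v (levelRange k l) (levels k l) p.1 p.2 = ∑ p ∈ pairs k l,
          freeLimit ε m C (levels k l) (fun h => crossings h p.1) fun h => crossings h p.2 := by
      have e : pairs k l = (sharedPairs k l).filter fun p =>
          flatSum (levelRange k l) p.1 = 0 ∧ flatSum (levelRange k l) p.2 = 0 := by
        ext p
        rw [mem_pairs_iff, Finset.mem_filter]
      rw [e, Finset.sum_filter]
      refine Finset.sum_congr rfl fun p hp => ?_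
      rw [pairLimit]
      split_ifs with h1 h2
      · rfl
      · have := (hpar p hp).1
        rw [h2.1] at this
        exact absurd this (by simpa [Nat.even_add_one] using heven.1)
      · rfl
    rw [hsum, covD, if_pos heven]
    split_ifs with h0
    · rw [covZero, h0]
      simp only [freeLimit, if_true]
      ring
    · rw [covEven]
      simp only [freeLimit, if_neg h0]
      rw [div_eq_mul_one_div, mul_comm]
      congr 1
      refine Finset.sum_congr rfl fun p hp => Finset.sum_congr rfl fun g hg => ?_
      congr 1
      obtain ⟨hp, f1, f2⟩ := mem_pairs_iff.1 hp
      have hin := pathIn_of_mem_sharedPairs hp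
      rw [prod_eq_pow_half (hm (lt_of_le_of_ne hε (Ne.symm h0))) _ fun g =>
        (even_crossings hin.1.isPath g).add (even_crossings hin.2.isPath g)]
      congr 2
      -- Without flat steps all crossing numbers add up to `k + l`; removing level `g` leaves the
      -- exponent of the definition.
      have s1 := hin.1.flatSum_add_sum_crossings
      have s2 := hin.2.flatSum_add_sum_crossings
      have s3 := Finset.add_sum_erase (levels k l)
        (fun g => crossings g p.1 + crossings g p.2) hg
      simp only [Finset.sum_add_distrib] at s3 ⊢
      omega
  · have hfree : ∀ p ∈ sharedPairs k l, ¬ (flatSum (levelRange k l) p.1 = 0 ∧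
        flatSum (levelRange k l) p.2 = 0) := by
      rintro p hp ⟨f1, f2⟩
      have := hpar p hp
      rw [f1, f2] at this
      exact heven this
    rw [covD, if_neg heven]
    split_ifs with hodd
    · obtain ⟨hk, hl, hεα⟩ := hodd
      have hterm : ∀ p ∈ sharedPairs k l,
          pairLimit α ε m C v (levelRange k l) (levels k l) p.1 p.2 =
          if flatSum (levelRange k l) p.1 = 1 ∧ flatSum (levelRange k l) p.2 = 1 ∧
            (∃ h, flats h p.1 ≠ 0 ∧ flats h p.2 ≠ 0) then v * m 2 ^ ((k + l - 2) / 2) else 0 := by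
        intro p hp
        rw [pairLimit, if_neg (hfree p hp)]
        simp only [hεα, true_and]
        split_ifs with hc
        · have hin := pathIn_of_mem_sharedPairs hp
          have hm := hm (hεα ▸ h.α_pos)
          have s1 := hin.1.flatSum_add_sum_crossings
          have s2 := hin.2.flatSum_add_sum_crossings
          have ev1 : Even (∑ g ∈ levels k l, crossings g p.1) :=
            Finset.even_sum _ fun g _ => even_crossings hin.1.isPath g
          rw [Finset.prod_mul_distrib, prod_eq_pow_half hm _ fun g => even_crossings hin.1.isPath g,
            prod_eq_pow_half hm _ fun g => even_crossings hin.2.isPath g, ← pow_add]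
          congr 2
          obtain ⟨q, hq⟩ := ev1
          omega
        · rfl
      rw [Finset.sum_congr rfl hterm, ← Finset.sum_filter, Finset.sum_const,
        card_sharedPairs_oneFlat hk hl, covOdd, hεα, nsmul_eq_mul]
      push_cast
      ring
    · rw [Finset.sum_eq_zero, zero_div]
      intro p hp
      rw [pairLimit, if_neg (hfree p hp), if_neg]
      rintro ⟨f1, f2, f3, -⟩
      have := hpar p hp
      rw [f1, f2] at this
      refine hodd ⟨?_, ?_, f3⟩
      · exact Nat.not_even_iff_odd.1 (Nat.even_add_one.1 this.1)
      · exact Nat.not_even_iff_odd.1 (Nat.even_add_one.1 this.2)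

/-! ### The covariance as a bilinear form on polynomials -/

/-- The linear functional with `X ^ k ↦ f k`. -/
noncomputable def polyFunctional (f : ℕ → ℝ) : Polynomial ℝ →ₗ[ℝ] ℝ :=
  Polynomial.lsum fun k => LinearMap.toSpanSingleton ℝ ℝ (f k)

theorem polyFunctional_apply (f : ℕ → ℝ) (P : Polynomial ℝ) :
    polyFunctional f P = ∑ k ∈ Finset.range (P.natDegree + 1), P.coeff k * f k := by
  rw [polyFunctional, Polynomial.lsum_apply, Polynomial.sum_over_range _ (fun n => by simp)]
  simp [LinearMap.toSpanSingleton_apply]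

theorem polyFunctional_X_pow (f : ℕ → ℝ) (k : ℕ) : polyFunctional f (Polynomial.X ^ k) = f k := by
  rw [polyFunctional, Polynomial.lsum_apply, ← Polynomial.monomial_one_right_eq_X_pow,
    Polynomial.sum_monomial_index _ _ (by simp)]
  simp [LinearMap.toSpanSingleton_apply]

/-- The bilinear form with `(X ^ k, X ^ l) ↦ D k l`. -/
noncomputable def polyForm (D : ℕ → ℕ → ℝ) : LinearMap.BilinForm ℝ (Polynomial ℝ) :=
  LinearMap.mk₂ ℝ (fun P Q => polyFunctional (fun k => polyFunctional (D k) Q) P)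
    (fun P P' Q => map_add _ _ _) (fun c P Q => map_smul _ _ _)
    (fun P Q Q' => by
      simp only [map_add, polyFunctional_apply _ P, ← Finset.sum_add_distrib, mul_add])
    (fun c P Q => by
      simp only [map_smul, polyFunctional_apply _ P, smul_eq_mul, Finset.mul_sum]
      exact Finset.sum_congr rfl fun _ _ => by ring)

theorem polyForm_apply (D : ℕ → ℕ → ℝ) (P Q : Polynomial ℝ) :
    polyForm D P Q = polyFunctional (fun k => polyFunctional (D k) Q) P := rfl

theorem polyForm_X_pow (D : ℕ → ℕ → ℝ) (k l : ℕ) :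
    polyForm D (Polynomial.X ^ k) (Polynomial.X ^ l) = D k l := by
  rw [polyForm_apply, polyFunctional_X_pow, polyFunctional_X_pow]

theorem polyForm_self (D : ℕ → ℕ → ℝ) (P : Polynomial ℝ) :
    polyForm D P P = ∑ k ∈ Finset.range (P.natDegree + 1), ∑ l ∈ Finset.range (P.natDegree + 1),
      P.coeff k * P.coeff l * D k l := by
  simp only [polyForm_apply, polyFunctional_apply, Finset.mul_sum, mul_assoc]

/-- The limiting covariance of the powers, with the constant included. -/
noncomputable def covPow (α ε : ℝ) (m : ℕ → ℝ) (C : ℕ → ℕ → ℝ) (v : ℝ) (k l : ℕ) : ℝ :=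
  if 1 ≤ k ∧ 1 ≤ l then covD α ε m C v k l else 0

theorem varP_eq_polyForm (α ε : ℝ) (m : ℕ → ℝ) (C : ℕ → ℕ → ℝ) (v : ℝ) (P : Polynomial ℝ) :
    varP α ε m C v P = polyForm (covPow α ε m C v) P P := by
  have hsub : Finset.Icc 1 P.natDegree ⊆ Finset.range (P.natDegree + 1) := fun k hk => by
    simp only [Finset.mem_Icc] at hk
    simp only [Finset.mem_range]
    omega
  have hz : ∀ k ∈ Finset.range (P.natDegree + 1), k ∉ Finset.Icc 1 P.natDegree → ¬ 1 ≤ k := by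
    intro k hk hk'
    simp only [Finset.mem_Icc, Finset.mem_range] at hk hk'
    omega
  rw [polyForm_self, varP]
  refine (Finset.sum_congr rfl fun k hk => ?_).trans (Finset.sum_subset hsub fun k hk hk' => ?_)
  · refine (Finset.sum_congr rfl fun l hl => ?_).trans (Finset.sum_subset hsub fun l hl hl' => ?_)
    · rw [covPow, if_pos ⟨(Finset.mem_Icc.1 hk).1, (Finset.mem_Icc.1 hl).1⟩]
    · rw [covPow, if_neg fun h => hz l hl hl' h.2, mul_zero]
  · refine Finset.sum_eq_zero fun l _ => ?_
    rw [covPow, if_neg fun h => hz k hk hk' h.1, mul_zero]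

/-! ### Limiting variance and limit law for one polynomial -/

namespace Entries

variable {Ω : Type*} [MeasurableSpace Ω] {μ : Measure Ω} [IsProbabilityMeasure μ] {α ε : ℝ}
  {d b : ℕ → Ω → ℝ} {m : ℕ → ℝ} {C : ℕ → ℕ → ℝ} {v : ℝ}

theorem memLp_traceSum (h : Entries μ α ε d b m C v) (k n : ℕ) :
    MemLp (traceSum d b k n) 2 μ :=
  memLp_finsetSum _ fun γ _ => (h.bdd_single_pathVar γ).memLp_two ()

theorem fluct_eq_polyFunctional (h : Entries μ α ε d b m C v) (P : Polynomial ℝ) (n : ℕ) (ω : Ω) :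
    fluct μ α ε d b P n ω = polyFunctional (fun k => normalizer α ε k n *
        (traceSum d b k n ω - ∫ ω', traceSum d b k n ω' ∂μ)) P := by
  rw [h.fluct_eq, polyFunctional_apply]

theorem fluct_sum (h : Entries μ α ε d b m C v) {ι : Type*} (T : Finset ι) (P : ι → Polynomial ℝ)
    (n : ℕ) (ω : Ω) :
    fluct μ α ε d b (∑ i ∈ T, P i) n ω = ∑ i ∈ T, fluct μ α ε d b (P i) n ω := by
  simp only [h.fluct_eq_polyFunctional, map_sum]

omit [MeasurableSpace Ω] in
theorem traceSum_zero (d b : ℕ → Ω → ℝ) (n : ℕ) :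
    traceSum d b 0 n = fun _ => ((closedPaths 0 n).card : ℝ) := by
  funext ω
  simp [traceSum, pathVar, pathWeight]

theorem tendsto_normalizer_mul_cov' (h : Entries μ α ε d b m C v) (k l : ℕ) :
    Tendsto (fun n : ℕ => normalizer α ε k n * normalizer α ε l n *
        cov[traceSum d b k n, traceSum d b l n; μ]) atTop (𝓝 (covPow α ε m C v k l)) := by
  rw [covPow]
  split_ifs with hkl
  · rw [← h.sum_pairLimit_div]
    exact h.tendsto_normalizer_mul_cov hkl.1 hkl.2
  · have h0 : ∀ n, cov[traceSum d b k n, traceSum d b l n; μ] = 0 := fun n => by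
      rcases (by omega : k = 0 ∨ l = 0) with rfl | rfl
      · rw [traceSum_zero, covariance_const_left]
      · rw [traceSum_zero, covariance_const_right]
    simp only [h0, mul_zero]
    exact tendsto_const_nhds

theorem integral_fluct_sq (h : Entries μ α ε d b m C v) (P : Polynomial ℝ) (n : ℕ) :
    ∫ ω, fluct μ α ε d b P n ω ^ 2 ∂μ = ∑ k ∈ Finset.range (P.natDegree + 1),
      ∑ l ∈ Finset.range (P.natDegree + 1), P.coeff k * P.coeff l *
        (normalizer α ε k n * normalizer α ε l n *
          cov[traceSum d b k n, traceSum d b l n; μ]) := by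
  have hL : ∀ k, MemLp (fun ω => traceSum d b k n ω - ∫ ω', traceSum d b k n ω' ∂μ) 2 μ :=
    fun k => (h.memLp_traceSum k n).sub (memLp_const _)
  have e : ∀ ω, fluct μ α ε d b P n ω ^ 2 = ∑ k ∈ Finset.range (P.natDegree + 1),
      ∑ l ∈ Finset.range (P.natDegree + 1), P.coeff k * P.coeff l *
        (normalizer α ε k n * normalizer α ε l n) *
          ((traceSum d b k n ω - ∫ ω', traceSum d b k n ω' ∂μ) *
            (traceSum d b l n ω - ∫ ω', traceSum d b l n ω' ∂μ)) := fun ω => by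
    rw [h.fluct_eq, sq, Finset.sum_mul_sum]
    exact Finset.sum_congr rfl fun k _ => Finset.sum_congr rfl fun l _ => by ring
  simp only [e]
  have hi : ∀ k l, Integrable (fun ω => P.coeff k * P.coeff l *
        (normalizer α ε k n * normalizer α ε l n) *
          ((traceSum d b k n ω - ∫ ω', traceSum d b k n ω' ∂μ) *
            (traceSum d b l n ω - ∫ ω', traceSum d b l n ω' ∂μ))) μ := fun k l =>
    ((hL k).integrable_mul (hL l)).const_mul _
  rw [integral_finsetSum _ fun k _ => integrable_finsetSum _ fun l _ => hi k l]
  refine Finset.sum_congr rfl fun k _ => ?_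
  rw [integral_finsetSum _ fun l _ => hi k l]
  refine Finset.sum_congr rfl fun l _ => ?_
  rw [integral_const_mul, covariance]
  ring

theorem tendsto_integral_fluct_sq (h : Entries μ α ε d b m C v) (P : Polynomial ℝ) :
    Tendsto (fun n => ∫ ω, fluct μ α ε d b P n ω ^ 2 ∂μ) atTop
      (𝓝 (varP α ε m C v P)) := by
  rw [varP_eq_polyForm, polyForm_self]
  simp only [h.integral_fluct_sq]
  exact tendsto_finsetSum _ fun k _ => tendsto_finsetSum _ fun l _ =>
    (h.tendsto_normalizer_mul_cov' k l).const_mul _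

theorem tendstoNormal_fluct (h : Entries μ α ε d b m C v) (P : Polynomial ℝ) :
    TendstoNormal μ (fluct μ α ε d b P) (varP α ε m C v P) := by
  have h1 := h.tendsto_integral_fluct_sq P
  rw [h.fluct_eq_rowSum] at h1 ⊢
  exact (h.locallyDependent P).tendstoNormal h1

theorem varP_X_pow {k : ℕ} (hk : 1 ≤ k) :
    varP α ε m C v (Polynomial.X ^ k) = covD α ε m C v k k := by
  rw [varP_eq_polyForm, polyForm_X_pow, covPow, if_pos ⟨hk, hk⟩]

/-- Both sides are limits of the same covariances, so no combinatorial symmetry has to be checked.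
-/
theorem covD_comm (h : Entries μ α ε d b m C v) {k l : ℕ} (hk : 1 ≤ k) (hl : 1 ≤ l) :
    covD α ε m C v k l = covD α ε m C v l k := by
  have h1 := h.tendsto_normalizer_mul_cov' k l
  have h2 := h.tendsto_normalizer_mul_cov' l k
  rw [covPow, if_pos ⟨hk, hl⟩] at h1
  rw [covPow, if_pos ⟨hl, hk⟩] at h2
  refine tendsto_nhds_unique h1 (h2.congr fun n => ?_)
  rw [covariance_comm, mul_comm (normalizer α ε l n)]

end Entries

/-! ### Polarization -/

/-- Expand the power over maps `f` into `T`. The alternating sum over all `T` containing the image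
of `f` vanishes unless `f` is onto, so only the `j!` permutations remain, each with `T` everything.
-/
theorem sum_neg_one_pow_card_mul_pow {j : ℕ} (y : Fin j → ℝ) :
    ∑ T : Finset (Fin j), (-1 : ℝ) ^ T.card * (∑ i ∈ T, y i) ^ j =
      (-1) ^ j * (j.factorial * ∏ i, y i) := by
  have h1 : ∀ T : Finset (Fin j), (∑ i ∈ T, y i) ^ j =
      ∑ f : Fin j → Fin j, ∏ a, (if f a ∈ T then y (f a) else 0) := fun T => by
    have e : ∑ i ∈ T, y i = ∑ i, if i ∈ T then y i else 0 := by simp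
    rw [e, ← Fintype.piFinset_univ, ← Finset.prod_univ_sum (fun _ => Finset.univ)
      (fun _ i => if i ∈ T then y i else 0)]
    simp
  have h2 : ∀ f : Fin j → Fin j, ∑ T : Finset (Fin j),
      (-1 : ℝ) ^ T.card * ∏ a, (if f a ∈ T then y (f a) else 0) =
        if Function.Bijective f then (-1) ^ j * ∏ i, y i else 0 := by
    intro f
    -- The alternating sum over `T` is an expanded product whose factor at an index outside the
    -- image of `f` is `-1 + 1`.
    have e1 := Finset.prod_add (fun _ : Fin j => (-1 : ℝ))
      (fun i => if i ∈ Finset.univ.image f then 0 else 1) Finset.univ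
    have e2 : ∀ T : Finset (Fin j), ∏ a, (if f a ∈ T then y (f a) else 0) =
        (∏ i ∈ Finset.univ \ T, if i ∈ Finset.univ.image f then (0 : ℝ) else 1) *
          ∏ a, y (f a) := by
      intro T
      by_cases hT : ∀ a, f a ∈ T
      · rw [Finset.prod_eq_one (s := Finset.univ \ T), one_mul]
        · exact Finset.prod_congr rfl fun a _ => if_pos (hT a)
        · intro i hi
          rw [if_neg]
          intro hi'
          obtain ⟨a, -, rfl⟩ := Finset.mem_image.1 hi'
          exact (Finset.mem_sdiff.1 hi).2 (hT a)
      · push Not at hT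
        obtain ⟨a, ha⟩ := hT
        rw [Finset.prod_eq_zero (Finset.mem_univ a) (if_neg ha),
          Finset.prod_eq_zero (i := f a) (s := Finset.univ \ T) (by simpa using ha) (by simp),
          zero_mul]
    have e3 : ∑ T : Finset (Fin j), (-1 : ℝ) ^ T.card *
        ∏ a, (if f a ∈ T then y (f a) else 0) =
        (∏ i : Fin j, ((-1 : ℝ) + if i ∈ Finset.univ.image f then 0 else 1)) *
          ∏ a, y (f a) := by
      rw [e1, Finset.sum_mul, Finset.powerset_univ]
      refine Finset.sum_congr rfl fun T _ => ?_
      rw [e2, Finset.prod_const, mul_assoc]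
    rw [e3]
    split_ifs with hf
    · rw [hf.prod_comp y]
      congr 1
      have : ∀ i, i ∈ Finset.univ.image f := fun i => by
        obtain ⟨a, rfl⟩ := hf.2 i
        simp
      simp [this]
    · have hs : ¬ Function.Surjective f := fun hs => hf (Finite.injective_iff_bijective.1
        (Finite.injective_iff_surjective.2 hs))
      rw [Function.Surjective] at hs
      push Not at hs
      obtain ⟨i, hi⟩ := hs
      rw [Finset.prod_eq_zero (Finset.mem_univ i), zero_mul]
      rw [if_neg]
      · ring
      · intro hi'
        obtain ⟨a, -, ha⟩ := Finset.mem_image.1 hi'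
        exact hi a ha
  simp only [h1, Finset.mul_sum]
  rw [Finset.sum_comm]
  simp only [h2]
  have h3 : ∑ f : Fin j → Fin j, (if Function.Bijective f then (-1 : ℝ) ^ j * ∏ i, y i else 0) =
      ∑ _σ : Equiv.Perm (Fin j), (-1 : ℝ) ^ j * ∏ i, y i := by
    symm
    refine Finset.sum_of_injOn (fun σ => ⇑σ) (fun σ _ τ _ h => Equiv.coe_fn_injective h)
      (fun σ _ => Finset.mem_coe.2 (Finset.mem_univ _)) (fun f _ hf => ?_) (fun σ _ => ?_)
    · rw [if_neg]
      intro hb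
      exact hf ⟨Equiv.ofBijective f hb, by simp, rfl⟩
    · rw [if_pos σ.bijective]
  rw [h3, Finset.sum_const, Finset.card_univ, Fintype.card_perm, Fintype.card_fin, nsmul_eq_mul]
  ring

theorem prod_eq_sum_pow {j : ℕ} (y : Fin j → ℝ) :
    ∏ i, y i = ∑ T : Finset (Fin j), ((-1 : ℝ) ^ j / j.factorial * (-1) ^ T.card) *
      (∑ i ∈ T, y i) ^ j := by
  simp only [mul_assoc]
  rw [← Finset.mul_sum, sum_neg_one_pow_card_mul_pow]
  have h1 : ((-1 : ℝ) ^ j) * (-1) ^ j = 1 := by rw [← mul_pow]; simp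
  have h2 : (j.factorial : ℝ) ≠ 0 := by positivity
  field_simp
  linear_combination (-∏ i, y i) * h1

/-! ### Gram factorization of a positive semidefinite form along a sequence -/

section Gram

variable {V : Type*} [AddCommGroup V] [Module ℝ V]

/-- The Schur complement of a form with respect to a vector. -/
noncomputable def schur (B : LinearMap.BilinForm ℝ V) (e : V) : LinearMap.BilinForm ℝ V :=
  B - (B e e)⁻¹ • LinearMap.BilinForm.linMulLin (B e) (B e)

theorem schur_apply (B : LinearMap.BilinForm ℝ V) (e x y : V) :
    schur B e x y = B x y - (B e e)⁻¹ * (B e x * B e y) := rfl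

/-- A symmetric positive semidefinite form. -/
def SymmNonneg (B : LinearMap.BilinForm ℝ V) : Prop := (∀ x y, B x y = B y x) ∧ ∀ x, 0 ≤ B x x

theorem SymmNonneg.sq_le {B : LinearMap.BilinForm ℝ V} (hB : SymmNonneg B) (x y : V) :
    B x y ^ 2 ≤ B x x * B y y :=
  LinearMap.BilinForm.apply_sq_le_of_symm B hB.2 ⟨hB.1⟩ x y

/-- Nonnegativity is Cauchy-Schwarz for `e` and `x`. If `B e e = 0`, the inverse is `0` and nothing
is subtracted. -/
theorem SymmNonneg.schur {B : LinearMap.BilinForm ℝ V} (hB : SymmNonneg B) (e : V) :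
    SymmNonneg (schur B e) := by
  refine ⟨fun x y => ?_, fun x => ?_⟩
  · rw [schur_apply, schur_apply, hB.1 x y]; ring
  · rw [schur_apply]
    rcases (hB.2 e).eq_or_lt with h | h
    · simpa [← h] using hB.2 x
    · have h1 := hB.sq_le e x
      rw [sub_nonneg, inv_mul_le_iff₀ h]
      nlinarith

/-- In the degenerate case `B e e = 0`, Cauchy-Schwarz already forces `B e y = 0`. -/
theorem SymmNonneg.schur_self {B : LinearMap.BilinForm ℝ V} (hB : SymmNonneg B) (e y : V) :
    Tridiag.schur B e e y = 0 := by
  rw [schur_apply]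
  rcases (hB.2 e).eq_or_lt with h | h
  · have h1 := hB.sq_le e y
    rw [← h, zero_mul] at h1
    have h2 : B e y = 0 := by nlinarith
    simp [h2]
  · field_simp
    ring

theorem schur_eq_zero {B : LinearMap.BilinForm ℝ V} (hB : SymmNonneg B) {x : V}
    (hx : ∀ y, B x y = 0) (e y : V) : schur B e x y = 0 := by
  rw [schur_apply, hx, hB.1 e x, hx]; ring

/-- The iterated Schur complements along a sequence of vectors. -/
noncomputable def schurSeq (B : LinearMap.BilinForm ℝ V) (e : ℕ → V) : ℕ → LinearMap.BilinForm ℝ V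
  | 0 => B
  | n + 1 => schur (schurSeq B e n) (e n)

theorem SymmNonneg.schurSeq {B : LinearMap.BilinForm ℝ V} (hB : SymmNonneg B) (e : ℕ → V) (n : ℕ) :
    SymmNonneg (schurSeq B e n) := by
  induction n with
  | zero => exact hB
  | succ n ih => exact ih.schur _

theorem schurSeq_eq_zero {B : LinearMap.BilinForm ℝ V} (hB : SymmNonneg B) (e : ℕ → V) {k n : ℕ}
    (hk : k < n) (y : V) : schurSeq B e n (e k) y = 0 := by
  induction n generalizing y with
  | zero => omega
  | succ n ih =>
    rcases Nat.lt_succ_iff_lt_or_eq.1 hk with h | rfl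
    · exact schur_eq_zero (hB.schurSeq e n) (ih h) _ _
    · exact (hB.schurSeq e k).schur_self _ _

/-- The coefficients of the triangular factorization. -/
noncomputable def gramCoeff (B : LinearMap.BilinForm ℝ V) (e : ℕ → V) (k j : ℕ) : ℝ :=
  schurSeq B e j (e j) (e k) / √(schurSeq B e j (e j) (e j))

theorem gramCoeff_eq_zero {B : LinearMap.BilinForm ℝ V} (hB : SymmNonneg B) (e : ℕ → V) {k j : ℕ}
    (h : k < j) : gramCoeff B e k j = 0 := by
  rw [gramCoeff, (hB.schurSeq e j).1, schurSeq_eq_zero hB e h, zero_div]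

/-- Each Schur step subtracts the rank-one form given by one column of coefficients, so the sum
telescopes; once `e k` has been processed the remaining form annihilates it. -/
theorem sum_gramCoeff_mul {B : LinearMap.BilinForm ℝ V} (hB : SymmNonneg B) (e : ℕ → V) {k n : ℕ}
    (l : ℕ) (hk : k < n) :
    ∑ j ∈ Finset.range n, gramCoeff B e k j * gramCoeff B e l j = B (e k) (e l) := by
  have key : ∀ n, ∑ j ∈ Finset.range n, gramCoeff B e k j * gramCoeff B e l j =
      B (e k) (e l) - schurSeq B e n (e k) (e l) := by
    intro n
    induction n with
    | zero => simp [schurSeq]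
    | succ n ih =>
      rw [Finset.sum_range_succ, ih, schurSeq, schur_apply, gramCoeff, gramCoeff,
        div_mul_div_comm, Real.mul_self_sqrt ((hB.schurSeq e n).2 _)]
      ring
  rw [key, schurSeq_eq_zero hB e hk, sub_zero]

end Gram

/-! ### The Gaussian family -/

/-- The product of standard normal laws. -/
noncomputable def stdSeq : Measure (ℕ+ → ℝ) := Measure.infinitePi fun _ => gaussianReal 0 1

instance : IsProbabilityMeasure stdSeq := by unfold stdSeq; infer_instance

theorem iIndepFun_stdSeq : iIndepFun (fun (i : ℕ+) (x : ℕ+ → ℝ) => x i) stdSeq :=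
  iIndepFun_infinitePi (X := fun _ x => x) fun _ => measurable_id

theorem map_eval_stdSeq (i : ℕ+) : stdSeq.map (fun x => x i) = gaussianReal 0 1 :=
  (measurePreserving_eval_infinitePi (fun _ : ℕ+ => gaussianReal 0 1) i).map_eq

theorem hasGaussianLaw_stdSeq (i : ℕ+) : HasGaussianLaw (fun x : ℕ+ → ℝ => x i) stdSeq :=
  ⟨by rw [map_eval_stdSeq]; infer_instance⟩

theorem isGaussianProcess_stdSeq : IsGaussianProcess (fun (i : ℕ+) (x : ℕ+ → ℝ) => x i) stdSeq :=
  ⟨fun I => iIndepFun.hasGaussianLaw (X := fun (i : I) (x : ℕ+ → ℝ) => x i)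
    (fun i => hasGaussianLaw_stdSeq i) (iIndepFun_stdSeq.precomp Subtype.val_injective)⟩

theorem integral_stdSeq (i : ℕ+) : ∫ x, x i ∂stdSeq = 0 := by
  have h := integral_map (μ := stdSeq) (φ := fun x : ℕ+ → ℝ => x i) (f := fun y : ℝ => y)
    (measurable_pi_apply i).aemeasurable (by fun_prop)
  rw [← h, map_eval_stdSeq, integral_id_gaussianReal]

theorem covariance_stdSeq (i j : ℕ+) :
    cov[fun x : ℕ+ → ℝ => x i, fun x => x j; stdSeq] = if i = j then 1 else 0 := by
  split_ifs with hij
  · subst hij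
    rw [covariance_self (measurable_pi_apply i).aemeasurable]
    have h := variance_map (μ := stdSeq) (X := fun y : ℝ => y) (Y := fun x : ℕ+ → ℝ => x i)
      (by fun_prop) (measurable_pi_apply i).aemeasurable
    have h2 : Var[fun x : ℕ+ → ℝ => x i; stdSeq] =
      Var[(fun y : ℝ => y) ∘ fun x : ℕ+ → ℝ => x i; stdSeq] := rfl
    rw [h2, ← h, map_eval_stdSeq]
    exact variance_id_gaussianReal
  · exact (iIndepFun_stdSeq.indepFun hij).covariance_eq_zero (hasGaussianLaw_stdSeq i).memLp_two
      (hasGaussianLaw_stdSeq j).memLp_two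

/-- The Gaussian family with triangular coefficients `c`. -/
noncomputable def triangular (c : ℕ → ℕ → ℝ) (k : ℕ+) (x : ℕ+ → ℝ) : ℝ :=
  ∑ j ∈ Finset.range k, c k.natPred j * x j.succPNat

theorem memLp_stdSeq_mul (a : ℝ) (i : ℕ+) : MemLp (fun x : ℕ+ → ℝ => a * x i) 2 stdSeq :=
  (hasGaussianLaw_stdSeq i).memLp_two.const_mul a

theorem isGaussianProcess_triangular (c : ℕ → ℕ → ℝ) : IsGaussianProcess (triangular c) stdSeq := by
  classical
  refine isGaussianProcess_stdSeq.of_isGaussianProcess fun k =>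
    ⟨(Finset.range k).image Nat.succPNat, ∑ j ∈ (Finset.range k).attach, c k.natPred j •
      ContinuousLinearMap.proj ⟨(j : ℕ).succPNat, Finset.mem_image_of_mem _ j.2⟩, fun x => ?_⟩
  rw [triangular, ← Finset.sum_attach]
  simp [Finset.restrict_def]

theorem integral_triangular (c : ℕ → ℕ → ℝ) (k : ℕ+) : ∫ x, triangular c k x ∂stdSeq = 0 := by
  simp only [triangular]
  rw [integral_finsetSum _ fun j _ => (memLp_stdSeq_mul _ _).integrable one_le_two]
  exact Finset.sum_eq_zero fun j _ => by rw [integral_const_mul, integral_stdSeq, mul_zero]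

theorem covariance_triangular (c : ℕ → ℕ → ℝ) (hc : ∀ k j, k < j → c k j = 0) (k l : ℕ+) :
    cov[triangular c k, triangular c l; stdSeq] =
      ∑ j ∈ Finset.range k, c k.natPred j * c l.natPred j := by
  have h := covariance_fun_sum_fun_sum' (μ := stdSeq) (s := Finset.range k) (t := Finset.range l)
    (X := fun j (x : ℕ+ → ℝ) => c k.natPred j * x j.succPNat)
    (Y := fun j (x : ℕ+ → ℝ) => c l.natPred j * x j.succPNat)
    (fun j _ => memLp_stdSeq_mul _ _) (fun j _ => memLp_stdSeq_mul _ _)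
  refine h.trans (Finset.sum_congr rfl fun i hi => ?_)
  have e : ∀ j, cov[fun x : ℕ+ → ℝ => c k.natPred i * x i.succPNat,
      fun x => c l.natPred j * x j.succPNat; stdSeq] =
      if i = j then c k.natPred i * c l.natPred i else 0 := fun j => by
    rw [covariance_const_mul_left, covariance_const_mul_right, covariance_stdSeq]
    by_cases hij : i = j
    · subst hij; simp
    · rw [if_neg (fun h => hij (Nat.succPNat_injective h)), if_neg hij]; ring
  simp only [e]
  rw [Finset.sum_ite_eq]
  split_ifs with hil
  · rfl
  -- Here `i ≥ l`, so `i` exceeds the zero-based index of `l` and triangularity applies.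
  · rw [hc l.natPred i, mul_zero]
    have := l.natPred_add_one
    rw [Finset.mem_range] at hil
    omega

theorem polyForm_comm {D : ℕ → ℕ → ℝ} (hD : ∀ k l, D k l = D l k) (P Q : Polynomial ℝ) :
    polyForm D P Q = polyForm D Q P := by
  simp only [polyForm_apply, polyFunctional_apply, Finset.mul_sum]
  rw [Finset.sum_comm]
  exact Finset.sum_congr rfl fun l _ => Finset.sum_congr rfl fun k _ => by rw [hD k l]; ring

theorem HasGaussianLaw.integrable_pow_and_integral_pow {Ω : Type*} [MeasurableSpace Ω]
    {μ : Measure Ω} {X : Ω → ℝ} (hX : HasGaussianLaw X μ) (h0 : ∫ ω, X ω ∂μ = 0) (j : ℕ) :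
    Integrable (fun ω => X ω ^ j) μ ∧
      ∫ ω, X ω ^ j ∂μ = ∫ x, x ^ j ∂gaussianReal 0 (Var[X; μ]).toNNReal := by
  have h1 := hX.map_eq_gaussianReal
  rw [h0] at h1
  have hm : AEMeasurable X μ := hX.aemeasurable
  constructor
  · have h2 := integrable_pow_gaussianReal (Var[X; μ]).toNNReal j
    rw [← h1] at h2
    exact (integrable_map_measure (measurable_id.pow_const j).aestronglyMeasurable hm).1 h2
  · rw [← h1]
    exact (integral_map hm (measurable_id.pow_const j).aestronglyMeasurable).symm

/-! ### The Gaussian limit family and joint moments -/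

namespace Entries

variable {Ω : Type*} [MeasurableSpace Ω] {μ : Measure Ω} [IsProbabilityMeasure μ] {α ε : ℝ}
  {d b : ℕ → Ω → ℝ} {m : ℕ → ℝ} {C : ℕ → ℕ → ℝ} {v : ℝ}

/-- The diagonal values are limits of second moments of fluctuations, hence nonnegative. -/
theorem symmNonneg_polyForm (h : Entries μ α ε d b m C v) :
    SymmNonneg (polyForm (covPow α ε m C v)) := by
  refine ⟨polyForm_comm fun k l => ?_, fun P => ?_⟩
  · by_cases hkl : 1 ≤ k ∧ 1 ≤ l
    · rw [covPow, covPow, if_pos hkl, if_pos hkl.symm, h.covD_comm hkl.1 hkl.2]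
    · rw [covPow, covPow, if_neg hkl, if_neg fun hh => hkl hh.symm]
  · rw [← varP_eq_polyForm]
    exact (h.tendstoNormal_fluct P).1

theorem exists_gaussian_family (h : Entries μ α ε d b m C v) :
    ∃ S : ℕ+ → (ℕ+ → ℝ) → ℝ, IsGaussianProcess S stdSeq ∧ (∀ k, ∫ x, S k x ∂stdSeq = 0) ∧
      ∀ k l : ℕ+, cov[S k, S l; stdSeq] = covD α ε m C v k l := by
  set B := polyForm (covPow α ε m C v)
  -- The sequence starts at `X`, so index `k.natPred` belongs to the power `X ^ k`.
  set e : ℕ → Polynomial ℝ := fun j => Polynomial.X ^ (j + 1) with he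
  have hB := h.symmNonneg_polyForm
  refine ⟨triangular (gramCoeff B e), isGaussianProcess_triangular _, integral_triangular _,
    fun k l => ?_⟩
  have hk := k.natPred_add_one
  have hl := l.natPred_add_one
  rw [covariance_triangular _ fun k j hkj => gramCoeff_eq_zero hB e hkj,
    sum_gramCoeff_mul hB e _ (by omega)]
  simp only [he]
  rw [hk, hl, polyForm_X_pow, covPow, if_pos ⟨k.2, l.2⟩]

/-- Polarization writes both mixed moments as the same combination of `j`-th moments of partial
sums. A partial sum of fluctuations is the fluctuation of the polynomial `P T`, and its limiting
variance is that of the corresponding sum of the `S (k i)`. -/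
theorem tendsto_joint_moment (h : Entries μ α ε d b m C v) {Ω' : Type*} [MeasurableSpace Ω']
    {ν : Measure Ω'} {S : ℕ+ → Ω' → ℝ} (hS : IsGaussianProcess S ν)
    (h0 : ∀ k, ∫ x, S k x ∂ν = 0)
    (hcov : ∀ k l : ℕ+, cov[S k, S l; ν] = covD α ε m C v k l) (j : ℕ) (k : Fin j → ℕ+) :
    (∀ n, Integrable (fun ω => ∏ i, fluct μ α ε d b (Polynomial.X ^ (k i : ℕ)) n ω) μ) ∧
      Tendsto (fun n => ∫ ω, ∏ i, fluct μ α ε d b (Polynomial.X ^ (k i : ℕ)) n ω ∂μ) atTop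
        (𝓝 (∫ x, ∏ i, S (k i) x ∂ν)) := by
  have hν := hS.isProbabilityMeasure
  set P : Finset (Fin j) → Polynomial ℝ := fun T => ∑ i ∈ T, Polynomial.X ^ (k i : ℕ) with hP
  have hL : ∀ i, MemLp (S (k i)) 2 ν := fun i => (hS.hasGaussianLaw_eval (k i)).memLp_two
  have hvar : ∀ T, Var[fun x => ∑ i ∈ T, S (k i) x; ν] = varP α ε m C v (P T) := fun T => by
    rw [variance_fun_sum' fun i _ => hL i, varP_eq_polyForm]
    simp only [hP, map_sum, LinearMap.sum_apply, polyForm_X_pow]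
    rw [Finset.sum_comm]
    refine Finset.sum_congr rfl fun i _ => Finset.sum_congr rfl fun i' _ => ?_
    rw [hcov, covPow, if_pos ⟨(k i').2, (k i).2⟩]
  have hgauss : ∀ T : Finset (Fin j), HasGaussianLaw (fun x => ∑ i ∈ T, S (k i) x) ν := fun T =>
    (hS.comp_right k).hasGaussianLaw_fun_sum (I := T)
  have hmean : ∀ T : Finset (Fin j), ∫ x, ∑ i ∈ T, S (k i) x ∂ν = 0 := fun T => by
    rw [integral_finsetSum _ fun i _ => (hL i).integrable one_le_two]
    exact Finset.sum_eq_zero fun i _ => h0 _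
  have hmom := fun T => HasGaussianLaw.integrable_pow_and_integral_pow (hgauss T) (hmean T) j
  have hconv := fun T => (h.tendstoNormal_fluct (P T)).2.2 j
  have e : ∀ n ω, ∏ i, fluct μ α ε d b (Polynomial.X ^ (k i : ℕ)) n ω =
      ∑ T : Finset (Fin j), ((-1 : ℝ) ^ j / j.factorial * (-1) ^ T.card) *
        fluct μ α ε d b (P T) n ω ^ j := fun n ω => by
    rw [prod_eq_sum_pow]
    simp only [hP, h.fluct_sum]
  simp only [e, prod_eq_sum_pow fun i => S (k i) _]
  refine ⟨fun n => integrable_finsetSum _ fun T _ => ((hconv T).1 n).const_mul _, ?_⟩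
  rw [integral_finsetSum _ fun T _ => (hmom T).1.const_mul _]
  simp only [integral_finsetSum _ fun T _ => ((hconv T).1 _).const_mul _]
  simp only [integral_const_mul]
  refine tendsto_finsetSum _ fun T _ => Tendsto.const_mul _ ?_
  rw [(hmom T).2, hvar]
  exact (hconv T).2

end Entries

end Tridiag

theorem theorem5 {Ω : Type*} [MeasurableSpace Ω] (μ : Measure Ω) [IsProbabilityMeasure μ]
    (α : ℝ) (hα : 0 < α)
    -- the entries `d n`, `b n` for `n ≥ 1` (the index `0` is not used)
    (d b : ℕ → Ω → ℝ)
    (hdmeas : ∀ n, 1 ≤ n → Measurable (d n)) (hbmeas : ∀ n, 1 ≤ n → Measurable (b n))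
    (hindep : iIndepFun (Sum.elim (fun n : ℕ+ => d n) (fun n : ℕ+ => b n)) μ)
    -- moments of `b n / n ^ α` are finite and converge
    (hbint : ∀ n, 1 ≤ n → ∀ k : ℕ, Integrable (fun ω => |b n ω| ^ k) μ)
    (m : ℕ → ℝ) (hm0 : m 0 = 1)
    (hm : ∀ k : ℕ,
      Tendsto (fun n : ℕ => ∫ ω, (b n ω / (n : ℝ) ^ α) ^ k ∂μ) atTop (𝓝 (m k)))
    -- the absolute moments of `d n` are finite and bounded in `n`
    (hdint : ∀ n, 1 ≤ n → ∀ k : ℕ, Integrable (fun ω => |d n ω| ^ k) μ)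
    (hdbdd : ∀ k : ℕ, ∃ K : ℝ, ∀ n, 1 ≤ n → ∫ ω, |d n ω| ^ k ∂μ ≤ K)
    -- the variances of `d n` converge
    (σd : ℝ) (hσd : Tendsto (fun n => Var[d n; μ]) atTop (𝓝 (σd ^ 2)))
    -- the fluctuations of the powers of `b n / n ^ α`
    (ε : ℝ) (hε0 : 0 ≤ ε) (hεα : ε ≤ α)
    (C : ℕ → ℕ → ℝ)
    (hC : ∀ k l : ℕ, Even k → Even l →
      Tendsto (fun n => cov[Tridiag.zfl μ α ε b n k, Tridiag.zfl μ α ε b n l; μ]) atTop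
        (𝓝 (C k l)))
    (hz : ∀ k r : ℕ, 1 ≤ k → 1 ≤ r →
      ∃ K : ℝ, ∀ n, 1 ≤ n → ∫ ω, |Tridiag.zfl μ α ε b n k ω| ^ r ∂μ ≤ K) :
    -- convergence of `S_n(P)` to the centred normal law of variance `σ(P)²`
    (∀ P : Polynomial ℝ,
      Tridiag.TendstoNormal μ (Tridiag.fluct μ α ε d b P)
        (Tridiag.varP α ε m C (σd ^ 2) P)) ∧
    -- joint convergence in moments of `S_n(k)`, `k ≥ 1`, to a centred Gaussian family with
    -- covariance `D(k,l)`
    (∃ (ν : Measure (ℕ+ → ℝ)) (S : ℕ+ → (ℕ+ → ℝ) → ℝ),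
      IsProbabilityMeasure ν ∧ IsGaussianProcess S ν ∧
      (∀ k, ∫ x, S k x ∂ν = 0) ∧
      (∀ k l : ℕ+, cov[S k, S l; ν] = Tridiag.covD α ε m C (σd ^ 2) k l) ∧
      ∀ (j : ℕ) (k : Fin j → ℕ+),
        (∀ n, Integrable
          (fun ω => ∏ i, Tridiag.fluct μ α ε d b (Polynomial.X ^ (k i : ℕ)) n ω) μ) ∧
        Tendsto
          (fun n => ∫ ω, ∏ i, Tridiag.fluct μ α ε d b (Polynomial.X ^ (k i : ℕ)) n ω ∂μ)
          atTop (𝓝 (∫ x, ∏ i, S (k i) x ∂ν))) ∧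
    -- each `S_n(k)` converges to the centred normal law of variance `D(k,k)`
    (∀ k : ℕ, 1 ≤ k →
      Tridiag.TendstoNormal μ (Tridiag.fluct μ α ε d b (Polynomial.X ^ k))
        (Tridiag.covD α ε m C (σd ^ 2) k k)) := by
  have h : Tridiag.Entries μ α ε d b m C (σd ^ 2) :=
    ⟨hα, hε0, hεα, hdmeas, hbmeas, hindep, hbint, hm0, hm, hdint, hdbdd, hσd, hC, hz⟩
  refine ⟨h.tendstoNormal_fluct, ?_, fun k hk => ?_⟩
  · obtain ⟨S, hS, hS0, hcov⟩ := h.exists_gaussian_family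
    exact ⟨Tridiag.stdSeq, S, inferInstance, hS, hS0, hcov, h.tendsto_joint_moment hS hS0 hcov⟩
  · rw [← Tridiag.Entries.varP_X_pow hk]
    exact h.tendstoNormal_fluct _
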